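/- Let $\Gamma$ be a countably infinite connected graph with symmetric edge weights $\mu_{x,y}=\mu_{y,x}>0$ for $x\sim y$ (and $\mu_{x,y}=0$ otherwise) such that $\mu(x)=\sum_{y\sim x}\mu_{x,y}<\infty$ for every vertex $x$. Let $(X_n)$ be the random walk with transition probabilities $P(x,y)=\mu_{x,y}/\mu(x)$, let $P_n(x,y)=\mathbb P(X_n=y\mid X_0=x)$ and $p_n(x,y)=P_n(x,y)/\mu(y)$. Let $d$ be the graph distance, $B(x,R)=\{y: d(x,y)<R\}$ and $V(x,R)=\sum_{y\in B(x,R)}\mu(y)$. Let $E(x,R)$ be the expectation, for the walk started at $x$, of the exit time $\min\{k: X_k\notin B(x,R)\}$, and for $n\in\mathbb N$ let $e(x,n)=\min\{R\in\mathbb N: E(x,R)\ge n\}$. For $A\subset\Gamma$ let $P^A(x,y)=P(x,y)$ if $x,y\in A$ and $P^A(x,y)=0$ otherwise, let $P^A_k$ be the iterates of $P^A$ (with $P^A_0(x,y)=1$ if $x=y\in A$ and $0$ otherwise), and let $g^A(y,z)=\frac1{\mu(z)}\sum_{k\ge0}P^A_k(y,z)$ be the Green kernel. A function $h$ is harmonic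 on $A$ if it is defined on $A$ and on the neighbours of points of $A$, and $\sum_yP(x,y)h(y)=h(x)$ for all $x\in A$. Assume - $(p_0)$: there is $p_0>0$ with $\mu_{x,y}/\mu(x)\ge p_0$ whenever $x\sim y$; - $(VD)$: there is $D_V>0$ with $V(x,2R)\le D_V\,V(x,R)$ for all $x\in\Gamma$, $R>0$; - $(TC)$: there is $C_T>1$ with $E(x,2R)/E(y,R)\le C_T$ for all $x\in\Gamma$, $R>0$, $y\in B(x,R)$. Let $0\le c_1<c_2$ be fixed real constants. Then the following six statements are equivalent. 1. $(DUE)$: there is $C>0$ such that for all $x\in\Gamma$ and all integers $n>0$, $$p_n(x,x)\le\frac{C}{V(x,e(x,n))}.$$ 2. $(UE)$: there are $C,\beta>1$ and $c>0$ such that for all $x,y\in\Gamma$ and all integers $n>0$, $$p_n(x,y)\le\frac{C}{V(x,e(x,n))}\exp\left[-c\left(\frac{E(x,d(x,y))}{n}\right)^{\frac1{\beta-1}}\right].$$ 3. Parabolic mean value inequality: there is $C>1$ such that for all $x\in\Gamma$ and $R>0$, with $B=B(x,R)$, $E=E(x,R)$, $m=\lfloor c_1E\rfloor$, $n=\lfloor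 c_2E\rfloor$, every family of functions $u_i\ge0$ on $B$, $0\le i\le n$, with $u_{i+1}(z)=\sum_{y\in B}P(z,y)u_i(y)$ for $z\in B$, $0\le i<n$, satisfies $$u_n(x)\le\frac{C}{V(x,R)E(x,R)}\sum_{i=m}^{n}\sum_{y\in B}u_i(y)\mu(y).$$ 4. $(MV)$: there is $C>0$ such that for all $x\in\Gamma$, $R>0$ and every function $u\ge0$ harmonic on $B=B(x,R)$, $$u(x)\le\frac{C}{V(x,R)}\sum_{y\in B}u(y)\mu(y).$$ 5. Mean value property of the Green kernels: there is $C>1$ such that for all $x\in\Gamma$, $R>0$ and $y\in\Gamma$ with $d=d(x,y)>0$, with $B=B(x,R)$, $$g^B(y,x)\le\frac{C}{V(x,d)}\sum_{z\in B(x,d)}g^B(y,z)\mu(z).$$ 6. Green kernel bound: there is $C>1$ such that for all $x\in\Gamma$, $R>0$ and $y\in\Gamma$ with $d=d(x,y)>0$, with $B=B(x,R)$, $$g^B(y,x)\le C\,\frac{E(x,R)}{V(x,d)}.$$ -/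

import Mathlib

open MeasureTheory ProbabilityTheory
open scoped ENNReal

/-- A connected weighted graph: positive symmetric weights on the edges, extended by zero to the
pairs which are not edges, with finite total weight at every vertex. -/
structure WeightedGraph (Γ : Type*) where
  graph : SimpleGraph Γ
  connected : graph.Connected
  weight : Γ → Γ → ℝ
  weight_symm : ∀ x y, weight x y = weight y x
  weight_pos : ∀ x y, graph.Adj x y → 0 < weight x y
  weight_eq_zero : ∀ x y, ¬ graph.Adj x y → weight x y = 0
  summable_weight : ∀ x, Summable (weight x)

namespace WeightedGraph

noncomputable section

variable {Γ : Type*} (G : WeightedGraph Γ)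

/-- The measure `μ(x) = ∑_{y ∼ x} μ_{x,y}` of a vertex. -/
def mass (x : Γ) : ℝ := ∑' y, G.weight x y

/-- One step transition probabilities `P(x,y) = μ_{x,y} / μ(x)`. -/
def P (x y : Γ) : ℝ := G.weight x y / G.mass x

/-- The open ball `B(x,R)` of the graph distance. -/
def ball (x : Γ) (R : ℝ) : Set Γ := {y | (G.graph.dist x y : ℝ) < R}

/-- The volume `V(x,R) = μ(B(x,R))`. -/
def V (x : Γ) (R : ℝ) : ℝ := ∑' y : G.ball x R, G.mass y

theorem weight_nonneg (x y : Γ) : 0 ≤ G.weight x y := by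
  by_cases h : G.graph.Adj x y
  · exact (G.weight_pos x y h).le
  · exact (G.weight_eq_zero x y h).ge

theorem mass_pos [Infinite Γ] (x : Γ) : 0 < G.mass x := by
  obtain ⟨y, hy⟩ := G.connected.preconnected.exists_adj_of_nontrivial x
  exact (G.summable_weight x).tsum_pos (G.weight_nonneg x) y (G.weight_pos x y hy)

theorem P_nonneg (x y : Γ) : 0 ≤ G.P x y :=
  div_nonneg (G.weight_nonneg x y) (tsum_nonneg (G.weight_nonneg x))

theorem hasSum_P [Infinite Γ] (x : Γ) : HasSum (G.P x) 1 := by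
  have h := (G.summable_weight x).hasSum.div_const (G.mass x)
  have h1 : (∑' y, G.weight x y) / G.mass x = 1 := div_self (G.mass_pos x).ne'
  rwa [h1] at h

/-! ### The killed walk, harmonic functions and Dirichlet solutions -/

open Classical in
/-- The kernel of the operator `P^A`, the restriction of `P` to functions supported in `A`. -/
def killedP (A : Set Γ) (x y : Γ) : ℝ := if x ∈ A ∧ y ∈ A then G.P x y else 0

open Classical in
/-- The kernels `P_k^A(x,y)` of the iterates of `P^A`. -/
def killedPn (A : Set Γ) : ℕ → Γ → Γ → ℝ
  | 0, x, y => if x ∈ A ∧ x = y then 1 else 0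
  | k + 1, x, y => ∑' z, G.killedP A x z * killedPn A k z y

/-- The Green kernel `g^A(y,z) = (1/μ(z)) ∑_k P_k^A(y,z)` of the killed walk. -/
def green (A : Set Γ) (y z : Γ) : ℝ := (∑' k, G.killedPn A k y z) / G.mass z

/-- The set `A` together with all neighbours of its points. -/
def closure (A : Set Γ) : Set Γ := A ∪ {y | ∃ x ∈ A, G.graph.Adj x y}

/-- `h` is harmonic on `A`. Only the values of `h` on the closure of `A` matter. -/
def IsHarmonicOn (h : Γ → ℝ) (A : Set Γ) : Prop := ∀ x ∈ A, ∑' y, G.P x y * h y = h x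

/-- `u` is a non-negative solution of `u_{i+1} = P^A u_i` on `[0,n] × A`. -/
def IsNonnegDirichletSolution (u : ℕ → Γ → ℝ) (n : ℕ) (A : Set Γ) : Prop :=
  (∀ i ≤ n, ∀ z ∈ A, 0 ≤ u i z) ∧
    ∀ i < n, ∀ z ∈ A, u (i + 1) z = ∑' y, G.killedP A z y * u i y

/-! ### Conditions which do not involve the exit time -/

/-- Controlled weights `(p₀)`. -/
def ControlledWeights : Prop :=
  ∃ p₀ : ℝ, 0 < p₀ ∧ ∀ x y, G.graph.Adj x y → p₀ ≤ G.weight x y / G.mass x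

/-- Volume doubling `(VD)`. -/
def VolumeDoubling : Prop :=
  ∃ D : ℝ, 0 < D ∧ ∀ (x : Γ) (R : ℝ), 0 < R → G.V x (2 * R) ≤ D * G.V x R

/-- The (elliptic) mean value inequality `(MV)`. -/
def MeanValue : Prop :=
  ∃ C : ℝ, 0 < C ∧ ∀ (x : Γ) (R : ℝ), 0 < R → ∀ u : Γ → ℝ,
    (∀ y ∈ G.closure (G.ball x R), 0 ≤ u y) → G.IsHarmonicOn u (G.ball x R) →
      u x ≤ C / G.V x R * ∑' y : G.ball x R, u y * G.mass y

/-- The mean value property of the Green kernels. -/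
def GreenMeanValue : Prop :=
  ∃ C : ℝ, 1 < C ∧ ∀ (x : Γ) (R : ℝ), 0 < R → ∀ y : Γ, 0 < G.graph.dist x y →
    G.green (G.ball x R) y x ≤ C / G.V x (G.graph.dist x y) *
      ∑' z : G.ball x (G.graph.dist x y), G.green (G.ball x R) y z * G.mass z

/-! ### The random walk -/

/-- The law of one step of the walk from `x`. -/
def stepPMF [Infinite Γ] (x : Γ) : PMF Γ :=
  ⟨fun y => ENNReal.ofReal (G.P x y), by
    have h := ENNReal.ofReal_tsum_of_nonneg (G.P_nonneg x) (G.hasSum_P x).summable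
    rw [(G.hasSum_P x).tsum_eq, ENNReal.ofReal_one] at h
    rw [h]
    exact ENNReal.summable.hasSum⟩

/-- The exit time `T_A = min {k : X_k ∉ A}` of a path, infinite if the path stays in `A`. -/
def exitTime (A : Set Γ) (ω : ℕ → Γ) : ℝ≥0∞ := ⨅ (k : ℕ) (_ : ω k ∉ A), (k : ℝ≥0∞)

variable [Countable Γ] [Infinite Γ] [MeasurableSpace Γ] [DiscreteMeasurableSpace Γ]

/-- The transition kernel of the walk. -/
def stepKernel : Kernel Γ Γ := Kernel.ofFunOfCountable fun x => (G.stepPMF x).toMeasure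

instance : IsMarkovKernel G.stepKernel :=
  ⟨fun x => inferInstanceAs (IsProbabilityMeasure (G.stepPMF x).toMeasure)⟩

/-- The conditional law of `X_{n+1}` given the path up to time `n`: one step from the last
position. -/
def pathKernel (n : ℕ) : Kernel ((i : Finset.Iic n) → (fun _ : ℕ => Γ) i) Γ :=
  G.stepKernel.comap (fun h => h ⟨n, Finset.mem_Iic.2 le_rfl⟩) (measurable_pi_apply _)

instance (n : ℕ) : IsMarkovKernel (G.pathKernel n) := by
  unfold pathKernel; infer_instance

/-- The law of the random walk `(X_k)` with `X_0 = x`, on the space of all paths; the walk itself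
is the coordinate process `X_k(ω) = ω k`. -/
def walkLaw (x : Γ) : Measure (ℕ → Γ) :=
  Kernel.traj (X := fun _ => Γ) G.pathKernel 0 (fun _ => x)

/-- The `n` step transition probability `P_n(x,y)`. -/
def Pn (n : ℕ) (x y : Γ) : ℝ := (G.walkLaw x).real {ω | ω n = y}

/-- The transition density (heat kernel) `p_n(x,y) = P_n(x,y) / μ(y)`. -/
def heatKernel (n : ℕ) (x y : Γ) : ℝ := G.Pn n x y / G.mass y

/-- The mean exit time `E_z(A)` of the walk started at `z`. -/
def meanExit (z : Γ) (A : Set Γ) : ℝ≥0∞ := ∫⁻ ω, exitTime A ω ∂(G.walkLaw z)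

/-- The mean exit time `E(x,R)` from the ball `B(x,R)` of the walk started at the centre, as a
real number; it is finite under `(p₀)`, since the balls are then finite and the graph is infinite
and connected. -/
def E (x : Γ) (R : ℝ) : ℝ := (G.meanExit x (G.ball x R)).toReal

/-- The inverse `e(x,n) = min {R ∈ ℕ : E(x,R) ≥ n}` of the mean exit time. -/
def e (x : Γ) (n : ℕ) : ℕ := sInf {R : ℕ | (n : ℝ) ≤ G.E x R}

/-! ### Conditions which involve the exit time -/

/-- The time comparison principle `(TC)`. -/
def TimeComparison : Prop :=
  ∃ C : ℝ, 1 < C ∧ ∀ (x : Γ) (R : ℝ), 0 < R → ∀ y ∈ G.ball x R, G.E x (2 * R) / G.E y R ≤ C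

/-- The local diagonal upper estimate `(DUE)`. -/
def DiagonalUpperEstimate : Prop :=
  ∃ C : ℝ, 0 < C ∧ ∀ (x : Γ) (n : ℕ), 0 < n → G.heatKernel n x x ≤ C / G.V x (G.e x n)

/-- The upper estimate `(UE)`. -/
def UpperEstimate : Prop :=
  ∃ C β c : ℝ, 1 < C ∧ 1 < β ∧ 0 < c ∧ ∀ (x y : Γ) (n : ℕ), 0 < n →
    G.heatKernel n x y ≤ C / G.V x (G.e x n) *
      Real.exp (-c * (G.E x (G.graph.dist x y) / n) ^ (1 / (β - 1)))

/-- The parabolic mean value inequality with constants `c₁ < c₂`; the times `c₁ E` and `c₂ E` are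
understood as integer parts. -/
def ParabolicMeanValue (c₁ c₂ : ℝ) : Prop :=
  ∃ C : ℝ, 1 < C ∧ ∀ (x : Γ) (R : ℝ), 0 < R → ∀ u : ℕ → Γ → ℝ,
    G.IsNonnegDirichletSolution u ⌊c₂ * G.E x R⌋₊ (G.ball x R) →
      u ⌊c₂ * G.E x R⌋₊ x ≤ C / (G.V x R * G.E x R) *
        ∑ i ∈ Finset.Icc ⌊c₁ * G.E x R⌋₊ ⌊c₂ * G.E x R⌋₊,
          ∑' y : G.ball x R, u i y * G.mass y

/-- The Green kernel is bounded by the ratio of the mean exit time and the volume. -/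
def GreenUpperBound : Prop :=
  ∃ C : ℝ, 1 < C ∧ ∀ (x : Γ) (R : ℝ), 0 < R → ∀ y : Γ, 0 < G.graph.dist x y →
    G.green (G.ball x R) y x ≤ C * (G.E x R / G.V x (G.graph.dist x y))

end

end WeightedGraph

/-! All six statements are compared through walks killed on leaving a finite set. By (p₀) balls are
finite, and only integer radii matter, so the law of the walk enters only through the operators `L
A`, self-adjoint in ℓ²(A, μ) by reversibility, their kernels `hk`, the survival probabilities `surv`
and the Green kernels `gr`.

Time comparison is used twice. It forces E(x,4R) ≥ (1+1/C) E(x,R), so with volume doubling V grows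
at most polynomially in E (`Hyp.exists_growth`). Moreover, leaving a ball means crossing many
smaller balls in succession, each with a definite chance of being slow; hence the exit time has a
stretched exponential tail (`Hyp.exists_tail`). Sums over scales converge because this tail beats
polynomial growth.

The hub is the inequality `FaberKrahn`: a set of small measure compared with V(y,e(y,n)) at each of
its points y has a spectral gap of order 1/n. It gives (DUE) by Nash's argument: as long as the
return density of a finite set is too large, cutting the density at a suitable level leaves a
function on a set small enough for the gap, and so the return density decays geometrically
(`nash_step`, `Hyp.exists_nash`). The reference volume depends on the point, so this works with a
uniform constant only inside a ball; the ball is then removed by telescoping over growing radii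
(`Hyp.exists_heatKernel_le_of_faberKrahn`).

(DUE) gives (UE) because halfway in time a path from x to y is far from x or far from y, and being
far is unlikely (`Hyp.exists_far_sum_le`). Putting y = x gives the converse. From (UE), averaging
over times of order E yields the parabolic inequality, and summing over time yields the Green kernel
bound.

On the elliptic side, g(y,·) is harmonic away from its pole, so (MV) applies to it, and its integral
is a mean exit time; this leads back to the Green kernel bound. Conversely, given that bound, a
harmonic function is swept onto a smaller ball and becomes the potential of a charge on a sphere;
symmetry of the Green operator then turns the pairing of this charge with the exit time into the
integral of the function (`Hyp.mul_Vn_le_of_superharmonic`).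

Two roads return to `FaberKrahn`. The Green kernel bound makes the mean exit time from a small set
short. The parabolic inequality bounds survival in a small subset of a ball, and a weighted cover by
balls carries the energy bound to arbitrary sets (`ip_L_pow_le_of_cover`). -/

namespace WeightedGraph

set_option linter.unusedSectionVars false

open scoped Classical

noncomputable section

variable {Γ : Type*} (G : WeightedGraph Γ)

/-! ### The killed transition operator of a finite set -/

/-- The operator `f ↦ P^A f` for a finite set `A`. -/
def L (A : Finset Γ) : Module.End ℝ (Γ → ℝ) where
  toFun f x := if x ∈ A then ∑ y ∈ A, G.P x y * f y else 0
  map_add' f g := by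
    funext x
    by_cases h : x ∈ A <;> simp [h, mul_add, Finset.sum_add_distrib]
  map_smul' c f := by
    funext x
    by_cases h : x ∈ A
    · simp only [h, if_true, Pi.smul_apply, smul_eq_mul, RingHom.id_apply, Finset.mul_sum]
      exact Finset.sum_congr rfl fun y _ => by ring
    · simp [h]

/-- The inner product of `ℓ²(A, μ)`. -/
def ip (A : Finset Γ) (f g : Γ → ℝ) : ℝ := ∑ x ∈ A, G.mass x * (f x * g x)

/-- The indicator function of a finite set. -/
def ind (A : Finset Γ) : Γ → ℝ := fun x => if x ∈ A then 1 else 0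

/-- The point mass at `y`, cut off outside `A`. -/
def dl (A : Finset Γ) (y : Γ) : Γ → ℝ := fun x => if x ∈ A ∧ x = y then 1 else 0

/-- The probability that the walk started at `z` has not left `A` up to time `k`. -/
def surv (A : Finset Γ) (k : ℕ) (z : Γ) : ℝ := (G.L A ^ k) (ind A) z

/-- The heat kernel of the walk killed on leaving `A`. -/
def hk (A : Finset Γ) (k : ℕ) (x y : Γ) : ℝ := (G.L A ^ k) (dl A y) x / G.mass y

/-- The measure of a finite set. -/
def vol (A : Finset Γ) : ℝ := ∑ x ∈ A, G.mass x

variable {G} {A B : Finset Γ} {f g : Γ → ℝ} {x y z : Γ} {k : ℕ}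

theorem L_apply_of_mem (h : x ∈ A) : G.L A f x = ∑ y ∈ A, G.P x y * f y := by simp [L, h]

theorem L_apply_of_notMem (h : x ∉ A) : G.L A f x = 0 := by simp [L, h]

theorem L_nonneg (hf : ∀ y ∈ A, 0 ≤ f y) (x : Γ) : 0 ≤ G.L A f x := by
  by_cases h : x ∈ A
  · rw [L_apply_of_mem h]
    exact Finset.sum_nonneg fun y hy => mul_nonneg (G.P_nonneg x y) (hf y hy)
  · rw [L_apply_of_notMem h]

theorem L_mono (hfg : ∀ y ∈ A, f y ≤ g y) (x : Γ) : G.L A f x ≤ G.L A g x := by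
  by_cases h : x ∈ A
  · rw [L_apply_of_mem h, L_apply_of_mem h]
    exact Finset.sum_le_sum fun y hy => mul_le_mul_of_nonneg_left (hfg y hy) (G.P_nonneg x y)
  · rw [L_apply_of_notMem h, L_apply_of_notMem h]

theorem L_pow_succ (f : Γ → ℝ) : (G.L A ^ (k + 1)) f = G.L A ((G.L A ^ k) f) := by
  rw [pow_succ', Module.End.mul_apply]

theorem L_pow_succ' (f : Γ → ℝ) : (G.L A ^ (k + 1)) f = (G.L A ^ k) (G.L A f) := by
  rw [pow_succ, Module.End.mul_apply]

theorem L_pow_add (j k : ℕ) (f : Γ → ℝ) : (G.L A ^ (j + k)) f = (G.L A ^ j) ((G.L A ^ k) f) := by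
  rw [pow_add, Module.End.mul_apply]

theorem L_pow_mono (hfg : ∀ y ∈ A, f y ≤ g y) (k : ℕ) :
    ∀ x ∈ A, (G.L A ^ k) f x ≤ (G.L A ^ k) g x := by
  induction k with
  | zero => simpa using hfg
  | succ k ih => intro x _; rw [L_pow_succ, L_pow_succ]; exact L_mono ih x

theorem L_pow_nonneg (hf : ∀ y ∈ A, 0 ≤ f y) (k : ℕ) {x : Γ} (hx : x ∈ A) :
    0 ≤ (G.L A ^ k) f x := by
  have h := L_pow_mono (G := G) (f := 0) (g := f) (by simpa using hf) k x hx
  simpa using h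

theorem L_mono_set (hAB : A ⊆ B) (hfg : ∀ y ∈ A, f y ≤ g y) (hg : ∀ y ∈ B, 0 ≤ g y) (x : Γ) :
    G.L A f x ≤ G.L B g x := by
  by_cases h : x ∈ A
  · rw [L_apply_of_mem h, L_apply_of_mem (hAB h)]
    calc _ ≤ ∑ y ∈ A, G.P x y * g y :=
          Finset.sum_le_sum fun y hy => mul_le_mul_of_nonneg_left (hfg y hy) (G.P_nonneg x y)
      _ ≤ _ := Finset.sum_le_sum_of_subset_of_nonneg hAB fun y hy _ =>
          mul_nonneg (G.P_nonneg x y) (hg y hy)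
  · rw [L_apply_of_notMem h]; exact L_nonneg hg x

theorem L_pow_mono_set (hAB : A ⊆ B) (hfg : ∀ y ∈ A, f y ≤ g y) (hg : ∀ y ∈ B, 0 ≤ g y) (k : ℕ) :
    ∀ x ∈ A, (G.L A ^ k) f x ≤ (G.L B ^ k) g x := by
  induction k with
  | zero => simpa using hfg
  | succ k ih =>
    intro x _
    rw [L_pow_succ, L_pow_succ]
    exact L_mono_set hAB ih (fun y hy => L_pow_nonneg hg k hy) x

theorem ind_of_mem (h : x ∈ A) : ind A x = 1 := by simp [ind, h]

theorem ind_of_notMem (h : x ∉ A) : ind A x = 0 := by simp [ind, h]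

theorem dl_nonneg (A : Finset Γ) (y x : Γ) : 0 ≤ dl A y x := by
  unfold dl; split_ifs <;> norm_num

theorem surv_zero (z : Γ) : G.surv A 0 z = ind A z := by simp [surv]

theorem surv_succ (k : ℕ) : G.surv A (k + 1) z = G.L A (G.surv A k) z := by
  rw [surv, L_pow_succ]; rfl

theorem surv_of_notMem (h : z ∉ A) (k : ℕ) : G.surv A k z = 0 := by
  cases k with
  | zero => rw [surv_zero, ind_of_notMem h]
  | succ k => rw [surv_succ, L_apply_of_notMem h]

theorem surv_nonneg (A : Finset Γ) (k : ℕ) (z : Γ) : 0 ≤ G.surv A k z := by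
  by_cases h : z ∈ A
  · exact L_pow_nonneg (fun y hy => by rw [ind_of_mem hy]; norm_num) k h
  · rw [surv_of_notMem h]

/-! ### Contraction, and monotonicity of survival probabilities -/

section Infinite

variable [Infinite Γ]

theorem P_sum_le_one (A : Finset Γ) (x : Γ) : ∑ y ∈ A, G.P x y ≤ 1 :=
  sum_le_hasSum A (fun y _ => G.P_nonneg x y) (G.hasSum_P x)

theorem L_le_of_le {c : ℝ} (hc : 0 ≤ c) (hf : ∀ y ∈ A, f y ≤ c) (x : Γ) : G.L A f x ≤ c := by
  by_cases h : x ∈ A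
  · rw [L_apply_of_mem h]
    calc _ ≤ ∑ y ∈ A, G.P x y * c :=
          Finset.sum_le_sum fun y hy => mul_le_mul_of_nonneg_left (hf y hy) (G.P_nonneg x y)
      _ = (∑ y ∈ A, G.P x y) * c := by rw [Finset.sum_mul]
      _ ≤ 1 * c := mul_le_mul_of_nonneg_right (P_sum_le_one A x) hc
      _ = c := one_mul c
  · rwa [L_apply_of_notMem h]

theorem L_pow_le_of_le {c : ℝ} (hc : 0 ≤ c) (hf : ∀ y ∈ A, f y ≤ c) (k : ℕ) :
    ∀ x ∈ A, (G.L A ^ k) f x ≤ c := by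
  induction k with
  | zero => simpa using hf
  | succ k ih => intro x _; rw [L_pow_succ]; exact L_le_of_le hc ih x

theorem surv_le_one (A : Finset Γ) (k : ℕ) (z : Γ) : G.surv A k z ≤ 1 := by
  by_cases h : z ∈ A
  · exact L_pow_le_of_le zero_le_one (fun y hy => by rw [ind_of_mem hy]) k z h
  · rw [surv_of_notMem h]; norm_num

theorem surv_succ_le (A : Finset Γ) (k : ℕ) (z : Γ) : G.surv A (k + 1) z ≤ G.surv A k z := by
  induction k generalizing z with
  | zero =>
    by_cases h : z ∈ A
    · rw [surv_zero, ind_of_mem h]; exact surv_le_one A _ z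
    · rw [surv_of_notMem h, surv_of_notMem h]
  | succ k ih => rw [surv_succ, surv_succ]; exact L_mono (fun y _ => ih y) z

theorem surv_antitone (A : Finset Γ) (z : Γ) : Antitone fun k => G.surv A k z :=
  antitone_nat_of_succ_le fun k => surv_succ_le A k z

theorem surv_mono_set (hAB : A ⊆ B) (k : ℕ) (z : Γ) : G.surv A k z ≤ G.surv B k z := by
  by_cases h : z ∈ A
  · exact L_pow_mono_set hAB (fun y hy => by rw [ind_of_mem hy, ind_of_mem (hAB hy)])
      (fun y hy => by rw [ind_of_mem hy]; norm_num) k z h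
  · rw [surv_of_notMem h]; exact surv_nonneg B k z

/-- Dominating an iterate by the survival probability. -/
theorem L_pow_le_mul_surv {c : ℝ} (hf : ∀ y ∈ A, f y ≤ c) (k : ℕ) (hx : x ∈ A) :
    (G.L A ^ k) f x ≤ c * G.surv A k x := by
  have h := L_pow_mono (G := G) (f := f) (g := c • ind A)
    (fun y hy => by simpa [ind_of_mem hy] using hf y hy) k x hx
  rwa [map_smul, Pi.smul_apply, smul_eq_mul] at h

/-- Markov property at time j: the remaining k steps are survived with probability at most c from
wherever the walk is. -/
theorem surv_add_le {c : ℝ} (j k : ℕ) (hc : ∀ y ∈ A, G.surv A k y ≤ c) (z : Γ) :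
    G.surv A (j + k) z ≤ c * G.surv A j z := by
  by_cases h : z ∈ A
  · rw [surv, L_pow_add]
    exact L_pow_le_mul_surv hc j h
  · rw [surv_of_notMem h, surv_of_notMem h, mul_zero]

/-- Union bound: a path staying in A either stays in B as well or leaves B. It is proved by
first-step induction, so no path measure is needed. -/
theorem surv_le_surv_inter_add (A B : Finset Γ) (k : ℕ) (z : Γ) :
    G.surv A k z ≤ G.surv (A ∩ B) k z + (1 - G.surv B k z) := by
  induction k generalizing z with
  | zero =>
    simp only [surv_zero, ind, Finset.mem_inter]
    by_cases h1 : z ∈ A <;> by_cases h2 : z ∈ B <;> simp [h1, h2]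
  | succ k ih =>
    by_cases h1 : z ∈ A
    swap
    · rw [surv_of_notMem h1]
      have := surv_nonneg (G := G) (A ∩ B) (k + 1) z
      have := surv_le_one (G := G) B (k + 1) z
      linarith
    by_cases h2 : z ∈ B
    swap
    · rw [surv_of_notMem h2]
      have := surv_nonneg (G := G) (A ∩ B) (k + 1) z
      have := surv_le_one (G := G) A (k + 1) z
      linarith
    -- Survival probabilities vanish off their set, so the three first-step recursions can be summed
    -- over one common set and combined linearly.
    have key : ∀ S : Finset Γ, S ⊆ A ∪ B → z ∈ S →
        G.surv S (k + 1) z = ∑ y ∈ A ∪ B, G.P z y * G.surv S k y := by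
      intro S hS hz
      rw [surv_succ, L_apply_of_mem hz]
      refine Finset.sum_subset hS fun y _ hy => ?_
      rw [surv_of_notMem hy, mul_zero]
    rw [key A Finset.subset_union_left h1, key B Finset.subset_union_right h2,
      key (A ∩ B) (Finset.inter_subset_left.trans Finset.subset_union_left)
        (Finset.mem_inter.2 ⟨h1, h2⟩)]
    have h3 := P_sum_le_one (G := G) (A ∪ B) z
    have h4 : ∑ y ∈ A ∪ B, G.P z y * G.surv A k y ≤
        ∑ y ∈ A ∪ B, (G.P z y * G.surv (A ∩ B) k y + (G.P z y - G.P z y * G.surv B k y)) := by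
      refine Finset.sum_le_sum fun y _ => ?_
      have := mul_le_mul_of_nonneg_left (ih y) (G.P_nonneg z y)
      linarith
    rw [Finset.sum_add_distrib, Finset.sum_sub_distrib] at h4
    linarith

end Infinite

/-! ### Symmetry -/

theorem ip_comm : G.ip A f g = G.ip A g f :=
  Finset.sum_congr rfl fun x _ => by ring

theorem mass_nonneg (x : Γ) : 0 ≤ G.mass x := tsum_nonneg (G.weight_nonneg x)

theorem ip_self_nonneg (A : Finset Γ) (f : Γ → ℝ) : 0 ≤ G.ip A f f :=
  Finset.sum_nonneg fun x _ => mul_nonneg (mass_nonneg x) (mul_self_nonneg _)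

theorem ip_add_left (f g w : Γ → ℝ) : G.ip A (f + g) w = G.ip A f w + G.ip A g w := by
  simp only [ip, ← Finset.sum_add_distrib, Pi.add_apply]
  exact Finset.sum_congr rfl fun x _ => by ring

theorem ip_sq_le (A : Finset Γ) (f g : Γ → ℝ) :
    G.ip A f g ^ 2 ≤ G.ip A f f * G.ip A g g := by
  have h := Finset.sum_mul_sq_le_sq_mul_sq A (fun x => √(G.mass x) * f x)
    (fun x => √(G.mass x) * g x)
  have e : ∀ a b : Γ → ℝ, ∀ x, √(G.mass x) * a x * (√(G.mass x) * b x) =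
      G.mass x * (a x * b x) := fun a b x => by
    rw [show √(G.mass x) * a x * (√(G.mass x) * b x) =
      (√(G.mass x) * √(G.mass x)) * (a x * b x) by ring, Real.mul_self_sqrt (mass_nonneg x)]
  simp only [sq, e] at h
  simpa only [ip, sq] using h

/-! ### Reversibility, killed heat kernels and energy bounds -/

section Infinite

variable [Infinite Γ]

theorem mass_mul_P (x y : Γ) : G.mass x * G.P x y = G.weight x y := by
  rw [P, mul_div_cancel₀ _ (G.mass_pos x).ne']

theorem mass_mul_P_comm (x y : Γ) : G.mass x * G.P x y = G.mass y * G.P y x := by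
  rw [mass_mul_P, mass_mul_P, G.weight_symm]

theorem ip_L (f g : Γ → ℝ) : G.ip A (G.L A f) g = G.ip A f (G.L A g) := by
  have h1 : ∀ u v : Γ → ℝ, G.ip A (G.L A u) v =
      ∑ x ∈ A, ∑ y ∈ A, G.mass x * G.P x y * (u y * v x) := by
    intro u v
    refine Finset.sum_congr rfl fun x hx => ?_
    rw [L_apply_of_mem hx, Finset.sum_mul, Finset.mul_sum]
    exact Finset.sum_congr rfl fun y _ => by ring
  rw [h1, ip_comm (f := f), h1, Finset.sum_comm]
  refine Finset.sum_congr rfl fun x _ => Finset.sum_congr rfl fun y _ => ?_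
  rw [mass_mul_P_comm]; ring

theorem ip_L_pow (k : ℕ) (f g : Γ → ℝ) :
    G.ip A ((G.L A ^ k) f) g = G.ip A f ((G.L A ^ k) g) := by
  induction k generalizing f g with
  | zero => simp
  | succ k ih => rw [L_pow_succ, ip_L, ih, ← L_pow_succ']

theorem ip_dl (hx : x ∈ A) (f : Γ → ℝ) : G.ip A (dl A x) f = G.mass x * f x := by
  rw [ip, Finset.sum_eq_single x]
  · simp [dl, hx]
  · intro y _ hy; simp [dl, hy]
  · exact fun h => (h hx).elim

theorem hk_of_notMem_left (hx : x ∉ A) (k : ℕ) (y : Γ) : G.hk A k x y = 0 := by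
  cases k with
  | zero => simp [hk, dl, hx]
  | succ k => rw [hk, L_pow_succ, L_apply_of_notMem hx, zero_div]

theorem hk_of_notMem_right (hy : y ∉ A) (k : ℕ) (x : Γ) : G.hk A k x y = 0 := by
  have : dl A y = 0 := by
    funext z
    simp only [dl, Pi.zero_apply, ite_eq_right_iff, one_ne_zero, imp_false, not_and]
    rintro hz rfl; exact hy hz
  simp [hk, this]

theorem hk_comm (A : Finset Γ) (k : ℕ) (x y : Γ) : G.hk A k x y = G.hk A k y x := by
  by_cases hx : x ∈ A
  swap
  · rw [hk_of_notMem_left hx, hk_of_notMem_right hx]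
  by_cases hy : y ∈ A
  swap
  · rw [hk_of_notMem_left hy, hk_of_notMem_right hy]
  have h := ip_L_pow (G := G) (A := A) k (dl A y) (dl A x)
  rw [ip_comm, ip_dl hx, ip_dl hy] at h
  rw [hk, hk, div_eq_div_iff (G.mass_pos y).ne' (G.mass_pos x).ne']
  linarith

theorem hk_nonneg (A : Finset Γ) (k : ℕ) (x y : Γ) : 0 ≤ G.hk A k x y := by
  by_cases hx : x ∈ A
  · exact div_nonneg (L_pow_nonneg (fun z _ => dl_nonneg A y z) k hx) (mass_nonneg y)
  · rw [hk_of_notMem_left hx]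

/-- Pair with the point mass at x and move the power across by self-adjointness. -/
theorem L_pow_eq_sum_hk (k : ℕ) (f : Γ → ℝ) (hx : x ∈ A) :
    (G.L A ^ k) f x = ∑ y ∈ A, G.mass y * (G.hk A k x y * f y) := by
  have h := ip_L_pow (G := G) (A := A) k f (dl A x)
  rw [ip_comm, ip_dl hx] at h
  have h2 : G.mass x * (G.L A ^ k) f x = G.mass x * ∑ y ∈ A, G.mass y * (G.hk A k x y * f y) := by
    rw [h, ip, Finset.mul_sum]
    refine Finset.sum_congr rfl fun y _ => ?_
    rw [hk_comm, hk]
    field_simp [(G.mass_pos x).ne']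
  exact mul_left_cancel₀ (G.mass_pos x).ne' h2

theorem surv_eq_sum_hk (hx : x ∈ A) : G.surv A k x = ∑ y ∈ A, G.mass y * G.hk A k x y := by
  rw [surv, L_pow_eq_sum_hk k _ hx]
  exact Finset.sum_congr rfl fun y hy => by rw [ind_of_mem hy, mul_one]

theorem hk_add (j k : ℕ) (x y : Γ) :
    G.hk A (j + k) x y = ∑ z ∈ A, G.mass z * (G.hk A j x z * G.hk A k z y) := by
  by_cases hx : x ∈ A
  · rw [hk, L_pow_add, L_pow_eq_sum_hk j _ hx, Finset.sum_div]
    refine Finset.sum_congr rfl fun z _ => ?_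
    simp only [hk]; ring
  · rw [hk_of_notMem_left hx]
    exact (Finset.sum_eq_zero fun z _ => by rw [hk_of_notMem_left hx]; ring).symm

theorem hk_mono_set (hAB : A ⊆ B) (k : ℕ) (x y : Γ) : G.hk A k x y ≤ G.hk B k x y := by
  by_cases hx : x ∈ A
  · refine div_le_div_of_nonneg_right (L_pow_mono_set hAB (fun z hz => ?_)
      (fun z _ => dl_nonneg B y z) k x hx) (mass_nonneg y)
    simp [dl, hz, hAB hz]
  · rw [hk_of_notMem_left hx]; exact hk_nonneg B k x y

theorem hk_eq_ip (j k : ℕ) (x y : Γ) :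
    G.hk A (j + k) x y = G.ip A (fun z => G.hk A j x z) (fun z => G.hk A k y z) := by
  rw [hk_add, ip]
  exact Finset.sum_congr rfl fun z _ => by rw [hk_comm A k z y]

/-- Chapman–Kolmogorov and symmetry make the kernel an inner product; Cauchy–Schwarz then bounds it
by diagonal values at even times, which are squared norms. -/
theorem hk_sq_le (j k : ℕ) (x y : Γ) :
    G.hk A (j + k) x y ^ 2 ≤ G.hk A (j + j) x x * G.hk A (k + k) y y := by
  rw [hk_eq_ip, hk_eq_ip, hk_eq_ip]
  exact ip_sq_le A _ _

theorem mass_mul_hk_le_surv (k : ℕ) (x y : Γ) : G.mass y * G.hk A k x y ≤ G.surv A k x := by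
  by_cases hx : x ∈ A
  swap
  · rw [hk_of_notMem_left hx, mul_zero]; exact surv_nonneg A k x
  by_cases hy : y ∈ A
  · rw [surv_eq_sum_hk hx]
    exact Finset.single_le_sum (f := fun y => G.mass y * G.hk A k x y)
      (fun z _ => mul_nonneg (mass_nonneg z) (hk_nonneg A k x z)) hy
  · rw [hk_of_notMem_right hy, mul_zero]; exact surv_nonneg A k x

theorem hk_le_inv_mass (k : ℕ) (x y : Γ) : G.hk A k x y ≤ 1 / G.mass y := by
  rw [le_div_iff₀ (G.mass_pos y), mul_comm]
  exact (mass_mul_hk_le_surv k x y).trans (surv_le_one A k x)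

/-- Schur's test for a symmetric nonnegative kernel. -/
theorem schur (K : Γ → Γ → ℝ) (hK : ∀ x ∈ A, ∀ y ∈ A, 0 ≤ K x y)
    (hsymm : ∀ x ∈ A, ∀ y ∈ A, K x y = K y x) {c : ℝ}
    (hc : ∀ x ∈ A, ∑ y ∈ A, G.mass y * K x y ≤ c) (f : Γ → ℝ) :
    ∑ x ∈ A, ∑ y ∈ A, G.mass x * G.mass y * K x y * (f x * f y) ≤ c * G.ip A f f := by
  have h1 : ∑ x ∈ A, ∑ y ∈ A, G.mass x * G.mass y * K x y * (f x * f y) ≤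
      ∑ x ∈ A, ∑ y ∈ A, (G.mass x * G.mass y * K x y * (f x * f x) / 2 +
        G.mass x * G.mass y * K x y * (f y * f y) / 2) := by
    refine Finset.sum_le_sum fun x hx => Finset.sum_le_sum fun y hy => ?_
    have h0 : 0 ≤ G.mass x * G.mass y * K x y :=
      mul_nonneg (mul_nonneg (mass_nonneg x) (mass_nonneg y)) (hK x hx y hy)
    -- The product f(x)f(y) is at most (f(x)² + f(y)²)/2; symmetry makes the two halves equal.
    nlinarith [mul_nonneg h0 (sq_nonneg (f x - f y))]
  have h2 : ∑ x ∈ A, ∑ y ∈ A, G.mass x * G.mass y * K x y * (f x * f x) / 2 ≤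
      c * G.ip A f f / 2 := by
    rw [ip, Finset.mul_sum, Finset.sum_div]
    refine Finset.sum_le_sum fun x hx => ?_
    have h3 : ∑ y ∈ A, G.mass x * G.mass y * K x y * (f x * f x) / 2 =
        (G.mass x * (f x * f x) / 2) * ∑ y ∈ A, G.mass y * K x y := by
      rw [Finset.mul_sum]; exact Finset.sum_congr rfl fun y _ => by ring
    rw [h3]
    have h4 : 0 ≤ G.mass x * (f x * f x) / 2 :=
      div_nonneg (mul_nonneg (mass_nonneg x) (mul_self_nonneg _)) (by norm_num)
    calc _ ≤ (G.mass x * (f x * f x) / 2) * c := mul_le_mul_of_nonneg_left (hc x hx) h4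
      _ = _ := by ring
  have h5 : ∑ x ∈ A, ∑ y ∈ A, G.mass x * G.mass y * K x y * (f y * f y) / 2 =
      ∑ x ∈ A, ∑ y ∈ A, G.mass x * G.mass y * K x y * (f x * f x) / 2 := by
    rw [Finset.sum_comm]
    refine Finset.sum_congr rfl fun x hx => Finset.sum_congr rfl fun y hy => ?_
    rw [hsymm y hy x hx]; ring
  simp only [Finset.sum_add_distrib] at h1
  linarith

theorem ip_L_pow_eq_sum (k : ℕ) (f : Γ → ℝ) :
    G.ip A ((G.L A ^ k) f) f =
      ∑ x ∈ A, ∑ y ∈ A, G.mass x * G.mass y * G.hk A k x y * (f x * f y) := by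
  rw [ip]
  refine Finset.sum_congr rfl fun x hx => ?_
  rw [L_pow_eq_sum_hk k f hx, Finset.sum_mul, Finset.mul_sum]
  exact Finset.sum_congr rfl fun y _ => by ring

/-- The row sums of the symmetric kernel are survival probabilities, so Schur's test turns a uniform
survival bound into an operator bound. -/
theorem ip_L_pow_le {c : ℝ} (k : ℕ) (hc : ∀ x ∈ A, G.surv A k x ≤ c) (f : Γ → ℝ) :
    G.ip A ((G.L A ^ k) f) f ≤ c * G.ip A f f := by
  rw [ip_L_pow_eq_sum]
  refine schur (fun x y => G.hk A k x y) (fun x _ y _ => hk_nonneg A k x y)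
    (fun x _ y _ => hk_comm A k x y) (fun x hx => ?_) f
  rw [← surv_eq_sum_hk hx]; exact hc x hx

theorem ip_L_pow_L_pow (k : ℕ) (f : Γ → ℝ) :
    G.ip A ((G.L A ^ k) f) ((G.L A ^ k) f) = G.ip A ((G.L A ^ (k + k)) f) f := by
  rw [L_pow_add, ip_L_pow (k := k) (f := (G.L A ^ k) f)]

theorem ip_L_L_le (f : Γ → ℝ) : G.ip A (G.L A f) (G.L A f) ≤ G.ip A f f := by
  have h := ip_L_pow_L_pow (G := G) (A := A) 1 f
  rw [pow_one] at h
  rw [h]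
  simpa using ip_L_pow_le (G := G) (A := A) (c := 1) (1 + 1) (fun x _ => surv_le_one A _ x) f

/-- Jensen's inequality for the spectral measure of `f`, along powers of two. -/
theorem ip_L_pow_jensen (k j : ℕ) {c : ℝ} (hc : 0 ≤ c) {f : Γ → ℝ}
    (h : G.ip A ((G.L A ^ (2 ^ j * k)) f) f ≤ c ^ (2 ^ j) * G.ip A f f) :
    G.ip A ((G.L A ^ k) f) f ≤ c * G.ip A f f := by
  induction j with
  | zero => simpa using h
  | succ j ih =>
    refine ih ?_
    set i := 2 ^ j * k with hi
    have e : 2 ^ (j + 1) * k = i + i := by rw [hi]; ring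
    rw [e, ← ip_L_pow_L_pow] at h
    -- Cauchy–Schwarz: the square of ⟨Lⁱf, f⟩ is at most ⟨L²ⁱf, f⟩⟨f, f⟩, so halving the time takes
    -- a square root of the constant.
    have h1 := ip_sq_le (G := G) A ((G.L A ^ i) f) f
    have h0 := ip_self_nonneg (G := G) A f
    have h2 : G.ip A ((G.L A ^ i) f) f ^ 2 ≤ (c ^ 2 ^ j * G.ip A f f) ^ 2 := by
      calc _ ≤ _ := h1
        _ ≤ (c ^ 2 ^ (j + 1) * G.ip A f f) * G.ip A f f := mul_le_mul_of_nonneg_right h h0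
        _ = _ := by rw [pow_succ 2 j, pow_mul]; ring
    exact le_of_abs_le ((sq_le_sq.1 h2).trans_eq
      (abs_of_nonneg (mul_nonneg (pow_nonneg hc _) h0)))

end Infinite

end

noncomputable section

variable {Γ : Type*} (G : WeightedGraph Γ)

/-! ### The Green operator of a finite set -/

/-- The Green operator `∑_k (P^A)^k`. -/
def gop (A : Finset Γ) (f : Γ → ℝ) (x : Γ) : ℝ := ∑' k, (G.L A ^ k) f x

/-- The mean exit time from a finite set. -/
def ET (A : Finset Γ) (z : Γ) : ℝ := ∑' k, G.surv A k z

/-- The Green kernel of a finite set. -/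
def gr (A : Finset Γ) (x y : Γ) : ℝ := ∑' k, G.hk A k x y

variable {G} [Infinite Γ] {A B : Finset Γ} {f g : Γ → ℝ} {x y z : Γ} {k : ℕ}

/-- The graph is infinite and connected: some path leads from z out of A and is followed with
positive probability. The induction runs along this path. -/
theorem exists_surv_lt_one (A : Finset Γ) (z : Γ) : ∃ k, G.surv A k z < 1 := by
  obtain ⟨w, hw⟩ := Infinite.exists_notMem_finset A
  obtain ⟨p⟩ := G.connected.preconnected z w
  induction p with
  | nil => exact ⟨0, by rw [surv_of_notMem hw]; norm_num⟩
  | @cons u v w h p ih =>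
    obtain ⟨k, hk⟩ := ih hw
    refine ⟨k + 1, ?_⟩
    by_cases hu : u ∈ A
    swap
    · rw [surv_of_notMem hu]; norm_num
    have hP : 0 < G.P u v := div_pos (G.weight_pos u v h) (G.mass_pos u)
    rw [surv_succ, L_apply_of_mem hu]
    calc ∑ y ∈ A, G.P u y * G.surv A k y ≤ ∑ y ∈ insert v A, G.P u y * G.surv A k y :=
          Finset.sum_le_sum_of_subset_of_nonneg (Finset.subset_insert v A) fun y _ _ =>
            mul_nonneg (G.P_nonneg u y) (surv_nonneg A k y)
      _ < ∑ y ∈ insert v A, G.P u y := by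
          refine Finset.sum_lt_sum (fun y _ => ?_) ⟨v, Finset.mem_insert_self v A, ?_⟩
          · exact mul_le_of_le_one_right (G.P_nonneg u y) (surv_le_one A k y)
          · exact mul_lt_of_lt_one_right hP hk
      _ ≤ 1 := P_sum_le_one _ u

theorem exists_surv_le (A : Finset Γ) : ∃ (N : ℕ) (θ : ℝ), θ < 1 ∧ ∀ z, G.surv A N z ≤ θ := by
  choose N hN using fun z => exists_surv_lt_one (G := G) A z
  rcases A.eq_empty_or_nonempty with rfl | hA
  · exact ⟨0, 0, by norm_num, fun z => by rw [surv_of_notMem (Finset.notMem_empty z)]⟩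
  refine ⟨A.sup N, A.sup' hA (G.surv A (A.sup N)), ?_, fun z => ?_⟩
  · rw [Finset.sup'_lt_iff]
    intro z hz
    exact (surv_antitone A z (Finset.le_sup (f := N) hz)).trans_lt (hN z)
  · by_cases hz : z ∈ A
    · exact Finset.le_sup' (G.surv A (A.sup N)) hz
    · obtain ⟨a, ha⟩ := hA
      rw [surv_of_notMem hz]
      exact (surv_nonneg A _ a).trans (Finset.le_sup' (G.surv A (A.sup N)) ha)

/-- By finiteness one time N has survival at most θ < 1 from every start. The maximum S over starts
of the partial sums satisfies S ≤ N + θS, a bound independent of the length M. -/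
theorem summable_surv (A : Finset Γ) (z : Γ) : Summable fun k => G.surv A k z := by
  by_cases hz : z ∈ A
  swap
  · simpa only [surv_of_notMem hz] using summable_zero
  obtain ⟨N, θ, hθ, hN⟩ := exists_surv_le (G := G) A
  refine summable_of_sum_range_le (c := N / (1 - θ)) (fun k => surv_nonneg A k z) fun M => ?_
  set S := A.sup' ⟨z, hz⟩ fun y => ∑ k ∈ Finset.range M, G.surv A k y with hS
  have hle : ∀ y ∈ A, ∑ k ∈ Finset.range M, G.surv A k y ≤ S := fun y hy =>
    Finset.le_sup' (fun y => ∑ k ∈ Finset.range M, G.surv A k y) hy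
  have hθ0 : 0 ≤ θ := (surv_nonneg A N z).trans (hN z)
  have h1 : S ≤ N + θ * S := by
    refine Finset.sup'_le _ _ fun y hy => ?_
    calc ∑ k ∈ Finset.range M, G.surv A k y ≤ ∑ k ∈ Finset.range (N + M), G.surv A k y :=
          Finset.sum_le_sum_of_subset_of_nonneg (Finset.range_mono (Nat.le_add_left M N))
            fun k _ _ => surv_nonneg A k y
      _ = ∑ k ∈ Finset.range N, G.surv A k y + ∑ k ∈ Finset.range M, G.surv A (N + k) y :=
          Finset.sum_range_add _ N M
      _ ≤ ∑ _k ∈ Finset.range N, (1 : ℝ) + ∑ k ∈ Finset.range M, θ * G.surv A k y := by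
          refine add_le_add (Finset.sum_le_sum fun k _ => surv_le_one A k y)
            (Finset.sum_le_sum fun k _ => ?_)
          rw [add_comm]; exact surv_add_le k N (fun y _ => hN y) y
      _ ≤ N + θ * S := by
          rw [← Finset.mul_sum]
          simpa using mul_le_mul_of_nonneg_left (hle y hy) hθ0
  refine (hle z hz).trans ?_
  rw [le_div_iff₀ (by linarith)]
  linarith

theorem exists_bound (A : Finset Γ) (f : Γ → ℝ) : ∃ c, 0 ≤ c ∧ ∀ x ∈ A, |f x| ≤ c :=
  ⟨∑ x ∈ A, |f x|, Finset.sum_nonneg fun _ _ => abs_nonneg _, fun _ hx =>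
    Finset.single_le_sum (f := fun x => |f x|) (fun _ _ => abs_nonneg _) hx⟩

theorem abs_L_pow_le {c : ℝ} (hf : ∀ y ∈ A, |f y| ≤ c) (k : ℕ) (hx : x ∈ A) :
    |(G.L A ^ k) f x| ≤ c * G.surv A k x := by
  rw [abs_le]
  constructor
  · have h := L_pow_le_mul_surv (G := G) (f := -f) (fun y hy => (neg_le_abs _).trans (hf y hy)) k hx
    rw [map_neg, Pi.neg_apply] at h
    linarith
  · exact L_pow_le_mul_surv (fun y hy => (le_abs_self _).trans (hf y hy)) k hx

theorem summable_L_pow (f : Γ → ℝ) (hx : x ∈ A) : Summable fun k => (G.L A ^ k) f x := by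
  obtain ⟨c, -, hc⟩ := exists_bound A f
  exact Summable.of_norm_bounded ((summable_surv A x).mul_left c)
    fun k => by rw [Real.norm_eq_abs]; exact abs_L_pow_le hc k hx

/-- The minimum principle for the killed walk. -/
theorem nonneg_of_L_le (h : ∀ x ∈ A, G.L A f x ≤ f x) : ∀ x ∈ A, 0 ≤ f x := by
  intro x hx
  -- Iterating gives Lᵏf ≤ f, while Lᵏf tends to 0 since its series converges.
  have h1 : ∀ k, ∀ y ∈ A, (G.L A ^ k) f y ≤ f y := by
    intro k
    induction k with
    | zero => simp
    | succ k ih =>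
      intro y hy
      rw [L_pow_succ]
      exact (L_mono ih y).trans (h y hy)
  exact le_of_tendsto (summable_L_pow f hx).tendsto_atTop_zero
    (Filter.Eventually.of_forall fun k => h1 k x hx)

theorem gop_eq_add (f : Γ → ℝ) (hx : x ∈ A) : G.gop A f x = f x + G.L A (G.gop A f) x := by
  rw [gop, (summable_L_pow f hx).tsum_eq_zero_add, L_apply_of_mem hx]
  simp only [gop, ← tsum_mul_left]
  rw [← Summable.tsum_finsetSum fun y hy => (summable_L_pow f hy).mul_left _]
  congr 1
  refine tsum_congr fun k => ?_
  rw [L_pow_succ, L_apply_of_mem hx]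

theorem gop_nonneg (hf : ∀ y ∈ A, 0 ≤ f y) (hx : x ∈ A) : 0 ≤ G.gop A f x :=
  tsum_nonneg fun k => L_pow_nonneg hf k hx

/-- The series telescopes and Lᵏv → 0. Thus v is the Green potential of its charge v - Lv. -/
theorem gop_sub_L (v : Γ → ℝ) (hx : x ∈ A) : G.gop A (v - G.L A v) x = v x := by
  have h1 : ∀ k, (G.L A ^ k) (v - G.L A v) x = (G.L A ^ k) v x - (G.L A ^ (k + 1)) v x := by
    intro k; rw [map_sub, Pi.sub_apply, L_pow_succ']
  have hs := summable_L_pow (G := G) (v - G.L A v) hx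
  refine HasSum.tsum_eq ((hs.hasSum_iff_tendsto_nat).2 ?_)
  simp only [h1, Finset.sum_range_sub']
  simpa using (summable_L_pow (G := G) v hx).tendsto_atTop_zero.const_sub (v x)

theorem ET_eq_gop (A : Finset Γ) (x : Γ) : G.ET A x = G.gop A (ind A) x := rfl

theorem ET_of_notMem (hx : x ∉ A) : G.ET A x = 0 := by
  simp only [ET, surv_of_notMem hx, tsum_zero]

theorem ET_nonneg (A : Finset Γ) (x : Γ) : 0 ≤ G.ET A x := tsum_nonneg fun k => surv_nonneg A k x

theorem ET_mono (h : A ⊆ B) (x : Γ) : G.ET A x ≤ G.ET B x :=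
  (summable_surv A x).tsum_le_tsum (fun k => surv_mono_set h k x) (summable_surv B x)

theorem ET_eq_add (hx : x ∈ A) : G.ET A x = 1 + G.L A (G.ET A) x := by
  have h := gop_eq_add (G := G) (ind A) hx
  rw [ind_of_mem hx] at h
  exact h

/-- Markov's inequality for the exit time: the first n survival probabilities are all at least the
n-th. -/
theorem mul_surv_le_ET (n : ℕ) (x : Γ) : n * G.surv A n x ≤ G.ET A x := by
  calc n * G.surv A n x = ∑ _k ∈ Finset.range n, G.surv A n x := by simp
    _ ≤ ∑ k ∈ Finset.range n, G.surv A k x :=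
        Finset.sum_le_sum fun k hk => surv_antitone A x (Finset.mem_range.1 hk).le
    _ ≤ G.ET A x := (summable_surv A x).sum_le_tsum _ fun k _ => surv_nonneg A k x

/-- Markov property at time n: up to then at most n units of time are spent, and a surviving walk
expects at most M more. Its use is to bound survival from below. -/
theorem ET_le_add {M : ℝ} (n : ℕ) (hM : ∀ y ∈ A, G.ET A y ≤ M) (x : Γ) :
    G.ET A x ≤ n + G.surv A n x * M := by
  by_cases hx : x ∈ A
  swap
  · rw [ET_of_notMem hx, surv_of_notMem hx]; simp
  have h1 : ∑ k ∈ Finset.range n, G.surv A k x ≤ n := by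
    calc _ ≤ ∑ _k ∈ Finset.range n, (1 : ℝ) := Finset.sum_le_sum fun k _ => surv_le_one A k x
      _ = n := by simp
  have h2 : ∑' k, G.surv A (k + n) x = (G.L A ^ n) (G.ET A) x := by
    rw [L_pow_eq_sum_hk n _ hx]
    simp only [ET, ← tsum_mul_left]
    rw [← Summable.tsum_finsetSum fun y _ => ((summable_surv A y).mul_left _).mul_left _]
    refine tsum_congr fun k => ?_
    rw [add_comm, surv, L_pow_add, L_pow_eq_sum_hk n _ hx]; rfl
  have h3 := L_pow_le_mul_surv (G := G) hM n hx
  have h4 := (summable_surv (G := G) A x).sum_add_tsum_nat_add n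
  rw [ET, ← h4, h2]
  linarith

theorem ip_gop (f g : Γ → ℝ) : G.ip A (G.gop A f) g = G.ip A f (G.gop A g) := by
  have h : ∀ u v : Γ → ℝ, G.ip A (G.gop A u) v = ∑' k, G.ip A ((G.L A ^ k) u) v := by
    intro u v
    simp only [ip]
    rw [Summable.tsum_finsetSum fun x hx => ((summable_L_pow u hx).mul_right _).mul_left _]
    refine Finset.sum_congr rfl fun x hx => ?_
    rw [gop, tsum_mul_left, tsum_mul_right]
  rw [h, ip_comm (f := f), h]
  exact tsum_congr fun k => by rw [ip_L_pow, ip_comm]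

theorem summable_hk (A : Finset Γ) (x y : Γ) : Summable fun k => G.hk A k x y := by
  by_cases hx : x ∈ A
  · exact (summable_L_pow (dl A y) hx).div_const _
  · simpa only [hk_of_notMem_left hx] using summable_zero

theorem gr_eq_gop (A : Finset Γ) (x y : Γ) : G.gr A x y = G.gop A (dl A y) x / G.mass y := by
  rw [gr, gop, ← tsum_div_const]; rfl

theorem gr_nonneg (A : Finset Γ) (x y : Γ) : 0 ≤ G.gr A x y := tsum_nonneg fun k => hk_nonneg A k x y

theorem gr_comm (A : Finset Γ) (x y : Γ) : G.gr A x y = G.gr A y x :=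
  tsum_congr fun k => hk_comm A k x y

theorem gr_mono (h : A ⊆ B) (x y : Γ) : G.gr A x y ≤ G.gr B x y :=
  (summable_hk A x y).tsum_le_tsum (fun k => hk_mono_set h k x y) (summable_hk B x y)

theorem gr_of_notMem_left (hx : x ∉ A) (y : Γ) : G.gr A x y = 0 := by
  simp only [gr, hk_of_notMem_left hx, tsum_zero]

theorem gr_of_notMem_right (hy : y ∉ A) (x : Γ) : G.gr A x y = 0 := by
  rw [gr_comm, gr_of_notMem_left hy]

theorem gop_eq_sum_gr (f : Γ → ℝ) (hx : x ∈ A) :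
    G.gop A f x = ∑ y ∈ A, G.mass y * (G.gr A x y * f y) := by
  simp only [gop, gr, ← tsum_mul_right, ← tsum_mul_left]
  rw [← Summable.tsum_finsetSum fun y _ => ((summable_hk A x y).mul_right _).mul_left _]
  exact tsum_congr fun k => L_pow_eq_sum_hk k f hx

theorem ET_eq_sum_gr (hx : x ∈ A) : G.ET A x = ∑ y ∈ A, G.mass y * G.gr A x y := by
  rw [ET_eq_gop, gop_eq_sum_gr _ hx]
  exact Finset.sum_congr rfl fun y hy => by rw [ind_of_mem hy, mul_one]

theorem gr_eq_add (hx : x ∈ A) :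
    G.gr A x y = dl A y x / G.mass y + G.L A (fun z => G.gr A z y) x := by
  rw [gr_eq_gop, gop_eq_add _ hx, add_div, L_apply_of_mem hx, L_apply_of_mem hx, Finset.sum_div]
  congr 1
  exact Finset.sum_congr rfl fun z _ => by rw [gr_eq_gop]; ring

end

noncomputable section

variable {Γ : Type*} {G : WeightedGraph Γ} [Countable Γ] [Infinite Γ] [MeasurableSpace Γ]
  [DiscreteMeasurableSpace Γ] {A : Finset Γ} {x y z : Γ}

/-! ### The law of the walk in terms of the killed operators -/

/-- The paths which stay in `A` up to time `k` and are at `y` at time `k`. -/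
def stay (A : Finset Γ) (k : ℕ) (y : Γ) : Set (ℕ → Γ) := {ω | (∀ i ≤ k, ω i ∈ A) ∧ ω k = y}

instance (x : Γ) : IsProbabilityMeasure (G.walkLaw x) := by
  unfold walkLaw; infer_instance

theorem measurableSet_forall_mem (A : Finset Γ) (k : ℕ) :
    MeasurableSet {ω : ℕ → Γ | ∀ i ≤ k, ω i ∈ A} := by
  have h : {ω : ℕ → Γ | ∀ i ≤ k, ω i ∈ A} = ⋂ i ≤ k, (fun ω : ℕ → Γ => ω i) ⁻¹' (A : Set Γ) := by
    ext ω; simp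
  rw [h]
  exact MeasurableSet.iInter fun i => MeasurableSet.iInter fun _ =>
    measurable_pi_apply i (MeasurableSet.of_discrete)

theorem measurableSet_stay (A : Finset Γ) (k : ℕ) (y : Γ) : MeasurableSet (stay A k y) := by
  have hm : MeasurableSet ((fun ω : ℕ → Γ => ω k) ⁻¹' {y}) :=
    measurable_pi_apply k (MeasurableSet.of_discrete)
  exact (measurableSet_forall_mem A k).inter hm

theorem walkLaw_map_zero (x : Γ) : (G.walkLaw x).map (fun ω => ω 0) = Measure.dirac x := by
  have h := Kernel.traj_map_frestrictLe_apply (X := fun _ => Γ) (κ := G.pathKernel) 0 0 (fun _ => x)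
  rw [Kernel.partialTraj_self, Kernel.id_apply] at h
  have h2 : (fun ω : ℕ → Γ => ω 0) =
      (fun u : (i : Finset.Iic 0) → Γ => u ⟨0, by simp⟩) ∘
        (Preorder.frestrictLe (π := fun _ => Γ) 0) := rfl
  rw [h2, ← Measure.map_map (measurable_pi_apply _) (by fun_prop)]
  rw [walkLaw]
  erw [h]
  rw [Measure.map_dirac' (measurable_pi_apply _)]

/-- The joint law of the path up to time k and of the next position is a composition product with
`pathKernel`; on the given event that kernel is the one-step law from z. -/
theorem walkLaw_step (x y : Γ) (k : ℕ) (z : Γ) :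
    G.walkLaw x (stay A k z ∩ {ω | ω (k + 1) = y}) =
      ENNReal.ofReal (G.P z y) * G.walkLaw x (stay A k z) := by
  have h := Kernel.partialTraj_compProd_eq_map_traj (X := fun _ => Γ) (κ := G.pathKernel)
    (Nat.zero_le k) (x₀ := fun _ => x)
  set S : Set ((i : Finset.Iic k) → Γ) := {u | (∀ i, u i ∈ A) ∧ u ⟨k, by simp⟩ = z} with hS
  have mS : MeasurableSet S := by
    have : S = (⋂ i, (fun u => u i) ⁻¹' (A : Set Γ)) ∩ (fun u => u ⟨k, by simp⟩) ⁻¹' {z} := by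
      ext u; simp [S]
    rw [this]
    exact (MeasurableSet.iInter fun i => measurable_pi_apply i (MeasurableSet.of_discrete)).inter
      (measurable_pi_apply _ (MeasurableSet.of_discrete))
  have hpre : stay A k z = (Preorder.frestrictLe (π := fun _ => Γ) k) ⁻¹' S := by
    ext ω
    simp only [stay, S, Set.mem_ofPred_eq, Set.mem_preimage, Preorder.frestrictLe_apply]
    refine and_congr_left fun _ => ⟨fun h i => h i (Finset.mem_Iic.1 i.2),
      fun h i hi => h ⟨i, Finset.mem_Iic.2 hi⟩⟩
  have h1 : G.walkLaw x (stay A k z ∩ {ω | ω (k + 1) = y}) =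
      ((G.walkLaw x).map fun ω => (Preorder.frestrictLe (π := fun _ => Γ) k ω, ω (k + 1)))
        (S ×ˢ {y}) := by
    rw [Measure.map_apply (by fun_prop) (mS.prod (MeasurableSet.of_discrete))]
    congr 1
    ext ω
    simp [hpre]
  rw [h1, walkLaw]
  erw [← h]
  rw [Measure.compProd_apply (mS.prod (MeasurableSet.of_discrete))]
  have h2 : ∀ u : (i : Finset.Iic k) → Γ, (G.pathKernel k u) (Prod.mk u ⁻¹' (S ×ˢ {y})) =
      S.indicator (fun _ => ENNReal.ofReal (G.P z y)) u := by
    intro u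
    by_cases hu : u ∈ S
    · have e : Prod.mk u ⁻¹' (S ×ˢ ({y} : Set Γ)) = {y} := by ext w; simp [hu]
      rw [e, Set.indicator_of_mem hu, pathKernel, Kernel.comap_apply, hu.2]
      change (G.stepPMF z).toMeasure {y} = _
      rw [PMF.toMeasure_apply_singleton _ _ (MeasurableSet.of_discrete)]
      rfl
    · have e : Prod.mk u ⁻¹' (S ×ˢ ({y} : Set Γ)) = ∅ := by ext w; simp [hu]
      rw [e, Set.indicator_of_notMem hu, measure_empty]
  simp only [h2]
  rw [lintegral_indicator_const mS, hpre,
    ← Kernel.traj_map_frestrictLe_apply (X := fun _ => Γ) (κ := G.pathKernel) 0 k (fun _ => x),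
    Measure.map_apply (by fun_prop) mS]

/-- A recursion in the last step, matching `walkLaw_step`; powers of `L` peel off the first step,
and Chapman–Kolmogorov converts one into the other. -/
theorem mass_mul_hk_succ (k : ℕ) (hy : y ∈ A) :
    G.mass y * G.hk A (k + 1) x y = ∑ z ∈ A, G.P z y * (G.mass z * G.hk A k x z) := by
  rw [hk_add, Finset.mul_sum]
  refine Finset.sum_congr rfl fun z hz => ?_
  have h1 : G.mass y * G.hk A 1 z y = G.P z y := by
    rw [hk, pow_one, mul_div_cancel₀ _ (G.mass_pos y).ne', L_apply_of_mem hz,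
      Finset.sum_eq_single y]
    · simp [dl, hy]
    · intro w _ hw; simp [dl, hw]
    · exact fun h => (h hy).elim
  rw [← h1]; ring

theorem walkLaw_stay (x y : Γ) (k : ℕ) :
    G.walkLaw x (stay A k y) = ENNReal.ofReal (G.mass y * G.hk A k x y) := by
  by_cases hy : y ∈ A
  swap
  · rw [hk_of_notMem_right hy, mul_zero, ENNReal.ofReal_zero]
    have : stay A k y = ∅ := by
      ext ω
      simp only [stay, Set.mem_ofPred_eq, Set.mem_empty_iff_false, iff_false, not_and]
      rintro h rfl; exact hy (h k le_rfl)
    rw [this, measure_empty]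
  induction k generalizing y with
  | zero =>
    have h1 : stay A 0 y = (fun ω : ℕ → Γ => ω 0) ⁻¹' {y} := by
      ext ω
      simp only [stay, nonpos_iff_eq_zero, forall_eq, Set.mem_ofPred_eq, Set.mem_preimage,
        Set.mem_singleton_iff, and_iff_right_iff_imp]
      rintro rfl; exact hy
    rw [h1, ← Measure.map_apply (measurable_pi_apply 0) (MeasurableSet.of_discrete),
      walkLaw_map_zero, Measure.dirac_apply' _ (MeasurableSet.of_discrete), hk, pow_zero,
      Module.End.one_apply, mul_div_cancel₀ _ (G.mass_pos y).ne']
    by_cases hxy : x = y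
    · subst hxy; simp [dl, hy]
    · simp [dl, hxy]
  | succ k ih =>
    have h1 : stay A (k + 1) y = ⋃ z ∈ A, (stay A k z ∩ {ω | ω (k + 1) = y}) := by
      ext ω
      simp only [stay, Set.mem_ofPred_eq, Set.mem_iUnion, Set.mem_inter_iff, exists_prop]
      constructor
      · rintro ⟨h, h'⟩
        exact ⟨ω k, h k (Nat.le_succ k), ⟨fun i hi => h i (hi.trans (Nat.le_succ k)), rfl⟩, h'⟩
      · rintro ⟨z, -, ⟨h, -⟩, h'⟩
        refine ⟨fun i hi => ?_, h'⟩
        rcases Nat.le_succ_iff.1 hi with hi | rfl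
        · exact h i hi
        · exact h' ▸ hy
    rw [h1, measure_biUnion_finset]
    · rw [mass_mul_hk_succ k hy, ENNReal.ofReal_sum_of_nonneg]
      · refine Finset.sum_congr rfl fun z hz => ?_
        rw [walkLaw_step x y k z, ih z hz, ENNReal.ofReal_mul (G.P_nonneg z y)]
      · exact fun z _ => mul_nonneg (G.P_nonneg z y) (mul_nonneg (mass_nonneg z) (hk_nonneg A k x z))
    · intro z _ w _ hzw
      refine Set.disjoint_left.2 fun ω h1 h2 => hzw ?_
      exact h1.1.2.symm.trans h2.1.2
    · have hm : MeasurableSet ((fun ω : ℕ → Γ => ω (k + 1)) ⁻¹' {y}) :=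
        measurable_pi_apply (k + 1) (MeasurableSet.of_discrete)
      exact fun z _ => (measurableSet_stay A k z).inter hm

theorem walkLaw_forall_mem (x : Γ) (k : ℕ) :
    G.walkLaw x {ω | ∀ i ≤ k, ω i ∈ A} = ENNReal.ofReal (G.surv A k x) := by
  have h1 : {ω : ℕ → Γ | ∀ i ≤ k, ω i ∈ A} = ⋃ z ∈ A, stay A k z := by
    ext ω
    simp only [stay, Set.mem_ofPred_eq, Set.mem_iUnion, exists_prop]
    exact ⟨fun h => ⟨ω k, h k le_rfl, h, rfl⟩, fun ⟨_, _, h, _⟩ => h⟩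
  rw [h1, measure_biUnion_finset]
  · simp only [walkLaw_stay]
    rw [← ENNReal.ofReal_sum_of_nonneg fun z _ => mul_nonneg (mass_nonneg z) (hk_nonneg A k x z)]
    congr 1
    by_cases hx : x ∈ A
    · rw [surv_eq_sum_hk hx]
    · rw [surv_of_notMem hx]
      exact Finset.sum_eq_zero fun z _ => by rw [hk_of_notMem_left hx, mul_zero]
  · intro z _ w _ hzw
    exact Set.disjoint_left.2 fun ω h1 h2 => hzw (h1.2.symm.trans h2.2)
  · exact fun z _ => measurableSet_stay A k z

/-- The heat kernel of the walk agrees with the one of a finite set which is not left. -/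
theorem heatKernel_eq_hk (n : ℕ) (x y : Γ) (h : G.surv A n x = 1) :
    G.heatKernel n x y = G.hk A n x y := by
  have h1 : G.walkLaw x {ω | ω n = y} = G.walkLaw x (stay A n y) := by
    have hfull : G.walkLaw x {ω | ∀ i ≤ n, ω i ∈ A}ᶜ = 0 := by
      rw [prob_compl_eq_zero_iff, walkLaw_forall_mem, h, ENNReal.ofReal_one]
      exact measurableSet_forall_mem A n
    refine measure_congr ?_
    filter_upwards [measure_eq_zero_iff_ae_notMem.1 hfull] with ω hω
    refine propext ⟨fun h' => ⟨?_, h'⟩, fun h' => h'.2⟩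
    simpa using hω
  rw [heatKernel, Pn, measureReal_def, h1, walkLaw_stay,
    ENNReal.toReal_ofReal (mul_nonneg (mass_nonneg y) (hk_nonneg A n x y)),
    mul_div_cancel_left₀ _ (G.mass_pos y).ne']

/-- The exit time counts the times k up to which the path has stayed in A, also when there are
infinitely many. Integrating gives the mean exit time as the sum of survival probabilities. -/
theorem exitTime_eq_tsum (A : Finset Γ) (ω : ℕ → Γ) :
    exitTime (A : Set Γ) ω = ∑' k, ({ω : ℕ → Γ | ∀ i ≤ k, ω i ∈ A}).indicator 1 ω := by
  by_cases h : ∃ k, ω k ∉ A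
  · have hk : ω (Nat.find h) ∉ A := Nat.find_spec h
    have hlt : ∀ i < Nat.find h, ω i ∈ A := fun i hi => not_not.1 (Nat.find_min h hi)
    have h1 : exitTime (A : Set Γ) ω = (Nat.find h : ℝ≥0∞) := by
      refine le_antisymm (iInf₂_le (Nat.find h) (by simpa using hk)) (le_iInf₂ fun k hk' => ?_)
      exact_mod_cast Nat.find_min' h (by simpa using hk')
    rw [h1, tsum_eq_sum (s := Finset.range (Nat.find h))]
    · rw [Finset.sum_congr rfl fun k hk => Set.indicator_of_mem (s := {ω : ℕ → Γ | ∀ i ≤ k, ω i ∈ A})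
        (f := (1 : (ℕ → Γ) → ℝ≥0∞))
        (fun i hi => hlt i (hi.trans_lt (Finset.mem_range.1 hk)))]
      simp
    · intro k hk'
      refine Set.indicator_of_notMem (fun h' => hk ?_) _
      exact h' _ (not_lt.1 fun h2 => hk' (Finset.mem_range.2 h2))
  · push Not at h
    have h1 : exitTime (A : Set Γ) ω = ⊤ := by
      refine iInf₂_eq_top.2 fun k hk => (hk (by simpa using h k)).elim
    rw [h1]
    have h2 : ∀ k, ({ω : ℕ → Γ | ∀ i ≤ k, ω i ∈ A}).indicator (1 : (ℕ → Γ) → ℝ≥0∞) ω = 1 :=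
      fun k => Set.indicator_of_mem (s := {ω : ℕ → Γ | ∀ i ≤ k, ω i ∈ A}) (fun i _ => h i) _
    simp only [h2]
    exact (ENNReal.tsum_const_eq_top_of_ne_zero one_ne_zero).symm

theorem meanExit_toReal (A : Finset Γ) (z : Γ) : (G.meanExit z A).toReal = G.ET A z := by
  have h1 : G.meanExit z A = ∑' k, ENNReal.ofReal (G.surv A k z) := by
    rw [meanExit]
    simp only [exitTime_eq_tsum]
    rw [lintegral_tsum fun k => ((measurable_one.indicator (measurableSet_forall_mem A k)).aemeasurable)]
    refine tsum_congr fun k => ?_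
    rw [lintegral_indicator_one (measurableSet_forall_mem A k), walkLaw_forall_mem]
  rw [h1, ← ENNReal.ofReal_tsum_of_nonneg (fun k => surv_nonneg A k z) (summable_surv A z),
    ENNReal.toReal_ofReal (tsum_nonneg fun k => surv_nonneg A k z)]
  rfl

end

noncomputable section

variable {Γ : Type*}

/-! ### Finite balls -/

/-- All balls of the graph are finite. -/
class FiniteBalls (G : WeightedGraph Γ) : Prop where
  finite : ∀ (x : Γ) (N : ℕ), {y | G.graph.dist x y < N}.Finite

variable (G : WeightedGraph Γ)

/-- The ball `B(x,N)` of integer radius as a finite set. -/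
def bf [FiniteBalls G] (x : Γ) (N : ℕ) : Finset Γ := (FiniteBalls.finite (G := G) x N).toFinset

/-- The volume of the ball of integer radius. -/
def Vn [FiniteBalls G] (x : Γ) (N : ℕ) : ℝ := G.vol (G.bf x N)

/-- The mean exit time from the ball of integer radius. -/
def En [FiniteBalls G] (x : Γ) (N : ℕ) : ℝ := G.ET (G.bf x N) x

/-- The inverse of the mean exit time. -/
def en [FiniteBalls G] (x : Γ) (n : ℕ) : ℕ := sInf {R : ℕ | (n : ℝ) ≤ G.En x R}

/-- The volume of the ball the walk typically visits up to time `n`. -/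
def vt [FiniteBalls G] (x : Γ) (n : ℕ) : ℝ := G.Vn x (G.en x n)

variable {G}

/-- Transition probabilities out of a vertex are summable and at least p on edges, so each vertex
has finitely many neighbours; balls are then finite by induction on the radius. -/
theorem finiteBalls_of_controlledWeights [Infinite Γ] (h : G.ControlledWeights) :
    G.FiniteBalls := by
  obtain ⟨p, hp, h⟩ := h
  have hnb : ∀ x, {y | G.graph.Adj x y}.Finite := by
    intro x
    have h1 := (G.hasSum_P x).summable.tendsto_cofinite_zero.eventually (gt_mem_nhds hp)
    refine (Filter.eventually_cofinite.1 h1).subset fun y hy => ?_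
    exact not_lt.2 (h x y hy)
  refine ⟨fun x N => ?_⟩
  induction N with
  | zero => simp
  | succ N ih =>
    refine (((ih.biUnion fun z _ => hnb z).union ih).union (Set.finite_singleton x)).subset ?_
    intro y hy
    by_cases hxy : x = y
    · exact Or.inr hxy.symm
    left
    obtain ⟨p, hpl⟩ := G.connected.exists_walk_length_eq_dist y x
    cases p with
    | nil => exact (hxy rfl).elim
    | @cons _ z _ hadj q =>
      have hq : G.graph.dist x z ≤ q.length := by
        rw [SimpleGraph.dist_comm]; exact SimpleGraph.dist_le q
      rw [SimpleGraph.Walk.length_cons, SimpleGraph.dist_comm] at hpl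
      refine Or.inl (Set.mem_iUnion₂.2 ⟨z, ?_, hadj.symm⟩)
      have hy' : G.graph.dist x y < N + 1 := hy
      change G.graph.dist x z < N
      omega

section

variable [FiniteBalls G] {x y z : Γ} {N M n : ℕ}

@[simp] theorem mem_bf : y ∈ G.bf x N ↔ G.graph.dist x y < N := by simp [bf]

theorem dist_triangle (x y z : Γ) :
    G.graph.dist x z ≤ G.graph.dist x y + G.graph.dist y z := G.connected.dist_triangle

theorem bf_mono (h : N ≤ M) : G.bf x N ⊆ G.bf x M := fun y hy => by
  rw [mem_bf] at hy ⊢; omega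

theorem bf_subset_bf (h : G.graph.dist x y + M ≤ N) : G.bf y M ⊆ G.bf x N := fun z hz => by
  rw [mem_bf] at hz ⊢
  have := dist_triangle (G := G) x y z
  omega

theorem mem_bf_self (hN : 0 < N) : x ∈ G.bf x N := by simpa using hN

theorem dist_le_of_adj (h : G.graph.Adj y z) : G.graph.dist x z ≤ G.graph.dist x y + 1 := by
  have h1 := dist_triangle (G := G) x y z
  rw [SimpleGraph.dist_eq_one_iff_adj.2 h] at h1
  exact h1

/-- Distances are integers, so a real radius may be replaced by its ceiling. -/
theorem ball_eq_coe_bf (x : Γ) (R : ℝ) : G.ball x R = (G.bf x ⌈R⌉₊ : Set Γ) := by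
  ext y
  simp only [ball, Set.mem_ofPred_eq, Finset.mem_coe, mem_bf]
  exact Nat.lt_ceil.symm

theorem tsum_ball (x : Γ) (R : ℝ) (f : Γ → ℝ) :
    ∑' y : G.ball x R, f y = ∑ y ∈ G.bf x ⌈R⌉₊, f y := by
  rw [ball_eq_coe_bf]
  exact Finset.tsum_subtype' _ f

theorem V_eq_Vn (x : Γ) (R : ℝ) : G.V x R = G.Vn x ⌈R⌉₊ := tsum_ball x R _

theorem V_natCast (x : Γ) (N : ℕ) : G.V x N = G.Vn x N := by rw [V_eq_Vn, Nat.ceil_natCast]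

theorem vol_mono [Infinite Γ] {A B : Finset Γ} (h : A ⊆ B) : G.vol A ≤ G.vol B :=
  Finset.sum_le_sum_of_subset_of_nonneg h fun x _ _ => mass_nonneg x

theorem vol_nonneg (A : Finset Γ) : 0 ≤ G.vol A := Finset.sum_nonneg fun x _ => mass_nonneg x

theorem mass_le_vol {A : Finset Γ} (hx : x ∈ A) : G.mass x ≤ G.vol A :=
  Finset.single_le_sum (f := G.mass) (fun y _ => mass_nonneg y) hx

variable [Infinite Γ]

theorem Vn_mono (h : N ≤ M) : G.Vn x N ≤ G.Vn x M := vol_mono (bf_mono h)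

theorem Vn_pos (hN : 0 < N) : 0 < G.Vn x N :=
  (G.mass_pos x).trans_le (mass_le_vol (mem_bf_self hN))

theorem bf_one (x : Γ) : G.bf x 1 = {x} := by
  ext y
  rw [mem_bf, Nat.lt_one_iff, G.connected.dist_eq_zero_iff, Finset.mem_singleton]
  exact eq_comm

theorem Vn_one (x : Γ) : G.Vn x 1 = G.mass x := by rw [Vn, bf_one, vol, Finset.sum_singleton]

theorem En_mono (h : N ≤ M) : G.En x N ≤ G.En x M := ET_mono (bf_mono h) x

theorem En_nonneg (x : Γ) (N : ℕ) : 0 ≤ G.En x N := ET_nonneg _ x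

theorem P_eq_zero (h : ¬ G.graph.Adj x y) : G.P x y = 0 := by
  rw [P, G.weight_eq_zero x y h, zero_div]

theorem P_sum_eq_one {A : Finset Γ} (h : ∀ y, G.graph.Adj z y → y ∈ A) :
    ∑ y ∈ A, G.P z y = 1 := by
  rw [← (G.hasSum_P z).tsum_eq, tsum_eq_sum]
  exact fun y hy => P_eq_zero fun h' => hy (h y h')

theorem surv_bf_eq_one (x : Γ) (N k : ℕ) (z : Γ) (h : G.graph.dist x z + k < N) :
    G.surv (G.bf x N) k z = 1 := by
  induction k generalizing z with
  | zero => rw [surv_zero, ind_of_mem (by rw [mem_bf]; omega)]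
  | succ k ih =>
    have hadj : ∀ y, G.graph.Adj z y → G.graph.dist x y + k < N := fun y hy => by
      have := dist_le_of_adj (x := x) hy; omega
    rw [surv_succ, L_apply_of_mem (by rw [mem_bf]; omega),
      ← P_sum_eq_one (z := z) (A := G.bf x N) fun y hy => by rw [mem_bf]; have := hadj y hy; omega]
    refine Finset.sum_congr rfl fun y _ => ?_
    by_cases hy : G.graph.Adj z y
    · rw [ih y (hadj y hy), mul_one]
    · rw [P_eq_zero hy, zero_mul]

/-- Unit steps cannot leave the ball before time N. In particular the set defining `en` is never
empty, so its infimum is attained. -/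
theorem le_En (x : Γ) (N : ℕ) : (N : ℝ) ≤ G.En x N := by
  calc (N : ℝ) = ∑ k ∈ Finset.range N, G.surv (G.bf x N) k x := by
        rw [Finset.sum_congr rfl fun k hk => surv_bf_eq_one x N k x (by
          rw [SimpleGraph.dist_self]; simpa using hk)]
        simp
    _ ≤ _ := (summable_surv _ x).sum_le_tsum _ fun k _ => surv_nonneg _ k x

theorem En_pos (hN : 0 < N) : 0 < G.En x N := (Nat.cast_pos.2 hN).trans_le (le_En x N)

theorem En_zero (x : Γ) : G.En x 0 = 0 := ET_of_notMem (by simp)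

/-- There are no loops, so the first step leaves the singleton ball. -/
theorem En_one (x : Γ) : G.En x 1 = 1 := by
  rw [En, bf_one, ET_eq_add (Finset.mem_singleton_self x),
    L_apply_of_mem (Finset.mem_singleton_self x), Finset.sum_singleton,
    P_eq_zero (G.graph.loopless.irrefl x), zero_mul, add_zero]

theorem le_En_en (x : Γ) (n : ℕ) : (n : ℝ) ≤ G.En x (G.en x n) :=
  Nat.sInf_mem (s := {R : ℕ | (n : ℝ) ≤ G.En x R}) ⟨n, le_En x n⟩

theorem en_le (h : (n : ℝ) ≤ G.En x N) : G.en x n ≤ N := Nat.sInf_le h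

theorem lt_en_iff : N < G.en x n ↔ G.En x N < n := by
  refine ⟨fun h => not_le.1 fun h' => (en_le h').not_gt h, fun h => not_le.1 fun h' => ?_⟩
  exact absurd ((le_En_en x n).trans (En_mono h')) (not_le.2 h)

theorem en_pos (hn : 0 < n) : 0 < G.en x n := by
  rw [lt_en_iff, En_zero]; exact_mod_cast hn

theorem en_mono (h : N ≤ M) : G.en x N ≤ G.en x M :=
  en_le ((Nat.cast_le.2 h).trans (le_En_en x M))

theorem en_one (x : Γ) : G.en x 1 = 1 :=
  le_antisymm (en_le (by rw [En_one]; norm_num)) (en_pos one_pos)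

theorem vt_pos (hn : 0 < n) : 0 < G.vt x n := Vn_pos (en_pos hn)

theorem vt_one (x : Γ) : G.vt x 1 = G.mass x := by rw [vt, en_one, Vn_one]

theorem vt_mono (h : N ≤ M) : G.vt x N ≤ G.vt x M := Vn_mono (en_mono h)

/-! ### Kernels and exit times of balls as finite sums -/

theorem killedPn_coe (A : Finset Γ) (k : ℕ) (x y : Γ) :
    G.killedPn A k x y = (G.L A ^ k) (dl A y) x := by
  induction k generalizing x with
  | zero => simp [killedPn, dl]
  | succ k ih =>
    rw [killedPn, L_pow_succ]
    by_cases hx : x ∈ A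
    · rw [L_apply_of_mem hx, tsum_eq_sum (s := A)]
      · refine Finset.sum_congr rfl fun z hz => ?_
        rw [ih, killedP, if_pos ⟨hx, hz⟩]
      · intro z hz
        rw [killedP, if_neg fun h => hz h.2, zero_mul]
    · rw [L_apply_of_notMem hx]
      simp [killedP, hx]

theorem green_coe (A : Finset Γ) (y z : Γ) : G.green A y z = G.gr A y z := by
  rw [green, gr, ← tsum_div_const]
  exact tsum_congr fun k => by rw [killedPn_coe]; rfl

variable [Countable Γ] [MeasurableSpace Γ] [DiscreteMeasurableSpace Γ]

theorem E_eq_En (x : Γ) (R : ℝ) : G.E x R = G.En x ⌈R⌉₊ := by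
  rw [E, ball_eq_coe_bf, meanExit_toReal]; rfl

theorem E_natCast (x : Γ) (N : ℕ) : G.E x N = G.En x N := by rw [E_eq_En, Nat.ceil_natCast]

theorem e_eq_en (x : Γ) (n : ℕ) : G.e x n = G.en x n := by
  simp only [e, en, E_natCast]

theorem heatKernel_eq_hk_bf (n : ℕ) (x y : Γ) (hN : n < N) :
    G.heatKernel n x y = G.hk (G.bf x N) n x y :=
  heatKernel_eq_hk n x y (surv_bf_eq_one x N n x (by rw [SimpleGraph.dist_self]; omega))

theorem heatKernel_eq_hk_of_subset {A : Finset Γ} {n : ℕ} (h : G.bf x (n + 1) ⊆ A) (y : Γ) :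
    G.heatKernel n x y = G.hk A n x y := by
  refine heatKernel_eq_hk n x y (le_antisymm (surv_le_one A n x) ?_)
  rw [← surv_bf_eq_one (G := G) x (n + 1) n x (by rw [SimpleGraph.dist_self]; omega)]
  exact surv_mono_set h n x

/-- The walk cannot leave A together with the ball of radius n + 1 within n steps, so killing there
changes nothing, and the killed kernel increases with the set. -/
theorem hk_le_heatKernel (A : Finset Γ) (n : ℕ) (x y : Γ) : G.hk A n x y ≤ G.heatKernel n x y := by
  rw [heatKernel_eq_hk_of_subset (A := A ∪ G.bf x (n + 1)) Finset.subset_union_right]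
  exact hk_mono_set Finset.subset_union_left n x y

theorem heatKernel_nonneg (n : ℕ) (x y : Γ) : 0 ≤ G.heatKernel n x y := by
  rw [heatKernel_eq_hk_bf n x y (Nat.lt_succ_self n)]; exact hk_nonneg _ n x y

theorem heatKernel_comm (n : ℕ) (x y : Γ) : G.heatKernel n x y = G.heatKernel n y x := by
  rw [heatKernel_eq_hk_of_subset (A := G.bf x (n + 1) ∪ G.bf y (n + 1)) Finset.subset_union_left,
    heatKernel_eq_hk_of_subset (A := G.bf x (n + 1) ∪ G.bf y (n + 1)) Finset.subset_union_right,
    hk_comm]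

theorem heatKernel_sq_le (j k : ℕ) (x y : Γ) :
    G.heatKernel (j + k) x y ^ 2 ≤ G.heatKernel (j + j) x x * G.heatKernel (k + k) y y := by
  rw [heatKernel_eq_hk_of_subset (n := j + k)
    (A := G.bf x (j + k + 1) ∪ G.bf y (k + k + 1) ∪ G.bf x (j + j + 1))
    (Finset.subset_union_left.trans Finset.subset_union_left)]
  refine (hk_sq_le j k x y).trans (mul_le_mul (hk_le_heatKernel _ _ _ _) (hk_le_heatKernel _ _ _ _)
    (hk_nonneg _ _ _ _) (heatKernel_nonneg _ _ _))

end

end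

noncomputable section

variable {Γ : Type*}

/-! ### Consequences of the time comparison principle -/

/-- Controlled weights, volume doubling and time comparison with explicit constants, for balls of
integer radius. -/
structure Hyp (G : WeightedGraph Γ) [FiniteBalls G] (p D C : ℝ) : Prop where
  p_pos : 0 < p
  p_le : ∀ x y, G.graph.Adj x y → p ≤ G.P x y
  one_le_D : 1 ≤ D
  vd : ∀ x N, G.Vn x (2 * N) ≤ D * G.Vn x N
  two_le_C : 2 ≤ C
  tc : ∀ x y N, G.graph.dist x y < N → G.En x (2 * N) ≤ C * G.En y N

variable {G : WeightedGraph Γ} [Infinite Γ] {A B : Finset Γ} {x y z : Γ}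

/-- Comparison of mean exit times from nested sets. -/
theorem ET_add_le {m : ℝ} (hBA : B ⊆ A) (hcl : ∀ z ∈ B, ∀ y, G.graph.Adj z y → y ∈ A)
    (hm : ∀ z ∈ B, ∀ y ∉ B, G.graph.Adj z y → m ≤ G.ET A y) :
    ∀ z ∈ B, G.ET B z + m ≤ G.ET A z := by
  -- Inside B both exit times satisfy the same equation with source 1, and at exit points the larger
  -- one is at least m. So the difference minus m is superharmonic for the walk killed outside B.
  have key := nonneg_of_L_le (G := G) (A := B) (f := fun z => G.ET A z - G.ET B z - m) ?_
  · intro z hz; have := key z hz; linarith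
  intro z hz
  have h1 : ∑ y ∈ A \ B, G.P z y * m ≤ ∑ y ∈ A \ B, G.P z y * G.ET A y := by
    refine Finset.sum_le_sum fun y hy => ?_
    by_cases hadj : G.graph.Adj z y
    · exact mul_le_mul_of_nonneg_left (hm z hz y (Finset.mem_sdiff.1 hy).2 hadj) (G.P_nonneg z y)
    · have : G.P z y = 0 := by rw [P, G.weight_eq_zero z y hadj, zero_div]
      rw [this, zero_mul, zero_mul]
  have h2 := Finset.sum_sdiff (f := G.P z) hBA
  have h3 := Finset.sum_sdiff (f := fun y => G.P z y * G.ET A y) hBA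
  have h4 : ∑ y ∈ A, G.P z y = 1 := by
    rw [← (G.hasSum_P z).tsum_eq, tsum_eq_sum]
    intro y hy
    rw [P, G.weight_eq_zero z y fun h' => hy (hcl z hz y h'), zero_div]
  rw [ET_eq_add hz, ET_eq_add (hBA hz), L_apply_of_mem hz, L_apply_of_mem hz,
    L_apply_of_mem (hBA hz), ← h3]
  simp only [mul_sub, Finset.sum_sub_distrib, ← Finset.sum_mul] at h1 ⊢
  have h5 : ∑ y ∈ A \ B, G.P z y = 1 - ∑ y ∈ B, G.P z y := by linarith
  rw [h5] at h1
  linarith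

/-- Leaving a set requires to leave a subset first. -/
theorem one_sub_surv_le {S : ℝ} {n : ℕ} (hS : 0 ≤ S) (hBA : B ⊆ A)
    (hb : ∀ z ∈ B, ∀ y ∉ B, G.graph.Adj z y → 1 - G.surv A n y ≤ S) :
    ∀ k ≤ n, ∀ z ∈ B, 1 - G.surv A k z ≤ S * (1 - G.surv B k z) := by
  intro k
  induction k with
  | zero =>
    intro _ z hz
    rw [surv_zero, surv_zero, ind_of_mem hz, ind_of_mem (hBA hz)]; simp
  | succ k ih =>
    intro hk z hz
    have ih := ih (by omega)
    -- If the walk can step directly out of A, the neighbour outside A has exit probability 1, which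
    -- forces S ≥ 1; otherwise both sides vanish.
    have h1 : 1 - ∑ y ∈ A, G.P z y ≤ S * (1 - ∑ y ∈ A, G.P z y) := by
      by_cases hcl : ∀ y, G.graph.Adj z y → y ∈ A
      · have h4 : ∑ y ∈ A, G.P z y = 1 := by
          rw [← (G.hasSum_P z).tsum_eq, tsum_eq_sum]
          intro y hy
          rw [P, G.weight_eq_zero z y fun h' => hy (hcl y h'), zero_div]
        rw [h4]; simp
      · push Not at hcl
        obtain ⟨y, hy, hyA⟩ := hcl
        have h5 := hb z hz y (fun h => hyA (hBA h)) hy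
        rw [surv_of_notMem hyA] at h5
        have := P_sum_le_one (G := G) A z
        nlinarith
    have h2 : ∑ y ∈ A \ B, G.P z y * (1 - G.surv A k y) ≤ ∑ y ∈ A \ B, G.P z y * S := by
      refine Finset.sum_le_sum fun y hy => ?_
      by_cases hadj : G.graph.Adj z y
      · refine mul_le_mul_of_nonneg_left ?_ (G.P_nonneg z y)
        have h6 := hb z hz y (Finset.mem_sdiff.1 hy).2 hadj
        have h7 := surv_antitone (G := G) A y (show k ≤ n by omega)
        simp only at h7
        linarith
      · have : G.P z y = 0 := by rw [P, G.weight_eq_zero z y hadj, zero_div]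
        rw [this, zero_mul, zero_mul]
    have h3 : ∑ y ∈ B, G.P z y * (1 - G.surv A k y) ≤
        ∑ y ∈ B, G.P z y * (S * (1 - G.surv B k y)) :=
      Finset.sum_le_sum fun y hy => mul_le_mul_of_nonneg_left (ih y hy) (G.P_nonneg z y)
    have h4 := Finset.sum_sdiff (f := G.P z) hBA
    have h5 := Finset.sum_sdiff (f := fun y => G.P z y * (1 - G.surv A k y)) hBA
    have h6 : ∑ y ∈ B, G.P z y * (S * (1 - G.surv B k y)) =
        S * ∑ y ∈ B, G.P z y - S * ∑ y ∈ B, G.P z y * G.surv B k y := by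
      rw [Finset.mul_sum, Finset.mul_sum, ← Finset.sum_sub_distrib]
      exact Finset.sum_congr rfl fun y _ => by ring
    have h7 : ∑ y ∈ A, G.P z y * (1 - G.surv A k y) =
        ∑ y ∈ A, G.P z y - ∑ y ∈ A, G.P z y * G.surv A k y := by
      rw [← Finset.sum_sub_distrib]
      exact Finset.sum_congr rfl fun y _ => by ring
    rw [← Finset.sum_mul] at h2
    rw [surv_succ, surv_succ, L_apply_of_mem hz, L_apply_of_mem (hBA hz)]
    nlinarith

variable [FiniteBalls G] {p D C : ℝ} {N M n : ℕ}

namespace Hyp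

variable (h : G.Hyp p D C)
include h

theorem C_pos : 0 < C := by linarith [h.two_le_C]

theorem D_pos : 0 < D := by linarith [h.one_le_D]

theorem En_two_mul_le (x : Γ) (N : ℕ) : G.En x (2 * N) ≤ C * G.En x N := by
  rcases Nat.eq_zero_or_pos N with rfl | hN
  · simp [En_zero]
  · exact h.tc x x N (by rwa [SimpleGraph.dist_self])

theorem En_pow_two_mul_le (x : Γ) (j N : ℕ) : G.En x (2 ^ j * N) ≤ C ^ j * G.En x N := by
  induction j with
  | zero => simp
  | succ j ih =>
    calc G.En x (2 ^ (j + 1) * N) = G.En x (2 * (2 ^ j * N)) := by ring_nf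
      _ ≤ C * G.En x (2 ^ j * N) := h.En_two_mul_le x _
      _ ≤ C * (C ^ j * G.En x N) := mul_le_mul_of_nonneg_left ih h.C_pos.le
      _ = _ := by ring

theorem Vn_pow_two_mul_le (x : Γ) (j N : ℕ) : G.Vn x (2 ^ j * N) ≤ D ^ j * G.Vn x N := by
  induction j with
  | zero => simp
  | succ j ih =>
    calc G.Vn x (2 ^ (j + 1) * N) = G.Vn x (2 * (2 ^ j * N)) := by ring_nf
      _ ≤ D * G.Vn x (2 ^ j * N) := h.vd x _
      _ ≤ D * (D ^ j * G.Vn x N) := mul_le_mul_of_nonneg_left ih h.D_pos.le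
      _ = _ := by ring

theorem En_pow_four_mul_le (x : Γ) (j N : ℕ) : G.En x (4 ^ j * N) ≤ (C ^ 2) ^ j * G.En x N := by
  have := h.En_pow_two_mul_le x (2 * j) N
  rwa [pow_mul, pow_mul] at this

theorem Vn_pow_four_mul_le (x : Γ) (j N : ℕ) : G.Vn x (4 ^ j * N) ≤ (D ^ 2) ^ j * G.Vn x N := by
  have := h.Vn_pow_two_mul_le x (2 * j) N
  rwa [pow_mul, pow_mul] at this

theorem En_le_of_dist_lt (hd : G.graph.dist x y < N) : G.En x N ≤ C * G.En y N :=
  (En_mono (by omega)).trans (h.tc x y N hd)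

theorem Vn_le_of_dist_lt (hd : G.graph.dist x y < N) : G.Vn x N ≤ D * G.Vn y N := by
  refine le_trans (vol_mono ?_) (h.vd y N)
  exact bf_subset_bf (by rw [SimpleGraph.dist_comm]; omega)

/-- For y in the ball, B(x,N) lies in B(y,2N), and time comparison returns to the centre x. -/
theorem ET_bf_le (x y : Γ) (N : ℕ) : G.ET (G.bf x N) y ≤ C * G.En x N := by
  by_cases hy : y ∈ G.bf x N
  · have hd := mem_bf.1 hy
    rw [SimpleGraph.dist_comm] at hd
    exact (ET_mono (bf_subset_bf (by omega)) y).trans (h.tc y x N hd)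
  · rw [ET_of_notMem hy]
    exact mul_nonneg h.C_pos.le (En_nonneg x N)

/-- The ratio in the anti-doubling property of the mean exit time. -/
theorem one_lt_ratio : 1 < 1 + 1 / C := by have := h.C_pos; linarith [one_div_pos.2 this]

/-- The walk leaves B(x,N) at a point y at distance exactly N. From y it must still leave B(y,2N),
which lies in B(x,4N), and this takes mean time at least E(x,4N)/C by time comparison. -/
theorem le_En_four_mul (x : Γ) (N : ℕ) : (1 + 1 / C) * G.En x N ≤ G.En x (4 * N) := by
  rcases Nat.eq_zero_or_pos N with rfl | hN
  · simp [En_zero]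
  have h1 : ∀ z ∈ G.bf x N, ∀ y ∉ G.bf x N, G.graph.Adj z y → G.graph.dist x y = N := by
    intro z hz y hy hadj
    rw [mem_bf] at hz hy
    have := dist_le_of_adj (x := x) hadj
    omega
  have h2 := ET_add_le (G := G) (B := G.bf x N) (A := G.bf x (4 * N)) (m := 1 / C * G.En x N)
    (bf_mono (by omega)) ?_ ?_ x (mem_bf_self hN)
  · change G.En x N + 1 / C * G.En x N ≤ G.En x (4 * N) at h2
    linarith
  · intro z hz y hadj
    by_cases hy : y ∈ G.bf x N
    · exact bf_mono (by omega) hy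
    · rw [mem_bf, h1 z hz y hy hadj]; omega
  · intro z hz y hy hadj
    have hd := h1 z hz y hy hadj
    calc 1 / C * G.En x N ≤ 1 / C * G.En x (2 * (2 * N)) :=
          mul_le_mul_of_nonneg_left (En_mono (by omega)) (one_div_nonneg.2 h.C_pos.le)
      _ ≤ 1 / C * (C * G.En y (2 * N)) :=
          mul_le_mul_of_nonneg_left (h.tc x y (2 * N) (by omega)) (one_div_nonneg.2 h.C_pos.le)
      _ = G.En y (2 * N) := by field_simp [h.C_pos.ne']
      _ ≤ _ := ET_mono (bf_subset_bf (by omega)) y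

theorem le_En_pow_four_mul (x : Γ) (j N : ℕ) :
    (1 + 1 / C) ^ j * G.En x N ≤ G.En x (4 ^ j * N) := by
  induction j with
  | zero => simp
  | succ j ih =>
    calc (1 + 1 / C) ^ (j + 1) * G.En x N = (1 + 1 / C) * ((1 + 1 / C) ^ j * G.En x N) := by ring
      _ ≤ (1 + 1 / C) * G.En x (4 ^ j * N) :=
          mul_le_mul_of_nonneg_left ih (by linarith [h.one_lt_ratio])
      _ ≤ G.En x (4 * (4 ^ j * N)) := h.le_En_four_mul x _
      _ = _ := by ring_nf

/-- At radius e - 1 the exit time is below n, and doubling that radius reaches e. This needs e ≥ 2;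
for e = 1 the exit time is 1. -/
theorem En_en_le (x : Γ) (hn : 0 < n) : G.En x (G.en x n) ≤ C * n := by
  have hpos := en_pos (G := G) (x := x) hn
  have hn' : (1 : ℝ) ≤ n := by exact_mod_cast hn
  rcases Nat.lt_or_ge 1 (G.en x n) with h1 | h1
  · have h2 : G.En x (G.en x n - 1) < n := lt_en_iff.1 (by omega)
    calc _ ≤ G.En x (2 * (G.en x n - 1)) := En_mono (by omega)
      _ ≤ C * G.En x (G.en x n - 1) := h.En_two_mul_le x _
      _ ≤ C * n := mul_le_mul_of_nonneg_left h2.le h.C_pos.le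
  · rw [show G.en x n = 1 by omega, En_one]
    have := h.two_le_C
    nlinarith

/-! ### The tail of the exit time -/

/-- In E ≤ n + surv · sup ET one has n ≤ E/2 and sup ET ≤ CE, so survival is at least 1/(2C). -/
theorem one_sub_surv_le_of_le_half (hN : 0 < N) (hn : (n : ℝ) ≤ G.En x N / 2) :
    1 - G.surv (G.bf x N) n x ≤ 1 - 1 / (2 * C) := by
  have hE : 0 < G.En x N := En_pos hN
  have h1 := ET_le_add (G := G) (A := G.bf x N) n (fun y _ => h.ET_bf_le x y N) x
  change G.En x N ≤ _ at h1
  have h2 : 1 / (2 * C) ≤ G.surv (G.bf x N) n x := by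
    rw [div_le_iff₀ (by linarith [h.C_pos])]
    have h3 : G.En x N * 1 ≤ G.En x N * (G.surv (G.bf x N) n x * (2 * C)) := by nlinarith
    exact le_of_mul_le_mul_left h3 hE
  linarith

/-- Before leaving the large ball the walk must leave l balls of radius r one after another, each
centred where the previous one was left. Each is left within time n with probability at most 1 -
1/(2C). -/
theorem one_sub_surv_le_pow {r : ℕ} (hr0 : 0 < r)
    (hr : ∀ z ∈ G.bf x N, (n : ℝ) ≤ G.En z r / 2) (l : ℕ) (z : Γ)
    (hz : G.graph.dist x z + l * r ≤ N) :
    1 - G.surv (G.bf x N) n z ≤ (1 - 1 / (2 * C)) ^ l := by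
  have hq : 0 ≤ 1 - 1 / (2 * C) := by
    rw [sub_nonneg, div_le_one (by linarith [h.C_pos])]; linarith [h.two_le_C]
  induction l generalizing z with
  | zero => simpa using surv_nonneg _ n z
  | succ l ih =>
    have hz' : z ∈ G.bf x N := by
      rw [mem_bf]
      have : 0 < (l + 1) * r := by positivity
      omega
    have hz2 : G.graph.dist x z + r + l * r ≤ N := by linarith
    have h1 := one_sub_surv_le (G := G) (A := G.bf x N) (B := G.bf z r) (n := n)
      (pow_nonneg hq l) (bf_subset_bf (by nlinarith [Nat.zero_le (l * r)])) ?_ n le_rfl z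
      (mem_bf_self hr0)
    · refine h1.trans ?_
      rw [pow_succ]
      exact mul_le_mul_of_nonneg_left (h.one_sub_surv_le_of_le_half hr0 (hr z hz')) (pow_nonneg hq l)
    · intro w hw y hy hadj
      rw [mem_bf] at hw hy
      have h2 := dist_le_of_adj (x := z) hadj
      have h3 := dist_triangle (G := G) x z y
      exact ih y (by omega)

/-- Stretched exponential tail of the exit time from a ball. -/
theorem exists_tail : ∃ K c ε : ℝ, 1 ≤ K ∧ 0 < c ∧ 0 < ε ∧ ∀ (x : Γ) (N n : ℕ), 0 < n →
    1 - G.surv (G.bf x N) n x ≤ K * Real.exp (-c * (G.En x N / n) ^ ε) := by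
  have hC := h.two_le_C
  set q := 1 - 1 / (2 * C) with hq
  have hq0 : 0 < q := by
    rw [hq, sub_pos, div_lt_one (by linarith)]; linarith
  have hq1 : q < 1 := by
    rw [hq]; have : 0 < 1 / (2 * C) := by positivity
    linarith
  have hlogq : Real.log q < 0 := Real.log_neg hq0 hq1
  -- Chosen so that C^ε = 2: a time ratio of order Cⁱ pays for 2ⁱ crossings.
  set ε := Real.log 2 / Real.log C with hε
  have hlogC : 0 < Real.log C := Real.log_pos (by linarith)
  have hε0 : 0 < ε := div_pos (Real.log_pos (by norm_num)) hlogC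
  have hCε : C ^ ε = 2 := by
    rw [Real.rpow_def_of_pos (by linarith), hε, mul_div_cancel₀ _ hlogC.ne',
      Real.exp_log (by norm_num)]
  -- Changing the centre and passing to radius r ≈ N/2ⁱ costs C · C^(i+1), while E(x,N) ≥ CⁱTn; what
  -- is left is E(z,r) ≥ 2n. Ratios below T are absorbed in the prefactor.
  set T := 2 * C ^ 2 with hT
  have hT1 : 1 ≤ T := by rw [hT]; nlinarith
  have hT0 : 0 < T := by linarith
  set c := -Real.log q / 2 / T ^ ε with hc
  have hTε : 0 < T ^ ε := Real.rpow_pos_of_pos hT0 ε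
  have hc0 : 0 < c := by rw [hc]; exact div_pos (by linarith) hTε
  have hK1 : 1 ≤ Real.exp (c * T ^ ε) := Real.one_le_exp (by positivity)
  refine ⟨Real.exp (c * T ^ ε), c, ε, hK1, hc0, hε0, fun x N n hn => ?_⟩
  have hn' : (1 : ℝ) ≤ n := by exact_mod_cast hn
  have hn0 : (0 : ℝ) < n := by linarith
  set t := G.En x N / n with ht
  have ht0 : 0 ≤ t := div_nonneg (En_nonneg x N) hn0.le
  rcases lt_or_ge t T with htT | htT
  · have h1 := surv_nonneg (G := G) (G.bf x N) n x
    have h2 : t ^ ε ≤ T ^ ε := Real.rpow_le_rpow ht0 htT.le hε0.le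
    have h3 : 1 ≤ Real.exp (c * T ^ ε) * Real.exp (-c * t ^ ε) := by
      rw [← Real.exp_add]
      exact Real.one_le_exp (by nlinarith)
    linarith
  obtain ⟨i, hi1, hi2⟩ := exists_nat_pow_near (x := t / T) (y := C) ((one_le_div hT0).2 htT)
    (by linarith)
  rw [le_div_iff₀ hT0] at hi1
  have hE : G.En x N = t * n := by rw [ht, div_mul_cancel₀ _ hn0.ne']
  -- Needed for a nonzero crossing radius. Otherwise E(x,N) ≤ Cⁱ by doubling from radius 1, too
  -- small for the ratio t.
  have hiN : 2 ^ i ≤ N := by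
    by_contra hlt
    push Not at hlt
    have h1 : G.En x N ≤ C ^ i := by
      calc G.En x N ≤ G.En x (2 ^ i * 1) := En_mono (by omega)
        _ ≤ C ^ i * G.En x 1 := h.En_pow_two_mul_le x i 1
        _ = C ^ i := by rw [En_one, mul_one]
    have h2 : 0 < C ^ i := pow_pos h.C_pos i
    have h3 : C ^ i * 2 ≤ C ^ i * T := mul_le_mul_of_nonneg_left (by rw [hT]; nlinarith) h2.le
    have h4 : t * 1 ≤ t * n := mul_le_mul_of_nonneg_left hn' ht0
    linarith
  set r := N / 2 ^ i with hr
  have hr0 : 0 < r := Nat.div_pos hiN (by positivity)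
  have hrN : 2 ^ i * r ≤ N := Nat.mul_div_le N (2 ^ i)
  have hNr : N ≤ 2 ^ (i + 1) * r := by
    have h1 : N < 2 ^ i * (r + 1) := Nat.lt_mul_div_succ N (by positivity)
    have h2 : 2 ^ i * 1 ≤ 2 ^ i * r := Nat.mul_le_mul_left _ hr0
    rw [pow_succ]; nlinarith
  have h1 : ∀ z ∈ G.bf x N, (n : ℝ) ≤ G.En z r / 2 := by
    intro z hz
    have h2 : G.En x N ≤ C * (C ^ (i + 1) * G.En z r) := by
      calc G.En x N ≤ C * G.En z N := h.En_le_of_dist_lt (mem_bf.1 hz)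
        _ ≤ C * G.En z (2 ^ (i + 1) * r) := mul_le_mul_of_nonneg_left (En_mono hNr) h.C_pos.le
        _ ≤ _ := mul_le_mul_of_nonneg_left (h.En_pow_two_mul_le z _ r) h.C_pos.le
    have h3 : C ^ i * T * n ≤ C * (C ^ (i + 1) * G.En z r) := by
      rw [hE] at h2
      exact (mul_le_mul_of_nonneg_right hi1 hn0.le).trans h2
    have h4 : (C ^ (i + 2)) * (2 * n) ≤ C ^ (i + 2) * G.En z r := by
      calc _ = C ^ i * T * n := by rw [hT]; ring
        _ ≤ _ := h3
        _ = _ := by ring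
    have := le_of_mul_le_mul_left h4 (pow_pos h.C_pos _)
    linarith
  have h2 := h.one_sub_surv_le_pow hr0 h1 (2 ^ i) x (by rw [SimpleGraph.dist_self]; omega)
  refine h2.trans ?_
  have h3 : (t / T) ^ ε ≤ 2 * 2 ^ i := by
    calc (t / T) ^ ε ≤ (C ^ (i + 1)) ^ ε :=
          Real.rpow_le_rpow (div_nonneg ht0 hT0.le) hi2.le hε0.le
      _ = (C ^ ε) ^ (i + 1) := by
          rw [← Real.rpow_natCast, ← Real.rpow_natCast, ← Real.rpow_mul h.C_pos.le,
            ← Real.rpow_mul h.C_pos.le, mul_comm]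
      _ = 2 * 2 ^ i := by rw [hCε, pow_succ, mul_comm]
  have h4 : -c * t ^ ε = Real.log q / 2 * (t / T) ^ ε := by
    rw [Real.div_rpow ht0 hT0.le, hc]; ring
  have h5 : q ^ 2 ^ i ≤ Real.exp (-c * t ^ ε) := by
    rw [h4, ← Real.exp_log hq0, ← Real.exp_nat_mul, Real.exp_log hq0]
    refine Real.exp_le_exp.2 ?_
    push_cast
    nlinarith
  calc q ^ 2 ^ i ≤ 1 * Real.exp (-c * t ^ ε) := by rw [one_mul]; exact h5
    _ ≤ _ := mul_le_mul_of_nonneg_right hK1 (Real.exp_pos _).le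

/-- The walk does not leave a ball in a time which is small compared to the mean exit time. -/
theorem exists_exit_le {η : ℝ} (hη : 0 < η) : ∃ Λ : ℕ, 0 < Λ ∧ ∀ (x : Γ) (N n : ℕ), 0 < n →
    (Λ * n : ℝ) ≤ G.En x N → 1 - G.surv (G.bf x N) n x ≤ η := by
  obtain ⟨K, c, ε, hK, hc, hε, ht⟩ := h.exists_tail
  have h1 : Filter.Tendsto (fun n : ℕ => K * Real.exp (-(c * (n : ℝ) ^ ε))) Filter.atTop
      (nhds (K * 0)) := by
    refine Filter.Tendsto.const_mul K (Real.tendsto_exp_neg_atTop_nhds_zero.comp ?_)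
    exact ((tendsto_rpow_atTop hε).comp tendsto_natCast_atTop_atTop).const_mul_atTop hc
  rw [mul_zero] at h1
  obtain ⟨Λ, hΛ, hΛ0⟩ := ((h1.eventually (gt_mem_nhds hη)).and
    (Filter.eventually_gt_atTop 0)).exists
  refine ⟨Λ, hΛ0, fun x N n hn hle => (ht x N n hn).trans (le_trans ?_ hΛ.le)⟩
  have hn0 : (0 : ℝ) < n := by exact_mod_cast hn
  refine mul_le_mul_of_nonneg_left (Real.exp_le_exp.2 ?_) (by linarith)
  have h2 : (Λ : ℝ) ^ ε ≤ (G.En x N / n) ^ ε :=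
    Real.rpow_le_rpow (Nat.cast_nonneg _) ((le_div_iff₀ hn0).2 hle) hε.le
  nlinarith

end Hyp

end

noncomputable section

variable {Γ : Type*} {G : WeightedGraph Γ} [Infinite Γ] {A B : Finset Γ} {x y z : Γ}

/-! ### Polynomial growth of the volume in terms of the mean exit time -/

section Growth

variable [FiniteBalls G] {p D C : ℝ} {N M n : ℕ}

namespace Hyp

variable (h : G.Hyp p D C)
include h

/-- Each factor 4 in the radius multiplies V by at most D² and E by at least 1 + 1/C. With (1 +
1/C)^γ > D², counting the steps from e(x,n) up to N bounds V by the γ-th power of E/n. -/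
theorem exists_Vn_le : ∃ (K : ℝ) (γ : ℕ), 1 ≤ K ∧ ∀ (x : Γ) (N n : ℕ), 0 < n →
    G.Vn x N ≤ K * (1 + G.En x N / n) ^ γ * G.vt x n := by
  obtain ⟨γ, hγ⟩ := pow_unbounded_of_one_lt (D ^ 2) h.one_lt_ratio
  have hD : 1 ≤ D ^ 2 := one_le_pow₀ h.one_le_D
  refine ⟨D ^ 2, γ, hD, fun x N n hn => ?_⟩
  have hn0 : (0 : ℝ) < n := by exact_mod_cast hn
  have hE : 0 ≤ G.En x N / n := div_nonneg (En_nonneg x N) hn0.le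
  have hR := en_pos (G := G) (x := x) hn
  set R := G.en x n with hRdef
  have hex : ∃ i, N ≤ 4 ^ i * R :=
    ⟨N, (Nat.lt_pow_self (by norm_num : 1 < 4)).le.trans (Nat.le_mul_of_pos_right _ hR)⟩
  have hv : 0 < G.vt x n := vt_pos hn
  have hspec := Nat.find_spec hex
  rcases hi : Nat.find hex with _ | i
  · rw [hi, pow_zero, one_mul] at hspec
    have h1 : 1 ≤ D ^ 2 * (1 + G.En x N / n) ^ γ :=
      one_le_mul_of_one_le_of_one_le hD (one_le_pow₀ (by linarith))
    calc G.Vn x N ≤ 1 * G.vt x n := by rw [one_mul]; exact Vn_mono hspec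
      _ ≤ _ := mul_le_mul_of_nonneg_right h1 hv.le
  · have hlt : 4 ^ i * R < N := not_le.1 (Nat.find_min hex (by omega))
    rw [hi] at hspec
    have h1 : (1 + 1 / C) ^ i ≤ G.En x N / n := by
      rw [le_div_iff₀ hn0]
      calc (1 + 1 / C) ^ i * n ≤ (1 + 1 / C) ^ i * G.En x R :=
            mul_le_mul_of_nonneg_left (le_En_en x n) (pow_nonneg (by linarith [h.one_lt_ratio]) _)
        _ ≤ G.En x (4 ^ i * R) := h.le_En_pow_four_mul x i R
        _ ≤ _ := En_mono hlt.le
    have h2 : (D ^ 2) ^ i ≤ (1 + G.En x N / n) ^ γ := by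
      calc (D ^ 2) ^ i ≤ ((1 + 1 / C) ^ γ) ^ i := pow_le_pow_left₀ (by positivity) hγ.le i
        _ = ((1 + 1 / C) ^ i) ^ γ := by rw [← pow_mul, ← pow_mul, mul_comm]
        _ ≤ _ := pow_le_pow_left₀ (pow_nonneg (by linarith [h.one_lt_ratio]) _)
          (by linarith) γ
    calc G.Vn x N ≤ G.Vn x (4 ^ (i + 1) * R) := Vn_mono hspec
      _ ≤ (D ^ 2) ^ (i + 1) * G.Vn x R := h.Vn_pow_four_mul_le x _ R
      _ = D ^ 2 * (D ^ 2) ^ i * G.vt x n := by rw [vt, pow_succ]; ring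
      _ ≤ _ := by gcongr

theorem exists_growth : ∃ (K : ℝ) (γ : ℕ), 1 ≤ K ∧
    (∀ (x : Γ) (N n : ℕ), 0 < n → G.Vn x N ≤ K * (1 + G.En x N / n) ^ γ * G.vt x n) ∧
    (∀ (x z : Γ) (N n : ℕ), 0 < n → G.graph.dist x z < N →
      G.vt x n ≤ K * (1 + G.En x N / n) ^ γ * G.vt z n) ∧
    (∀ (x : Γ) (m n : ℕ), 0 < n → 0 < m → G.vt x m ≤ K * (1 + m / n) ^ γ * G.vt x n) := by
  obtain ⟨K, γ, hK, h1⟩ := h.exists_Vn_le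
  have hC := h.two_le_C
  have hb : 1 ≤ (2 * C ^ 2) ^ γ := one_le_pow₀ (by nlinarith)
  have hK' : K ≤ D * K * (2 * C ^ 2) ^ γ := by
    have hD := h.one_le_D
    calc K = 1 * K * 1 := by ring
      _ ≤ _ := by gcongr
  have hC1 : 1 ≤ C ^ 2 := by nlinarith
  have hC2 : C ≤ 2 * C ^ 2 := by nlinarith
  refine ⟨D * K * (2 * C ^ 2) ^ γ, γ, hK.trans hK', fun x N n hn => ?_, ?_, ?_⟩
  · have hE : 0 ≤ G.En x N / n := div_nonneg (En_nonneg x N) (Nat.cast_nonneg n)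
    refine (h1 x N n hn).trans ?_
    have := (vt_pos (G := G) (x := x) hn).le
    gcongr
  · intro x z N n hn hd
    have hn0 : (0 : ℝ) < n := by exact_mod_cast hn
    -- The radius must reach z, to exchange centres, and e(x,n), to dominate the volume at x.
    set M := max N (G.en x n) with hM
    have hE : 0 ≤ G.En x N / n := div_nonneg (En_nonneg x N) hn0.le
    have hdM : G.graph.dist x z < M := lt_of_lt_of_le hd (le_max_left _ _)
    have h2 : G.En z M / n ≤ C * (C + G.En x N / n) := by
      rw [div_le_iff₀ hn0]
      have h3 : G.En x M ≤ G.En x N + C * n := by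
        rcases max_cases N (G.en x n) with h4 | h4
        · rw [hM, h4.1]; nlinarith
        · rw [hM, h4.1]; linarith [h.En_en_le x hn, En_nonneg (G := G) x N]
      calc G.En z M ≤ C * G.En x M :=
            h.En_le_of_dist_lt (by rw [SimpleGraph.dist_comm]; exact hdM)
        _ ≤ C * (G.En x N + C * n) := mul_le_mul_of_nonneg_left h3 h.C_pos.le
        _ = _ := by field_simp; ring
    have h5 : 1 + G.En z M / n ≤ 2 * C ^ 2 * (1 + G.En x N / n) := by
      nlinarith [mul_le_mul_of_nonneg_right hC2 hE]
    have h6 : 0 ≤ G.En z M / n := div_nonneg (En_nonneg z M) hn0.le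
    have := (vt_pos (G := G) (x := z) hn).le
    have hD := h.D_pos.le
    calc G.vt x n ≤ G.Vn x M := Vn_mono (le_max_right _ _)
      _ ≤ D * G.Vn z M := h.Vn_le_of_dist_lt hdM
      _ ≤ D * (K * (1 + G.En z M / n) ^ γ * G.vt z n) :=
          mul_le_mul_of_nonneg_left (h1 z M n hn) hD
      _ ≤ D * (K * (2 * C ^ 2 * (1 + G.En x N / n)) ^ γ * G.vt z n) := by gcongr
      _ = _ := by rw [mul_pow]; ring
  · intro x m n hn hm
    have hn0 : (0 : ℝ) < n := by exact_mod_cast hn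
    have hm0 : (0 : ℝ) ≤ m / n := by positivity
    have h2 : 1 + G.En x (G.en x m) / n ≤ 2 * C ^ 2 * (1 + m / n) := by
      have h3 : G.En x (G.en x m) / n ≤ C * (m / n) := by
        rw [div_le_iff₀ hn0]
        calc _ ≤ C * m := h.En_en_le x hm
          _ = _ := by field_simp
      nlinarith [mul_le_mul_of_nonneg_right hC2 hm0]
    have h6 : 0 ≤ G.En x (G.en x m) / n := div_nonneg (En_nonneg x _) hn0.le
    have := (vt_pos (G := G) (x := x) hn).le
    have hD := h.one_le_D
    calc G.vt x m ≤ K * (1 + G.En x (G.en x m) / n) ^ γ * G.vt x n := h1 x _ n hn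
      _ ≤ K * (2 * C ^ 2 * (1 + m / n)) ^ γ * G.vt x n := by gcongr
      _ = 1 * K * (2 * C ^ 2) ^ γ * (1 + m / n) ^ γ * G.vt x n := by rw [mul_pow]; ring
      _ ≤ _ := by gcongr

end Hyp

end Growth

/-! ### A summation lemma -/

/-- A stretched exponential beats any power: use sⁿ/n! ≤ eˢ with s = c t^ε and nε ≥ γ + 1. -/
theorem exists_rpow_mul_exp_le {c ε b : ℝ} (hc : 0 < c) (hε : 0 < ε) (hb : 0 ≤ b) (γ : ℕ) :
    ∃ Φ : ℝ, 0 < Φ ∧ ∀ t : ℝ, 1 ≤ t → (1 + b * t) ^ γ * Real.exp (-c * t ^ ε) * t ≤ Φ := by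
  set n := ⌈(γ + 1 : ℝ) / ε⌉₊ with hn
  refine ⟨(1 + b) ^ γ * (n.factorial * (1 / c) ^ n), by positivity, fun t ht => ?_⟩
  have ht0 : 0 < t := by linarith
  have h1 : (1 + b * t) ^ γ ≤ (1 + b) ^ γ * t ^ γ := by
    rw [← mul_pow]
    exact pow_le_pow_left₀ (by positivity) (by nlinarith) γ
  have h2 : t ^ (γ + 1) ≤ (t ^ ε) ^ n := by
    rw [← Real.rpow_natCast, ← Real.rpow_natCast, ← Real.rpow_mul ht0.le]
    refine Real.rpow_le_rpow_of_exponent_le ht ?_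
    have := Nat.le_ceil ((γ + 1 : ℝ) / ε)
    rw [div_le_iff₀ hε] at this
    push_cast
    linarith
  have h3 : (c * t ^ ε) ^ n / n.factorial ≤ Real.exp (c * t ^ ε) :=
    Real.pow_div_factorial_le_exp _ (by positivity) n
  have h4 : (t ^ ε) ^ n * Real.exp (-c * t ^ ε) ≤ n.factorial * (1 / c) ^ n := by
    rw [neg_mul, Real.exp_neg, ← div_eq_mul_inv, div_le_iff₀ (Real.exp_pos _)]
    rw [div_le_iff₀ (by positivity), mul_pow] at h3
    calc (t ^ ε) ^ n = (1 / c) ^ n * (c ^ n * (t ^ ε) ^ n) := by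
          rw [← mul_assoc, ← mul_pow, one_div_mul_cancel hc.ne', one_pow, one_mul]
      _ ≤ (1 / c) ^ n * (Real.exp (c * t ^ ε) * n.factorial) :=
          mul_le_mul_of_nonneg_left h3 (by positivity)
      _ = _ := by ring
  have he := Real.exp_pos (-c * t ^ ε)
  calc (1 + b * t) ^ γ * Real.exp (-c * t ^ ε) * t
      ≤ (1 + b) ^ γ * t ^ γ * Real.exp (-c * t ^ ε) * t := by gcongr
    _ = (1 + b) ^ γ * (t ^ (γ + 1) * Real.exp (-c * t ^ ε)) := by ring
    _ ≤ (1 + b) ^ γ * ((t ^ ε) ^ n * Real.exp (-c * t ^ ε)) := by gcongr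
    _ ≤ _ := by gcongr

/-- Half of the exponent absorbs the polynomial and leaves 1/t_k ≤ r⁻ᵏ, which is summable; the other
half keeps the decay in t₀. -/
theorem exists_sum_exp_le {c ε b r : ℝ} (hc : 0 < c) (hε : 0 < ε) (hb : 0 ≤ b) (hr : 1 < r)
    (γ : ℕ) : ∃ Φ : ℝ, 0 < Φ ∧ ∀ t : ℕ → ℝ, 1 ≤ t 0 → (∀ k, r ^ k * t 0 ≤ t k) → ∀ M : ℕ,
      ∑ k ∈ Finset.range M, (1 + b * t k) ^ γ * Real.exp (-c * t k ^ ε) ≤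
        Φ * Real.exp (-(c / 2) * t 0 ^ ε) := by
  obtain ⟨Φ, hΦ, h⟩ := exists_rpow_mul_exp_le (half_pos hc) hε hb γ
  have hr' : (r⁻¹ : ℝ) < 1 := inv_lt_one_of_one_lt₀ hr
  have hr0 : 0 < r := by linarith
  refine ⟨Φ * (1 - r⁻¹)⁻¹, mul_pos hΦ (inv_pos.2 (by linarith)), fun t ht0 ht M => ?_⟩
  have hterm : ∀ k, (1 + b * t k) ^ γ * Real.exp (-c * t k ^ ε) ≤
      Φ * Real.exp (-(c / 2) * t 0 ^ ε) * r⁻¹ ^ k := by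
    intro k
    have h1 : t 0 ≤ t k := le_trans (le_mul_of_one_le_left (by linarith) (one_le_pow₀ hr.le)) (ht k)
    have h2 : r ^ k ≤ t k := le_trans (le_mul_of_one_le_right (by positivity) ht0) (ht k)
    have h3 := h (t k) (ht0.trans h1)
    have htk : 0 < t k := by linarith
    have h4 : Real.exp (-c * t k ^ ε) =
        Real.exp (-(c / 2) * t k ^ ε) * Real.exp (-(c / 2) * t k ^ ε) := by
      rw [← Real.exp_add]; ring_nf
    have h5 : Real.exp (-(c / 2) * t k ^ ε) ≤ Real.exp (-(c / 2) * t 0 ^ ε) := by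
      refine Real.exp_le_exp.2 ?_
      have := Real.rpow_le_rpow (by linarith) h1 hε.le
      nlinarith
    rw [← le_div_iff₀ htk] at h3
    have h6 : Φ / t k ≤ Φ * r⁻¹ ^ k := by
      rw [inv_pow, ← div_eq_mul_inv]
      exact div_le_div_of_nonneg_left hΦ.le (by positivity) h2
    calc (1 + b * t k) ^ γ * Real.exp (-c * t k ^ ε)
        = ((1 + b * t k) ^ γ * Real.exp (-(c / 2) * t k ^ ε)) * Real.exp (-(c / 2) * t k ^ ε) := by
          rw [h4]; ring
      _ ≤ (Φ * r⁻¹ ^ k) * Real.exp (-(c / 2) * t 0 ^ ε) :=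
          mul_le_mul (h3.trans h6) h5 (Real.exp_pos _).le (by positivity)
      _ = _ := by ring
  calc _ ≤ ∑ k ∈ Finset.range M, Φ * Real.exp (-(c / 2) * t 0 ^ ε) * r⁻¹ ^ k :=
        Finset.sum_le_sum fun k _ => hterm k
    _ = Φ * Real.exp (-(c / 2) * t 0 ^ ε) * ∑ k ∈ Finset.range M, r⁻¹ ^ k := by
        rw [Finset.mul_sum]
    _ ≤ Φ * Real.exp (-(c / 2) * t 0 ^ ε) * (1 - r⁻¹)⁻¹ := by
        refine mul_le_mul_of_nonneg_left ?_ (by positivity)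
        rw [← tsum_geometric_of_lt_one (by positivity) hr']
        exact (summable_geometric_of_lt_one (by positivity) hr').sum_le_tsum _
          fun k _ => by positivity
    _ = _ := by ring

/-! ### Comparison of heat kernels of nested sets -/

/-- At the middle time write bb' - aa' = (b - a)b' + a(b' - a') for the kernels b of B and a of A.
The mass of b - a is at most the probability of having left A by time m, and the other factor is at
most S. -/
theorem hk_sub_le {m : ℕ} {S : ℝ} (hAB : A ⊆ B) (hx : x ∈ A) (hy : y ∈ A)
    (hS : ∀ z ∈ B, G.hk B m z x ≤ S ∧ G.hk B m z y ≤ S) :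
    G.hk B (m + m) x y ≤ G.hk A (m + m) x y +
      ((1 - G.surv A m x) + (1 - G.surv A m y)) * S := by
  have key : ∀ w ∈ A, ∑ z ∈ B, G.mass z * (G.hk B m w z - G.hk A m w z) ≤ 1 - G.surv A m w := by
    intro w hw
    have h1 : ∑ z ∈ B, G.mass z * G.hk A m w z = G.surv A m w := by
      rw [surv_eq_sum_hk hw]
      refine (Finset.sum_subset hAB fun z _ hz => ?_).symm
      rw [hk_of_notMem_right hz, mul_zero]
    simp only [mul_sub, Finset.sum_sub_distrib, h1]
    rw [← surv_eq_sum_hk (hAB hw)]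
    linarith [surv_le_one (G := G) B m w]
  have hA : G.hk A (m + m) x y = ∑ z ∈ B, G.mass z * (G.hk A m x z * G.hk A m z y) := by
    rw [hk_add]
    refine Finset.sum_subset hAB fun z _ hz => ?_
    rw [hk_of_notMem_right hz, zero_mul, mul_zero]
  have h2 : G.hk B (m + m) x y ≤ G.hk A (m + m) x y +
      (∑ z ∈ B, G.mass z * (G.hk B m x z - G.hk A m x z) * S +
        ∑ z ∈ B, G.mass z * (G.hk B m y z - G.hk A m y z) * S) := by
    rw [hk_add, hA, ← Finset.sum_add_distrib, ← Finset.sum_add_distrib]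
    refine Finset.sum_le_sum fun z hz => ?_
    have e1 := hk_mono_set (G := G) hAB m x z
    have e2 := hk_mono_set (G := G) hAB m y z
    rw [hk_comm B m z y, hk_comm A m z y]
    have e3 := (hS z hz).2
    have e4 := (hS z hz).1
    rw [hk_comm B m z y] at e3
    rw [hk_comm B m z x] at e4
    have e5 := hk_nonneg (G := G) A m x z
    have e6 : (G.hk B m x z - G.hk A m x z) * G.hk B m y z ≤ (G.hk B m x z - G.hk A m x z) * S :=
      mul_le_mul_of_nonneg_left e3 (by linarith)
    have e7 : (G.hk B m y z - G.hk A m y z) * G.hk A m x z ≤ (G.hk B m y z - G.hk A m y z) * S :=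
      mul_le_mul_of_nonneg_left (by linarith) (by linarith)
    have e8 : G.hk B m x z * G.hk B m y z ≤ G.hk A m x z * G.hk A m y z +
        ((G.hk B m x z - G.hk A m x z) * S + (G.hk B m y z - G.hk A m y z) * S) := by
      nlinarith
    calc _ ≤ G.mass z * _ := mul_le_mul_of_nonneg_left e8 (mass_nonneg z)
      _ = _ := by ring
  have hS0 : 0 ≤ S := (hk_nonneg B m x x).trans (hS x (hAB hx)).1
  rw [← Finset.sum_mul, ← Finset.sum_mul] at h2
  have h3 := mul_le_mul_of_nonneg_right (key x hx) hS0
  have h4 := mul_le_mul_of_nonneg_right (key y hy) hS0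
  linarith

end

noncomputable section

variable {Γ : Type*} {G : WeightedGraph Γ} [Infinite Γ] {A B : Finset Γ} {x y z : Γ}

/-! ### A Faber-Krahn inequality and the Nash argument -/

/-- A Faber-Krahn inequality: on a set whose measure is small compared to the volumes
`V(y,e(y,n))`, the killed operator has a spectral gap of order `1/n`. -/
def FaberKrahn (G : WeightedGraph Γ) [FiniteBalls G] : Prop :=
  ∃ ε c : ℝ, 0 < ε ∧ 0 < c ∧ ∀ (n : ℕ) (A : Finset Γ), 0 < n →
    (∀ y ∈ A, G.vol A ≤ ε * G.vt y n) → ∀ f : Γ → ℝ, (∀ x ∈ A, 0 ≤ f x) →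
      G.ip A (G.L A f) (G.L A f) ≤ (1 - c / n) * G.ip A f f

/-- The first power of two above `n`. -/
theorem exists_pow_two (n : ℕ) (hn : 0 < n) : ∃ i : ℕ, n ≤ 2 ^ i ∧ 2 ^ i ≤ 2 * n := by
  refine ⟨Nat.log 2 n + 1, (Nat.lt_pow_succ_log_self (by norm_num) n).le, ?_⟩
  rw [pow_succ, mul_comm]
  exact Nat.mul_le_mul_left 2 (Nat.pow_log_le_self 2 hn.ne')

/-- A drop by one half at time 2^(i+1) is carried back to time 2 by Jensen. By Bernoulli (1 -
1/(4n))^(2ⁱ) ≥ 1/2 because 2ⁱ ≤ 2n. -/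
theorem ip_L_L_le_of_half {n i : ℕ} (hn : 0 < n) (hi : 2 ^ i ≤ 2 * n) (f : Γ → ℝ)
    (hf : G.ip A ((G.L A ^ (2 ^ i * 2)) f) f ≤ 1 / 2 * G.ip A f f) :
    G.ip A (G.L A f) (G.L A f) ≤ (1 - 1 / 4 / n) * G.ip A f f := by
  have hn1 : (1 : ℝ) ≤ n := by exact_mod_cast hn
  have hn0 : (0 : ℝ) < n := by linarith
  have hle : 1 / 4 / (n : ℝ) ≤ 1 := by
    rw [div_le_iff₀ hn0]; linarith
  have hpos : 0 < 1 / 4 / (n : ℝ) := by positivity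
  have h1 := ip_L_pow_L_pow (G := G) (A := A) 1 f
  rw [pow_one] at h1
  rw [h1]
  refine ip_L_pow_jensen (1 + 1) i (by linarith) (hf.trans ?_)
  refine mul_le_mul_of_nonneg_right ?_ (ip_self_nonneg A f)
  have h2 := one_add_mul_le_pow (a := -(1 / 4 / (n : ℝ))) (by linarith) (2 ^ i)
  rw [← sub_eq_add_neg] at h2
  refine le_trans ?_ h2
  have h3 : ((2 ^ i : ℕ) : ℝ) ≤ ((2 * n : ℕ) : ℝ) := by exact_mod_cast hi
  push_cast at h3 ⊢
  have h4 : (2 : ℝ) ^ i * (1 / 4 / (n : ℝ)) ≤ 2 * n * (1 / 4 / n) :=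
    mul_le_mul_of_nonneg_right h3 hpos.le
  have h5 : 2 * (n : ℝ) * (1 / 4 / n) = 1 / 2 := by field_simp; norm_num
  linarith

/-- The part of the `B`-neighbourhood of `A` inside `B`. -/
def nbhd (G : WeightedGraph Γ) (B A : Finset Γ) : Finset Γ :=
  {y ∈ B | y ∈ A ∨ ∃ x ∈ A, G.graph.Adj x y}

/-- By (p₀) a neighbour y of x in A has μ(y) ≤ μ_{x,y}/p, and the edges issuing from A have total
weight at most μ(A). -/
theorem vol_nbhd_le {p : ℝ} (hp : 0 < p) (hP : ∀ x y, G.graph.Adj x y → p ≤ G.P x y)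
    (B A : Finset Γ) : G.vol (G.nbhd B A) ≤ (1 + 1 / p) * G.vol A := by
  have h1 : ∀ y ∈ G.nbhd B A, G.mass y ≤
      ind A y * G.mass y + 1 / p * ∑ x ∈ A, G.weight x y := by
    intro y hy
    have h0 : 0 ≤ 1 / p * ∑ x ∈ A, G.weight x y :=
      mul_nonneg (by positivity) (Finset.sum_nonneg fun x _ => G.weight_nonneg x y)
    rcases (Finset.mem_filter.1 hy).2 with hA | ⟨x, hx, hadj⟩
    · rw [ind_of_mem hA]; linarith
    · have h2 : G.mass y ≤ 1 / p * G.weight x y := by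
        have h3 := hP y x hadj.symm
        rw [← G.weight_symm, ← mass_mul_P, one_div, inv_mul_eq_div, le_div_iff₀ hp]
        exact mul_le_mul_of_nonneg_left h3 (mass_nonneg y)
      have h4 : G.weight x y ≤ ∑ x ∈ A, G.weight x y :=
        Finset.single_le_sum (f := fun x => G.weight x y) (fun x _ => G.weight_nonneg x y) hx
      have h5 : 0 ≤ ind A y * G.mass y := by
        refine mul_nonneg ?_ (mass_nonneg y)
        unfold ind; split_ifs <;> norm_num
      have h6 : 1 / p * G.weight x y ≤ 1 / p * ∑ x ∈ A, G.weight x y :=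
        mul_le_mul_of_nonneg_left h4 (by positivity)
      linarith
  have h2 : ∑ y ∈ G.nbhd B A, ind A y * G.mass y ≤ G.vol A := by
    calc _ ≤ ∑ y ∈ G.nbhd B A ∪ A, ind A y * G.mass y := by
          refine Finset.sum_le_sum_of_subset_of_nonneg Finset.subset_union_left fun y _ _ =>
            mul_nonneg ?_ (mass_nonneg y)
          unfold ind; split_ifs <;> norm_num
      _ = ∑ y ∈ A, ind A y * G.mass y := by
          refine (Finset.sum_subset Finset.subset_union_right fun y _ hy => ?_).symm
          rw [ind_of_notMem hy, zero_mul]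
      _ = G.vol A := Finset.sum_congr rfl fun y hy => by rw [ind_of_mem hy, one_mul]
  have h3 : ∑ y ∈ G.nbhd B A, ∑ x ∈ A, G.weight x y ≤ G.vol A := by
    rw [Finset.sum_comm]
    exact Finset.sum_le_sum fun x _ =>
      (G.summable_weight x).sum_le_tsum _ fun y _ => G.weight_nonneg x y
  calc G.vol (G.nbhd B A) ≤ ∑ y ∈ G.nbhd B A,
        (ind A y * G.mass y + 1 / p * ∑ x ∈ A, G.weight x y) := Finset.sum_le_sum h1
    _ = ∑ y ∈ G.nbhd B A, ind A y * G.mass y +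
        1 / p * ∑ y ∈ G.nbhd B A, ∑ x ∈ A, G.weight x y := by
        rw [Finset.sum_add_distrib, Finset.mul_sum]
    _ ≤ G.vol A + 1 / p * G.vol A :=
        add_le_add h2 (mul_le_mul_of_nonneg_left h3 (by positivity))
    _ = _ := by ring

/-- Split f = g + u with g = min(f,s). The form ‖f‖² - ‖Lf‖² is nonnegative on g, and its cross term
is nonnegative because L²g ≤ s, with g = s wherever u ≠ 0. -/
theorem ip_sub_ip_L_trunc_le {f : Γ → ℝ} {s : ℝ} (hs : 0 ≤ s) :
    G.ip B (fun x => max (f x - s) 0) (fun x => max (f x - s) 0) -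
        G.ip B (G.L B fun x => max (f x - s) 0) (G.L B fun x => max (f x - s) 0) ≤
      G.ip B f f - G.ip B (G.L B f) (G.L B f) := by
  set u : Γ → ℝ := fun x => max (f x - s) 0 with hu
  set g : Γ → ℝ := fun x => min (f x) s with hg
  have hfg : f = g + u := by
    funext x
    simp only [hu, hg, Pi.add_apply]
    rcases le_total (f x) s with h1 | h1
    · rw [min_eq_left h1, max_eq_right (by linarith), add_zero]
    · rw [min_eq_right h1, max_eq_left (by linarith)]; ring
  have e : ∀ a b : Γ → ℝ, G.ip B (a + b) (a + b) = G.ip B a a + 2 * G.ip B a b + G.ip B b b := by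
    intro a b
    rw [ip_add_left, ip_comm (f := a), ip_comm (f := b) (g := a + b), ip_add_left, ip_add_left,
      ip_comm (f := b) (g := a)]
    ring
  rw [hfg, map_add, e, e]
  have h1 := ip_L_L_le (G := G) (A := B) g
  have h2 : G.ip B (G.L B g) (G.L B u) ≤ G.ip B g u := by
    rw [← ip_L]
    refine Finset.sum_le_sum fun x _ => mul_le_mul_of_nonneg_left ?_ (mass_nonneg x)
    have hux : 0 ≤ u x := le_max_right _ _
    rcases le_total (f x) s with h3 | h3
    · have : u x = 0 := max_eq_right (by linarith)
      rw [this, mul_zero, mul_zero]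
    · refine mul_le_mul_of_nonneg_right ?_ hux
      have h4 : g x = s := min_eq_right h3
      rw [h4]
      exact L_le_of_le hs (fun y _ => L_le_of_le hs (fun z _ => min_le_right _ _) y) x
  linarith

/-- One step spreads u to the neighbours of A but no further. The gap must therefore be applied on
the neighbourhood rather than on A itself. -/
theorem ip_L_L_eq_nbhd {u : Γ → ℝ} (hAB : A ⊆ B) (hu : ∀ x ∈ B, x ∉ A → u x = 0) :
    G.ip B (G.L B u) (G.L B u) =
      G.ip (G.nbhd B A) (G.L (G.nbhd B A) u) (G.L (G.nbhd B A) u) := by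
  have hsub : G.nbhd B A ⊆ B := Finset.filter_subset _ _
  have hA : A ⊆ G.nbhd B A := fun x hx => Finset.mem_filter.2 ⟨hAB hx, Or.inl hx⟩
  have h1 : ∀ x ∈ G.nbhd B A, G.L (G.nbhd B A) u x = G.L B u x := by
    intro x hx
    rw [L_apply_of_mem hx, L_apply_of_mem (hsub hx)]
    refine Finset.sum_subset hsub fun y hy hy' => ?_
    rw [hu y hy fun h => hy' (hA h), mul_zero]
  have h2 : ∀ x ∈ B, x ∉ G.nbhd B A → G.L B u x = 0 := by
    intro x hx hx'
    rw [L_apply_of_mem hx]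
    refine Finset.sum_eq_zero fun y hy => ?_
    by_cases hyA : y ∈ A
    · have : ¬ G.graph.Adj x y := fun h =>
        hx' (Finset.mem_filter.2 ⟨hx, Or.inr ⟨y, hyA, h.symm⟩⟩)
      rw [P, G.weight_eq_zero x y this, zero_div, zero_mul]
    · rw [hu y hy hyA, mul_zero]
  rw [ip, ip, ← Finset.sum_subset hsub fun x hx hx' => by rw [h2 x hx hx']; ring]
  exact Finset.sum_congr rfl fun x hx => by rw [h1 x hx]

/-- One step of the Nash argument. -/
theorem nash_step {p κ : ℝ} (hp : 0 < p) (hP : ∀ x y, G.graph.Adj x y → p ≤ G.P x y)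
    (hκ : 0 ≤ κ) {f : Γ → ℝ} (hf : ∀ x ∈ B, 0 ≤ f x) (hf1 : ∑ x ∈ B, G.mass x * f x ≤ 1)
    (hJ : 0 < G.ip B f f)
    (hgap : ∀ A ⊆ B, G.vol A ≤ (1 + 1 / p) * (4 / G.ip B f f) → ∀ u : Γ → ℝ,
      (∀ x ∈ A, 0 ≤ u x) → G.ip A (G.L A u) (G.L A u) ≤ (1 - κ) * G.ip A u u) :
    G.ip B (G.L B f) (G.L B f) ≤ (1 - κ / 2) * G.ip B f f := by
  set J := G.ip B f f with hJdef
  -- Since f has integral at most 1, the set {f > s} has measure at most 4/J, while the truncation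
  -- keeps energy at least J - 2s = J/2.
  set s := J / 4 with hs
  set A : Finset Γ := {x ∈ B | s < f x} with hA
  set u : Γ → ℝ := fun x => max (f x - s) 0 with hu
  have hAB : A ⊆ B := Finset.filter_subset _ _
  have hs0 : 0 < s := by positivity
  have huA : ∀ x ∈ B, x ∉ A → u x = 0 := by
    intro x hx hxA
    have : ¬ s < f x := fun h => hxA (Finset.mem_filter.2 ⟨hx, h⟩)
    exact max_eq_right (by linarith)
  have hvolA : G.vol A ≤ 4 / J := by
    rw [show 4 / J = 1 / s by rw [hs]; field_simp, le_div_iff₀ hs0, vol, Finset.sum_mul]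
    calc _ ≤ ∑ x ∈ A, G.mass x * f x := Finset.sum_le_sum fun x hx =>
          mul_le_mul_of_nonneg_left (Finset.mem_filter.1 hx).2.le (mass_nonneg x)
      _ ≤ ∑ x ∈ B, G.mass x * f x := Finset.sum_le_sum_of_subset_of_nonneg hAB fun x hx _ =>
          mul_nonneg (mass_nonneg x) (hf x hx)
      _ ≤ 1 := hf1
  have hvol : G.vol (G.nbhd B A) ≤ (1 + 1 / p) * (4 / J) :=
    (vol_nbhd_le hp hP B A).trans (mul_le_mul_of_nonneg_left hvolA (by positivity))
  have h1 := hgap (G.nbhd B A) (Finset.filter_subset _ _) hvol u fun x _ => le_max_right _ _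
  rw [← ip_L_L_eq_nbhd hAB huA] at h1
  have h2 : G.ip (G.nbhd B A) u u = G.ip B u u := by
    refine Finset.sum_subset (Finset.filter_subset _ _) fun x hx hx' => ?_
    rw [huA x hx fun h => hx' (Finset.mem_filter.2 ⟨hx, Or.inl h⟩)]; ring
  rw [h2] at h1
  have h3 := ip_sub_ip_L_trunc_le (G := G) (B := B) (f := f) hs0.le
  have h4 : J / 2 ≤ G.ip B u u := by
    have h5 : J - 2 * s * ∑ x ∈ B, G.mass x * f x ≤ G.ip B u u := by
      rw [hJdef, ip, ip, Finset.mul_sum, ← Finset.sum_sub_distrib]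
      refine Finset.sum_le_sum fun x hx => ?_
      have h6 : f x * f x - 2 * s * f x ≤ u x * u x := by
        rcases le_total (f x) s with h7 | h7
        · have h8 : u x = 0 := max_eq_right (by linarith)
          rw [h8]; nlinarith [hf x hx]
        · have h8 : u x = f x - s := max_eq_left (by linarith)
          rw [h8]; nlinarith
      calc _ = G.mass x * (f x * f x - 2 * s * f x) := by ring
        _ ≤ _ := mul_le_mul_of_nonneg_left h6 (mass_nonneg x)
    have h9 : 2 * s * ∑ x ∈ B, G.mass x * f x ≤ 2 * s * 1 :=
      mul_le_mul_of_nonneg_left hf1 (by positivity)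
    rw [hs] at h9 h5
    linarith
  have h5 := mul_le_mul_of_nonneg_left h4 hκ
  linarith

theorem hk_two_mul_eq_ip (B : Finset Γ) (k : ℕ) (y : Γ) :
    G.hk B (k + k) y y = G.ip B (fun z => G.hk B k z y) (fun z => G.hk B k z y) := by
  rw [hk_eq_ip]
  exact Finset.sum_congr rfl fun z _ => by simp only [hk_comm B k y z]

theorem L_hk (B : Finset Γ) (k : ℕ) (y z : Γ) :
    G.L B (fun z => G.hk B k z y) z = G.hk B (k + 1) z y := by
  by_cases hz : z ∈ B
  · rw [hk, L_pow_succ, L_apply_of_mem hz, L_apply_of_mem hz, Finset.sum_div]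
    exact Finset.sum_congr rfl fun w _ => by rw [hk]; ring
  · rw [L_apply_of_notMem hz, hk_of_notMem_left hz]

theorem hk_two_mul_succ_eq_ip (B : Finset Γ) (k : ℕ) (y : Γ) :
    G.hk B (k + 1 + (k + 1)) y y =
      G.ip B (G.L B fun z => G.hk B k z y) (G.L B fun z => G.hk B k z y) := by
  rw [hk_two_mul_eq_ip]
  exact Finset.sum_congr rfl fun z _ => by rw [L_hk]

theorem hk_two_mul_antitone (B : Finset Γ) (y : Γ) : Antitone fun k => G.hk B (k + k) y y := by
  refine antitone_nat_of_succ_le fun k => ?_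
  rw [hk_two_mul_succ_eq_ip, hk_two_mul_eq_ip]
  exact ip_L_L_le _

section

variable [FiniteBalls G] {p D C : ℝ}

namespace Hyp

variable (h : G.Hyp p D C)
include h

/-- Induction over dyadic scales. The bound at scale j is worse by a factor D' than the one wanted
at scale j + 1; over the next k₀ = M2ʲ times either the wanted bound is reached or each `nash_step`
gains, and the total gain exceeds D'. -/
theorem exists_nash (hFK : G.FaberKrahn) : ∃ (M : ℕ) (a : ℝ), 0 < M ∧ 0 < a ∧
    ∀ (B : Finset Γ) (j : ℕ) (v : ℝ), 0 < v → (∀ w ∈ B, v ≤ G.vt w (2 ^ j)) →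
      ∀ y ∈ B, ∀ k ≥ M * 2 ^ j, G.hk B (k + k) y y * v ≤ a := by
  obtain ⟨ε, c', hε, hc', hFK⟩ := hFK
  obtain ⟨K, γ, hK, -, -, hvt⟩ := h.exists_growth
  set c := min c' 1 with hc
  have hc0 : 0 < c := lt_min hc' one_pos
  have hc1 : c ≤ 1 := min_le_right _ _
  set D' : ℝ := K * 3 ^ γ with hD'
  have hD1 : 1 ≤ D' := one_le_mul_of_one_le_of_one_le hK (one_le_pow₀ (by norm_num))
  have hdouble : ∀ (w : Γ) (j : ℕ), G.vt w (2 ^ (j + 1)) ≤ D' * G.vt w (2 ^ j) := by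
    intro w j
    have h1 := hvt w (2 ^ (j + 1)) (2 ^ j) (by positivity) (by positivity)
    have h2 : (1 : ℝ) + ((2 ^ (j + 1) : ℕ) : ℝ) / ((2 ^ j : ℕ) : ℝ) = 3 := by
      push_cast; rw [pow_succ]; field_simp; norm_num
    rwa [h2] at h1
  -- The 1 covers the smallest scale; the second term makes the neighbourhood of a level set small
  -- enough for the gap whenever the bound a fails.
  set a : ℝ := max 1 ((1 + 1 / p) * 4 / ε) with ha
  have hp := h.p_pos
  have ha1 : 1 ≤ a := le_max_left _ _
  -- With k₀ = M2ʲ and κ = c/2^(j+1), the exponent k₀κ/2 = Mc/4 exceeds D', so the decay factor is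
  -- at most 1/D'.
  obtain ⟨M, hM⟩ := exists_nat_gt (4 * D' / c)
  have hM0 : 0 < M := by
    have : 0 < 4 * D' / c := by positivity
    exact_mod_cast this.trans hM
  refine ⟨M, a, hM0, by linarith, fun B j v hv hvB y hy => ?_⟩
  -- The index l counts the factors D' lost in descending from the scale at which v was compared
  -- with the volumes.
  have key : ∀ j l : ℕ, (∀ w ∈ B, v ≤ D' ^ l * G.vt w (2 ^ j)) → ∀ k ≥ M * 2 ^ j,
      G.hk B (k + k) y y * v ≤ a * D' ^ l := by
    intro j
    induction j with
    | zero =>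
      intro l hl k _
      have h1 := hl y hy
      rw [pow_zero, vt_one] at h1
      have h2 := hk_le_inv_mass (G := G) (A := B) (k + k) y y
      have h3 := G.mass_pos y
      calc G.hk B (k + k) y y * v ≤ 1 / G.mass y * (D' ^ l * G.mass y) :=
            mul_le_mul h2 h1 hv.le (by positivity)
        _ = 1 * D' ^ l := by field_simp
        _ ≤ a * D' ^ l := mul_le_mul_of_nonneg_right ha1 (by positivity)
    | succ j ih =>
      intro l hl k hk
      have ih' := ih (l + 1) fun w hw => (hl w hw).trans (by
        calc D' ^ l * G.vt w (2 ^ (j + 1)) ≤ D' ^ l * (D' * G.vt w (2 ^ j)) :=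
              mul_le_mul_of_nonneg_left (hdouble w j) (by positivity)
          _ = _ := by ring)
      have hmono := hk_two_mul_antitone (G := G) B y
      refine le_trans (mul_le_mul_of_nonneg_right (hmono hk) hv.le) ?_
      -- If the bound fails at the final time, it fails at all earlier ones by monotonicity, so the
      -- gap is available at every step in between.
      by_contra hcon
      push Not at hcon
      set k₀ := M * 2 ^ j with hk₀
      have hk₁ : M * 2 ^ (j + 1) = k₀ + k₀ := by rw [hk₀]; ring
      simp only [hk₁] at hcon
      set κ : ℝ := c / ((2 ^ (j + 1) : ℕ) : ℝ) with hκ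
      have h2j : (1 : ℝ) ≤ ((2 ^ (j + 1) : ℕ) : ℝ) := by exact_mod_cast Nat.one_le_two_pow
      have hκ0 : 0 < κ := by positivity
      have hκ1 : κ ≤ 1 := by rw [hκ, div_le_one (by linarith)]; linarith
      have hstep : ∀ i ≤ k₀, G.hk B (k₀ + i + (k₀ + i)) y y ≤
          (1 - κ / 2) ^ i * G.hk B (k₀ + k₀) y y := by
        intro i
        induction i with
        | zero => intro _; simp
        | succ i ihi =>
          intro hi
          have h1 := ihi (by omega)
          have hbig : a * D' ^ l < G.hk B (k₀ + i + (k₀ + i)) y y * v :=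
            hcon.trans_le (mul_le_mul_of_nonneg_right (hmono (by omega)) hv.le)
          have hJpos : 0 < G.hk B (k₀ + i + (k₀ + i)) y y := by
            have : 0 < a * D' ^ l := by positivity
            exact pos_of_mul_pos_left (this.trans hbig) hv.le
          rw [← add_assoc k₀ i 1, hk_two_mul_succ_eq_ip]
          have h2 := nash_step (G := G) (B := B) hp h.p_le hκ0.le
            (f := fun z => G.hk B (k₀ + i) z y) (fun z _ => hk_nonneg B _ z y) ?_ ?_ ?_
          · rw [← hk_two_mul_eq_ip] at h2
            refine h2.trans ?_
            rw [pow_succ', mul_assoc]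
            exact mul_le_mul_of_nonneg_left h1 (by linarith)
          · have h3 := surv_eq_sum_hk (G := G) (k := k₀ + i) hy
            rw [Finset.sum_congr rfl fun z _ => by rw [hk_comm B (k₀ + i) z y], ← h3]
            exact surv_le_one B _ y
          · rw [← hk_two_mul_eq_ip]; exact hJpos
          · intro A hAB hvol u hu
            rw [← hk_two_mul_eq_ip] at hvol
            have h4 := hFK (2 ^ (j + 1)) A (by positivity) ?_ u hu
            · refine h4.trans (mul_le_mul_of_nonneg_right ?_ (ip_self_nonneg A u))
              have : κ ≤ c' / ((2 ^ (j + 1) : ℕ) : ℝ) :=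
                div_le_div_of_nonneg_right (min_le_left _ _) (by linarith)
              linarith
            · intro w hw
              refine hvol.trans ?_
              have h5 := hl w (hAB hw)
              set J := G.hk B (k₀ + i + (k₀ + i)) y y
              have h6 : (1 + 1 / p) * 4 / ε ≤ a := le_max_right _ _
              rw [div_le_iff₀ hε] at h6
              rw [← mul_div_assoc, div_le_iff₀ hJpos]
              have h7 : a * D' ^ l ≤ J * G.vt w (2 ^ (j + 1)) * D' ^ l := by
                calc a * D' ^ l ≤ J * v := hbig.le
                  _ ≤ J * (D' ^ l * G.vt w (2 ^ (j + 1))) := mul_le_mul_of_nonneg_left h5 hJpos.le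
                  _ = _ := by ring
              have h8 : a ≤ J * G.vt w (2 ^ (j + 1)) :=
                le_of_mul_le_mul_right h7 (by positivity)
              calc (1 + 1 / p) * 4 ≤ a * ε := h6
                _ ≤ J * G.vt w (2 ^ (j + 1)) * ε := mul_le_mul_of_nonneg_right h8 hε.le
                _ = _ := by ring
      have h1 := hstep k₀ le_rfl
      have h2 : (1 - κ / 2) ^ k₀ * D' ≤ 1 := by
        have h3 : (1 - κ / 2) ^ k₀ ≤ Real.exp (-(k₀ * (κ / 2))) := by
          calc (1 - κ / 2) ^ k₀ ≤ Real.exp (-(κ / 2)) ^ k₀ :=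
                pow_le_pow_left₀ (by linarith) (Real.one_sub_le_exp_neg _) _
            _ = _ := by rw [← Real.exp_nat_mul]; ring_nf
        have h4 : D' ≤ k₀ * (κ / 2) := by
          rw [hk₀, hκ]
          push_cast
          rw [pow_succ]
          have h5 := (div_lt_iff₀ hc0).1 hM
          have h6 : (M : ℝ) * 2 ^ j * (c / (2 ^ j * 2) / 2) = M * c / 4 := by field_simp; norm_num
          rw [h6]; linarith
        have h5 : D' ≤ Real.exp (k₀ * (κ / 2)) := by
          have := Real.add_one_le_exp (k₀ * (κ / 2)); linarith
        rw [Real.exp_neg] at h3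
        calc _ ≤ (Real.exp (k₀ * (κ / 2)))⁻¹ * Real.exp (k₀ * (κ / 2)) :=
              mul_le_mul h3 h5 (by linarith) (by positivity)
          _ = 1 := inv_mul_cancel₀ (Real.exp_pos _).ne'
      have h3 := ih' k₀ le_rfl
      have h4 : G.hk B (k₀ + k₀ + (k₀ + k₀)) y y * v ≤ a * D' ^ l := by
        have hpow : 0 ≤ (1 - κ / 2) ^ k₀ := pow_nonneg (by linarith) _
        calc _ ≤ (1 - κ / 2) ^ k₀ * G.hk B (k₀ + k₀) y y * v := mul_le_mul_of_nonneg_right h1 hv.le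
          _ = (1 - κ / 2) ^ k₀ * (G.hk B (k₀ + k₀) y y * v) := by ring
          _ ≤ (1 - κ / 2) ^ k₀ * (a * D' ^ (l + 1)) := mul_le_mul_of_nonneg_left h3 hpow
          _ = ((1 - κ / 2) ^ k₀ * D') * (a * D' ^ l) := by ring
          _ ≤ 1 * (a * D' ^ l) := mul_le_mul_of_nonneg_right h2 (by positivity)
          _ = _ := one_mul _
      linarith
  intro k hk
  simpa using key j 0 (fun w hw => by simpa using hvB w hw) k hk

/-- On-diagonal bound for the heat kernel of a finite set. -/
theorem exists_hk_le (hFK : G.FaberKrahn) : ∃ a : ℝ, 0 < a ∧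
    ∀ (B : Finset Γ) (n : ℕ) (v : ℝ), 0 < n → 0 < v → (∀ w ∈ B, v ≤ G.vt w n) →
      ∀ y z, ∀ k ≥ n, G.hk B k y z * v ≤ a := by
  obtain ⟨M, a, hM, ha, hn⟩ := h.exists_nash hFK
  obtain ⟨K, γ, hK, -, -, hvt⟩ := h.exists_growth
  set Q : ℝ := K * (1 + 8 * M) ^ γ with hQ
  have hM1 : (1 : ℝ) ≤ M := by exact_mod_cast hM
  have hQ0 : 0 < Q := by positivity
  refine ⟨max Q (a * Q), lt_max_of_lt_left hQ0, fun B n v hn0 hv hvB y z k hk => ?_⟩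
  by_cases hy : y ∈ B
  swap
  · rw [hk_of_notMem_left hy, zero_mul]; exact (lt_max_of_lt_left hQ0).le
  by_cases hz : z ∈ B
  swap
  · rw [hk_of_notMem_right hz, zero_mul]; exact (lt_max_of_lt_left hQ0).le
  -- For bounded n the reference volume at z is comparable to μ(z), and the trivial bound 1/μ(z)
  -- suffices.
  rcases lt_or_ge n (4 * M) with hsmall | hbig
  · refine le_max_of_le_left ?_
    have h1 := hvt z n 1 one_pos hn0
    rw [vt_one] at h1
    have h2 : (1 : ℝ) + n / ((1 : ℕ) : ℝ) ≤ 1 + 8 * M := by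
      have : (n : ℝ) ≤ 4 * M := by exact_mod_cast hsmall.le
      push_cast; linarith
    have h3 : v ≤ Q * G.mass z := (hvB z hz).trans (h1.trans (by
      have := mass_nonneg (G := G) z
      rw [hQ]
      gcongr))
    have hm := G.mass_pos z
    calc _ ≤ 1 / G.mass z * (Q * G.mass z) :=
          mul_le_mul (hk_le_inv_mass k y z) h3 hv.le (by positivity)
      _ = Q := by field_simp
  · refine le_max_of_le_right ?_
    -- A scale with 4M2ⁱ ≤ n: every k ≥ n splits into two times at least M2ⁱ, and Cauchy–Schwarz
    -- uses the diagonal bound at both.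
    set i := Nat.log 2 (n / (4 * M)) with hi
    have hq : n / (4 * M) ≠ 0 := (Nat.div_pos hbig (by positivity)).ne'
    have h1 : 2 ^ i ≤ n / (4 * M) := Nat.pow_log_le_self 2 hq
    have h2 : n / (4 * M) < 2 ^ (i + 1) := Nat.lt_pow_succ_log_self (by norm_num) _
    have h3 : 4 * M * 2 ^ i ≤ n := (Nat.mul_le_mul_left _ h1).trans (Nat.mul_div_le n _)
    have h4 : n < 4 * M * 2 ^ (i + 1) := by
      rw [mul_comm]; exact (Nat.div_lt_iff_lt_mul (by positivity)).1 h2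
    have h5 : ∀ w ∈ B, v / Q ≤ G.vt w (2 ^ i) := by
      intro w hw
      rw [div_le_iff₀ hQ0]
      have h6 := hvt w n (2 ^ i) (by positivity) hn0
      have h7 : (1 : ℝ) + n / ((2 ^ i : ℕ) : ℝ) ≤ 1 + 8 * M := by
        have : (n : ℝ) / ((2 ^ i : ℕ) : ℝ) ≤ 8 * M := by
          rw [div_le_iff₀ (by positivity)]
          have : (n : ℝ) ≤ ((4 * M * 2 ^ (i + 1) : ℕ) : ℝ) := by exact_mod_cast h4.le
          refine this.trans (le_of_eq ?_)
          push_cast; rw [pow_succ]; ring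
        linarith
      have := (vt_pos (G := G) (x := w) (n := 2 ^ i) (by positivity)).le
      calc v ≤ _ := hvB w hw
        _ ≤ _ := h6
        _ ≤ Q * G.vt w (2 ^ i) := by rw [hQ]; gcongr
        _ = _ := mul_comm _ _
    have hvQ : 0 < v / Q := by positivity
    obtain ⟨k1, k2, hk12, hk1, hk2⟩ : ∃ k1 k2, k = k1 + k2 ∧ M * 2 ^ i ≤ k1 ∧ M * 2 ^ i ≤ k2 := by
      have : 4 * (M * 2 ^ i) ≤ k := by rw [← mul_assoc]; omega
      exact ⟨M * 2 ^ i, k - M * 2 ^ i, by omega, le_rfl, by omega⟩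
    have e1 := hn B i (v / Q) hvQ h5 y hy k1 hk1
    have e2 := hn B i (v / Q) hvQ h5 z hz k2 hk2
    have e3 := hk_sq_le (G := G) (A := B) k1 k2 y z
    rw [← hk12] at e3
    have e4 : (G.hk B k y z * (v / Q)) ^ 2 ≤ a ^ 2 := by
      calc _ = G.hk B k y z ^ 2 * (v / Q) ^ 2 := by ring
        _ ≤ G.hk B (k1 + k1) y y * G.hk B (k2 + k2) z z * (v / Q) ^ 2 :=
            mul_le_mul_of_nonneg_right e3 (by positivity)
        _ = (G.hk B (k1 + k1) y y * (v / Q)) * (G.hk B (k2 + k2) z z * (v / Q)) := by ring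
        _ ≤ a * a := mul_le_mul e1 e2 (mul_nonneg (hk_nonneg _ _ _ _) hvQ.le) ha.le
        _ = a ^ 2 := by ring
    have e5 := abs_le_of_sq_le_sq e4 ha.le
    have e6 := (le_abs_self _).trans e5
    rw [← mul_div_assoc, div_le_iff₀ hQ0] at e6
    exact e6

end Hyp

end

end

noncomputable section

variable {Γ : Type*} {G : WeightedGraph Γ} [Countable Γ] [Infinite Γ] [MeasurableSpace Γ]
  [DiscreteMeasurableSpace Γ] [FiniteBalls G] {p D C : ℝ} {A B : Finset Γ} {x y z : Γ}

theorem diagonalUpperEstimate_iff : G.DiagonalUpperEstimate ↔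
    ∃ K : ℝ, 0 < K ∧ ∀ (x : Γ) (n : ℕ), 0 < n → G.heatKernel n x x * G.vt x n ≤ K := by
  simp only [DiagonalUpperEstimate, e_eq_en, V_natCast]
  refine exists_congr fun K => and_congr_right fun _ => forall_congr' fun x => forall_congr' fun n =>
    forall_congr' fun hn => ?_
  rw [le_div_iff₀ (Vn_pos (en_pos hn))]
  rfl

theorem heatKernel_le_inv_mass (n : ℕ) (x y : Γ) : G.heatKernel n x y ≤ 1 / G.mass y := by
  rw [heatKernel_eq_hk_bf n x y (Nat.lt_succ_self n)]
  exact hk_le_inv_mass n x y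

namespace Hyp

variable (h : G.Hyp p D C)
include h

/-! ### The diagonal upper estimate from the Faber-Krahn inequality -/

/-- Telescope over the balls B(x,4ᵏR) with R = e(x,m). By `hk_sub_le` each increment is an exit
probability, stretched exponential in t_k = E(x,4ᵏR)/m, times a sup of the larger kernel, polynomial
in t_k. -/
theorem exists_heatKernel_le_of_faberKrahn (hFK : G.FaberKrahn) : ∃ K : ℝ, 0 < K ∧
    ∀ (x : Γ) (m : ℕ), 0 < m → G.heatKernel (m + m) x x * G.vt x m ≤ K := by
  obtain ⟨a, ha, hhk⟩ := h.exists_hk_le hFK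
  obtain ⟨K, γ, hK, -, hvx, -⟩ := h.exists_growth
  obtain ⟨T, c, ε, hT, hc, hε, htail⟩ := h.exists_tail
  have hC := h.two_le_C
  obtain ⟨Φ, hΦ, hsum⟩ := exists_sum_exp_le (b := C ^ 2) hc hε (by positivity) h.one_lt_ratio γ
  refine ⟨a * K * (1 + C) ^ γ + 2 * T * a * K * Φ, by positivity, fun x m hm => ?_⟩
  have hm0 : (0 : ℝ) < m := by exact_mod_cast hm
  set R := G.en x m with hR
  have hR0 : 0 < R := en_pos hm
  set t : ℕ → ℝ := fun k => G.En x (4 ^ k * R) / m with ht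
  have ht0 : ∀ k, 0 ≤ t k := fun k => div_nonneg (En_nonneg x _) hm0.le
  have hvpos : 0 < G.vt x m := vt_pos hm
  set Bk : ℕ → Finset Γ := fun k => G.bf x (4 ^ k * R) with hBk
  have hxB : ∀ k, x ∈ Bk k := fun k => mem_bf_self (by positivity)
  have hbound : ∀ k, ∀ y z, ∀ i ≥ m, G.hk (Bk k) i y z * G.vt x m ≤ a * (K * (1 + t k) ^ γ) := by
    intro k y z i hi
    have hpos : 0 < K * (1 + t k) ^ γ := by have := ht0 k; positivity
    have h1 := hhk (Bk k) m (G.vt x m / (K * (1 + t k) ^ γ)) hm (by positivity) ?_ y z i hi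
    · rwa [← mul_div_assoc, div_le_iff₀ hpos] at h1
    · intro w hw
      rw [div_le_iff₀ hpos, mul_comm]
      exact hvx x w _ m hm (mem_bf.1 hw)
  have htstep : ∀ k, t (k + 1) ≤ C ^ 2 * t k := by
    intro k
    have h1 := h.En_pow_four_mul_le x 1 (4 ^ k * R)
    rw [pow_one, pow_one, ← mul_assoc, ← pow_succ'] at h1
    rw [ht]; simp only
    rw [← mul_div_assoc]
    exact div_le_div_of_nonneg_right h1 hm0.le
  have hstep : ∀ k, G.hk (Bk (k + 1)) (m + m) x x * G.vt x m ≤ G.hk (Bk k) (m + m) x x * G.vt x m +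
      2 * T * a * K * ((1 + C ^ 2 * t k) ^ γ * Real.exp (-c * t k ^ ε)) := by
    intro k
    set S := a * (K * (1 + C ^ 2 * t k) ^ γ) / G.vt x m with hS
    have hS' : ∀ z, G.hk (Bk (k + 1)) m z x ≤ S := by
      intro z
      rw [hS, le_div_iff₀ hvpos]
      refine (hbound (k + 1) z x m le_rfl).trans ?_
      have := htstep k
      have := ht0 (k + 1)
      gcongr
    have h1 := hk_sub_le (G := G) (A := Bk k) (B := Bk (k + 1)) (m := m) (x := x) (y := x) (S := S)
      (bf_mono (Nat.mul_le_mul_right R (Nat.pow_le_pow_right (by norm_num) (Nat.le_succ k))))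
      (hxB k) (hxB k) fun z _ => ⟨hS' z, hS' z⟩
    have h2 := htail x (4 ^ k * R) m hm
    have hS0 : 0 ≤ S := (hk_nonneg _ _ _ _).trans (hS' x)
    have h3 := mul_le_mul_of_nonneg_right h2 hS0
    have h4 : G.hk (Bk (k + 1)) (m + m) x x ≤ G.hk (Bk k) (m + m) x x +
        2 * (T * Real.exp (-c * t k ^ ε) * S) := by
      linarith
    calc _ ≤ (G.hk (Bk k) (m + m) x x + 2 * (T * Real.exp (-c * t k ^ ε) * S)) * G.vt x m :=
          mul_le_mul_of_nonneg_right h4 hvpos.le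
      _ = _ := by rw [hS]; field_simp
  have hind : ∀ M : ℕ, G.hk (Bk M) (m + m) x x * G.vt x m ≤ G.hk (Bk 0) (m + m) x x * G.vt x m +
      2 * T * a * K * ∑ k ∈ Finset.range M, (1 + C ^ 2 * t k) ^ γ * Real.exp (-c * t k ^ ε) := by
    intro M
    induction M with
    | zero => simp
    | succ M ih => rw [Finset.sum_range_succ, mul_add]; linarith [hstep M]
  have ht00 : t 0 = G.En x R / m := by simp [ht]
  have h1 : 1 ≤ t 0 := by rw [ht00, one_le_div hm0]; exact le_En_en x m
  have h2 : t 0 ≤ C := by rw [ht00, div_le_iff₀ hm0]; exact h.En_en_le x hm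
  have h3 := hsum t h1 (fun k => by
    rw [ht00, ← mul_div_assoc]
    exact div_le_div_of_nonneg_right (h.le_En_pow_four_mul x k R) hm0.le) (m + m + 1)
  have h4 : Φ * Real.exp (-(c / 2) * t 0 ^ ε) ≤ Φ * 1 := by
    refine mul_le_mul_of_nonneg_left (Real.exp_le_one_iff.2 ?_) hΦ.le
    have := Real.rpow_nonneg (ht0 0) ε
    nlinarith
  have h5 := hbound 0 x x (m + m) (by omega)
  have h6 : a * (K * (1 + t 0) ^ γ) ≤ a * K * (1 + C) ^ γ := by
    rw [← mul_assoc]; gcongr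
  have h7 := hind (m + m + 1)
  -- After 2m + 1 scales the radius exceeds 2m, so the killed kernel is already that of the full
  -- walk.
  rw [heatKernel_eq_hk_bf (m + m) x x (N := 4 ^ (m + m + 1) * R)
    ((Nat.lt_pow_self (by norm_num : 1 < 4)).trans_le
      ((Nat.pow_le_pow_right (by norm_num) (Nat.le_succ _)).trans (Nat.le_mul_of_pos_right _ hR0)))]
  have h8 := mul_le_mul_of_nonneg_left (h3.trans h4) (show 0 ≤ 2 * T * a * K by positivity)
  change G.hk (Bk (m + m + 1)) (m + m) x x * G.vt x m ≤ _
  linarith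

theorem due_of_faberKrahn (hFK : G.FaberKrahn) : G.DiagonalUpperEstimate := by
  obtain ⟨K, hK, h1⟩ := h.exists_heatKernel_le_of_faberKrahn hFK
  obtain ⟨Q, γ, hQ, -, -, hvt⟩ := h.exists_growth
  rw [diagonalUpperEstimate_iff]
  refine ⟨max 1 (K * (Q * 4 ^ γ)), lt_max_of_lt_left one_pos, fun x n hn => ?_⟩
  -- The time n is split into two positive parts of comparable size, which also covers odd n; n = 1
  -- cannot be split.
  rcases Nat.lt_or_ge 1 n with hn1 | hn1
  swap
  · have : n = 1 := by omega
    subst this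
    refine le_max_of_le_left ?_
    rw [vt_one]
    have := heatKernel_le_inv_mass (G := G) 1 x x
    rwa [le_div_iff₀ (G.mass_pos x)] at this
  refine le_max_of_le_right ?_
  obtain ⟨j, k, hjk, hj, hk, hj3, hk3⟩ : ∃ j k, n = j + k ∧ 0 < j ∧ 0 < k ∧ n ≤ 3 * j ∧ n ≤ 3 * k :=
    ⟨n / 2, n - n / 2, by omega, by omega, by omega, by omega, by omega⟩
  have hvn : ∀ i, 0 < i → n ≤ 3 * i → G.heatKernel (i + i) x x * G.vt x n ≤ K * (Q * 4 ^ γ) := by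
    intro i hi hi3
    have hi0 : (0 : ℝ) < i := by exact_mod_cast hi
    have h2 := hvt x n i hi hn
    have h3 : (1 : ℝ) + n / i ≤ 4 := by
      have : (n : ℝ) / i ≤ 3 := by
        rw [div_le_iff₀ hi0]; exact_mod_cast hi3
      linarith
    have hp := (vt_pos (G := G) (x := x) hi).le
    have hnn := heatKernel_nonneg (G := G) (i + i) x x
    have h4 : G.vt x n ≤ Q * 4 ^ γ * G.vt x i := h2.trans (by gcongr)
    calc _ ≤ G.heatKernel (i + i) x x * (Q * 4 ^ γ * G.vt x i) := mul_le_mul_of_nonneg_left h4 hnn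
      _ = (G.heatKernel (i + i) x x * G.vt x i) * (Q * 4 ^ γ) := by ring
      _ ≤ _ := mul_le_mul_of_nonneg_right (h1 x i hi) (by positivity)
  have hsq := heatKernel_sq_le (G := G) j k x x
  rw [← hjk] at hsq
  have hv := (vt_pos (G := G) (x := x) hn).le
  refine (le_abs_self _).trans (abs_le_of_sq_le_sq ?_ (by positivity))
  calc (G.heatKernel n x x * G.vt x n) ^ 2 = G.heatKernel n x x ^ 2 * G.vt x n ^ 2 := by ring
    _ ≤ G.heatKernel (j + j) x x * G.heatKernel (k + k) x x * G.vt x n ^ 2 :=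
        mul_le_mul_of_nonneg_right hsq (by positivity)
    _ = (G.heatKernel (j + j) x x * G.vt x n) * (G.heatKernel (k + k) x x * G.vt x n) := by ring
    _ ≤ (K * (Q * 4 ^ γ)) * (K * (Q * 4 ^ γ)) := mul_le_mul (hvn j hj hj3) (hvn k hk hk3)
        (mul_nonneg (heatKernel_nonneg _ _ _) hv) (by positivity)
    _ = _ := by ring

end Hyp

end

noncomputable section

variable {Γ : Type*} {G : WeightedGraph Γ} [Countable Γ] [Infinite Γ] [MeasurableSpace Γ]
  [DiscreteMeasurableSpace Γ] [FiniteBalls G] {p D C : ℝ} {A B : Finset Γ} {x y z : Γ}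

theorem exists_pow_mul_exp_le {c ε b : ℝ} (hc : 0 < c) (hε : 0 < ε) (hb : 0 ≤ b) (γ : ℕ) :
    ∃ Φ : ℝ, 0 < Φ ∧ ∀ t : ℝ, 0 ≤ t →
      (1 + b * t) ^ γ * Real.exp (-c * t ^ ε) ≤ Φ * Real.exp (-(c / 2) * t ^ ε) := by
  obtain ⟨Φ, hΦ, h⟩ := exists_rpow_mul_exp_le (half_pos hc) hε hb γ
  refine ⟨max Φ ((1 + b) ^ γ), lt_max_of_lt_left hΦ, fun t ht => ?_⟩
  have h4 : Real.exp (-c * t ^ ε) =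
      Real.exp (-(c / 2) * t ^ ε) * Real.exp (-(c / 2) * t ^ ε) := by
    rw [← Real.exp_add]; ring_nf
  rw [h4, ← mul_assoc]
  refine mul_le_mul_of_nonneg_right ?_ (Real.exp_pos _).le
  rcases le_total 1 t with h1 | h1
  · refine le_max_of_le_left (le_trans ?_ (h t h1))
    exact le_mul_of_one_le_right (by positivity) h1
  · refine le_max_of_le_right ?_
    have h5 : Real.exp (-(c / 2) * t ^ ε) ≤ 1 := by
      refine Real.exp_le_one_iff.2 ?_
      have := Real.rpow_nonneg ht ε
      nlinarith
    calc _ ≤ (1 + b * 1) ^ γ * 1 := by gcongr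
      _ = _ := by ring

/-- A walk outside the ball at time a has left it by then. The set U is enlarged to contain the ball
and x, so that the two kernels are comparable. -/
theorem sum_mass_mul_hk_sdiff_le (U : Finset Γ) (x : Γ) (N a : ℕ) :
    ∑ z ∈ U \ G.bf x N, G.mass z * G.hk U a x z ≤ 1 - G.surv (G.bf x N) a x := by
  set W := U ∪ (G.bf x N ∪ {x}) with hW
  have hx : x ∈ W := by simp [hW]
  have hBW : G.bf x N ⊆ W := Finset.subset_union_left.trans Finset.subset_union_right
  have hnn : ∀ z, 0 ≤ G.mass z * G.hk W a x z := fun z =>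
    mul_nonneg (mass_nonneg z) (hk_nonneg W a x z)
  have h1 : ∑ z ∈ U \ G.bf x N, G.mass z * G.hk U a x z ≤
      ∑ z ∈ W \ G.bf x N, G.mass z * G.hk W a x z :=
    (Finset.sum_le_sum fun z _ => mul_le_mul_of_nonneg_left
      (hk_mono_set Finset.subset_union_left a x z) (mass_nonneg z)).trans
      (Finset.sum_le_sum_of_subset_of_nonneg
        (Finset.sdiff_subset_sdiff Finset.subset_union_left le_rfl) fun z _ _ => hnn z)
  have h2 := Finset.sum_sdiff (f := fun z => G.mass z * G.hk W a x z) hBW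
  have h3 := surv_le_one (G := G) W a x
  rw [surv_eq_sum_hk hx, ← h2] at h3
  have h4 : G.surv (G.bf x N) a x ≤ ∑ z ∈ G.bf x N, G.mass z * G.hk W a x z := by
    by_cases hxB : x ∈ G.bf x N
    · rw [surv_eq_sum_hk hxB]
      exact Finset.sum_le_sum fun z _ => mul_le_mul_of_nonneg_left
        (hk_mono_set hBW a x z) (mass_nonneg z)
    · rw [surv_of_notMem hxB]
      exact Finset.sum_nonneg fun z _ => hnn z
  linarith

/-- Since β > 1 is arbitrary, the exponent ε = 1/(β - 1) is an arbitrary positive number. -/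
theorem upperEstimate_iff : G.UpperEstimate ↔
    ∃ K c ε : ℝ, 0 < K ∧ 0 < c ∧ 0 < ε ∧ ∀ (x y : Γ) (n : ℕ), 0 < n →
      G.heatKernel n x y * G.vt x n ≤
        K * Real.exp (-c * (G.En x (G.graph.dist x y) / n) ^ ε) := by
  simp only [UpperEstimate, e_eq_en, V_natCast, E_natCast]
  constructor
  · rintro ⟨K, β, c, hK, hβ, hc, h⟩
    refine ⟨K, c, 1 / (β - 1), by linarith, hc, one_div_pos.2 (by linarith), fun x y n hn => ?_⟩
    have h1 := h x y n hn
    rw [div_mul_eq_mul_div, le_div_iff₀ (Vn_pos (en_pos hn))] at h1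
    exact h1
  · rintro ⟨K, c, ε, hK, hc, hε, h⟩
    refine ⟨K + 1, 1 + 1 / ε, c, by linarith, by linarith [one_div_pos.2 hε], hc,
      fun x y n hn => ?_⟩
    rw [div_mul_eq_mul_div, le_div_iff₀ (Vn_pos (en_pos hn)), add_sub_cancel_left, one_div_one_div]
    refine (h x y n hn).trans (mul_le_mul_of_nonneg_right (by linarith) (Real.exp_pos _).le)

namespace Hyp

variable (h : G.Hyp p D C)
include h

/-! ### The off-diagonal upper estimate -/

theorem exists_heatKernel_sq_le (hD : G.DiagonalUpperEstimate) : ∃ K : ℝ, 0 < K ∧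
    ∀ (x y : Γ) (n : ℕ), 0 < n → G.heatKernel n x y ^ 2 * (G.vt x n * G.vt y n) ≤ K := by
  obtain ⟨K, hK, h1⟩ := diagonalUpperEstimate_iff.1 hD
  obtain ⟨Q, γ, hQ, -, -, hvt⟩ := h.exists_growth
  refine ⟨max 1 ((K * (Q * 4 ^ γ)) ^ 2), lt_max_of_lt_left one_pos, fun x y n hn => ?_⟩
  have hnn := heatKernel_nonneg (G := G) n x y
  rcases Nat.lt_or_ge 1 n with hn1 | hn1
  swap
  · have : n = 1 := by omega
    subst this
    refine le_max_of_le_left ?_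
    rw [vt_one, vt_one]
    have h2 := heatKernel_le_inv_mass (G := G) 1 x y
    have h3 := heatKernel_le_inv_mass (G := G) 1 y x
    rw [heatKernel_comm] at h3
    rw [le_div_iff₀ (G.mass_pos _)] at h2 h3
    calc _ = (G.heatKernel 1 x y * G.mass x) * (G.heatKernel 1 x y * G.mass y) := by ring
      _ ≤ 1 * 1 := mul_le_mul h3 h2 (mul_nonneg hnn (mass_nonneg y)) zero_le_one
      _ = 1 := one_mul 1
  refine le_max_of_le_right ?_
  obtain ⟨j, k, hjk, hj, hk, hj3, hk3⟩ : ∃ j k, n = j + k ∧ 0 < j ∧ 0 < k ∧ n ≤ 3 * j ∧ n ≤ 3 * k :=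
    ⟨n / 2, n - n / 2, by omega, by omega, by omega, by omega, by omega⟩
  have hvn : ∀ w i, 0 < i → n ≤ 3 * i → G.heatKernel (i + i) w w * G.vt w n ≤ K * (Q * 4 ^ γ) := by
    intro w i hi hi3
    have hii : 0 < i + i := by omega
    have hi0 : (0 : ℝ) < (i + i : ℕ) := by exact_mod_cast hii
    have h2 := hvt w n (i + i) hii hn
    have h3 : (1 : ℝ) + n / (i + i : ℕ) ≤ 4 := by
      have : (n : ℝ) / (i + i : ℕ) ≤ 3 := by
        rw [div_le_iff₀ hi0]
        exact_mod_cast (by omega : n ≤ 3 * (i + i))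
      linarith
    have hp := (vt_pos (G := G) (x := w) hii).le
    have hnn := heatKernel_nonneg (G := G) (i + i) w w
    have h4 : G.vt w n ≤ Q * 4 ^ γ * G.vt w (i + i) := h2.trans (by gcongr)
    calc _ ≤ G.heatKernel (i + i) w w * (Q * 4 ^ γ * G.vt w (i + i)) :=
          mul_le_mul_of_nonneg_left h4 hnn
      _ = (G.heatKernel (i + i) w w * G.vt w (i + i)) * (Q * 4 ^ γ) := by ring
      _ ≤ _ := mul_le_mul_of_nonneg_right (h1 w _ hii) (by positivity)
  have hsq := heatKernel_sq_le (G := G) j k x y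
  rw [← hjk] at hsq
  have hv := (vt_pos (G := G) (x := x) hn).le
  have hv' := (vt_pos (G := G) (x := y) hn).le
  calc G.heatKernel n x y ^ 2 * (G.vt x n * G.vt y n)
      ≤ G.heatKernel (j + j) x x * G.heatKernel (k + k) y y * (G.vt x n * G.vt y n) :=
        mul_le_mul_of_nonneg_right hsq (by positivity)
    _ = (G.heatKernel (j + j) x x * G.vt x n) * (G.heatKernel (k + k) y y * G.vt y n) := by ring
    _ ≤ (K * (Q * 4 ^ γ)) * (K * (Q * 4 ^ γ)) := mul_le_mul (hvn x j hj hj3) (hvn y k hk hk3)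
        (mul_nonneg (heatKernel_nonneg _ _ _) hv') (by positivity)
    _ = _ := by ring

/-- The geometric mean bound at z and y is transferred to the volume at x; by `exists_growth` this
costs only a power of 1 + E(x,N)/n. -/
theorem exists_heatKernel_le (hD : G.DiagonalUpperEstimate) : ∃ (K : ℝ) (γ : ℕ), 0 < K ∧
    ∀ (x y z : Γ) (N n : ℕ), 0 < n → G.graph.dist x y < N → G.graph.dist x z < N →
      G.heatKernel n z y * G.vt x n ≤ K * (1 + G.En x N / n) ^ γ := by
  obtain ⟨K, hK, h1⟩ := h.exists_heatKernel_sq_le hD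
  obtain ⟨Q, γ, hQ, -, hvx, -⟩ := h.exists_growth
  refine ⟨√K * Q, γ, by positivity, fun x y z N n hn hy hz => ?_⟩
  have hE : 0 ≤ G.En x N / n := div_nonneg (En_nonneg x N) (Nat.cast_nonneg n)
  have hv := (vt_pos (G := G) (x := x) hn).le
  have hvz := (vt_pos (G := G) (x := z) hn).le
  have hvy := (vt_pos (G := G) (x := y) hn).le
  refine (le_abs_self _).trans (abs_le_of_sq_le_sq ?_ (by positivity))
  set q := Q * (1 + G.En x N / n) ^ γ with hq
  have hq0 : 0 ≤ q := by positivity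
  calc (G.heatKernel n z y * G.vt x n) ^ 2
      = G.heatKernel n z y ^ 2 * (G.vt x n * G.vt x n) := by ring
    _ ≤ G.heatKernel n z y ^ 2 * ((q * G.vt z n) * (q * G.vt y n)) := by
        refine mul_le_mul_of_nonneg_left ?_ (sq_nonneg _)
        exact mul_le_mul (hvx x z N n hn hz) (hvx x y N n hn hy) hv (by positivity)
    _ = (G.heatKernel n z y ^ 2 * (G.vt z n * G.vt y n)) * q ^ 2 := by ring
    _ ≤ K * q ^ 2 := mul_le_mul_of_nonneg_right (h1 z y n hn) (sq_nonneg _)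
    _ = (√K * q) ^ 2 := by rw [mul_pow (√K) q, Real.sq_sqrt hK.le]
    _ = _ := by rw [hq]; ring

/-- Decompose the far intermediate points into shells between radii 4ᵏr and 4^(k+1)r. The first
factor has the mass of an exit event, the second is bounded polynomially, and the sum over shells
converges. -/
theorem exists_far_sum_le (hD : G.DiagonalUpperEstimate) : ∃ K c ε : ℝ, 0 < K ∧ 0 < c ∧ 0 < ε ∧
    ∀ (U : Finset Γ) (x y : Γ) (n a b r : ℕ), 0 < a → 0 < b → a ≤ n → b ≤ n → n ≤ 3 * b → 0 < r →
      G.graph.dist x y < 4 * r → (n : ℝ) ≤ G.En x r →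
      (∑ z ∈ U \ G.bf x r, G.mass z * (G.hk U a x z * G.heatKernel b z y)) * G.vt x n ≤
        K * Real.exp (-c * (G.En x r / n) ^ ε) := by
  obtain ⟨K, γ, hK, h1⟩ := h.exists_heatKernel_le hD
  obtain ⟨Q, γ', hQ, -, -, hvt⟩ := h.exists_growth
  obtain ⟨T, c, ε, hT, hc, hε, htail⟩ := h.exists_tail
  have hC := h.two_le_C
  obtain ⟨Φ, hΦ, hsum⟩ := exists_sum_exp_le (b := 3 * C ^ 2) hc hε (by positivity) h.one_lt_ratio γ
  refine ⟨K * (Q * 4 ^ γ') * T * Φ, c / 2, ε, by positivity, by positivity, hε, ?_⟩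
  intro U x y n a b r ha hb han hbn hn3 hr hd hnr
  have hn : 0 < n := ha.trans_le han
  have hn0 : (0 : ℝ) < n := by exact_mod_cast hn
  have hb0 : (0 : ℝ) < b := by exact_mod_cast hb
  have ha0 : (0 : ℝ) < a := by exact_mod_cast ha
  set t : ℕ → ℝ := fun k => G.En x (4 ^ k * r) / n with ht
  have ht0 : ∀ k, 0 ≤ t k := fun k => div_nonneg (En_nonneg x _) hn0.le
  have htz : t 0 = G.En x r / n := by simp [ht]
  set F : Γ → ℝ := fun z => G.mass z * (G.hk U a x z * G.heatKernel b z y) with hF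
  have hF0 : ∀ z, 0 ≤ F z := fun z => mul_nonneg (mass_nonneg z)
    (mul_nonneg (hk_nonneg _ _ _ _) (heatKernel_nonneg _ _ _))
  have hvn : G.vt x n ≤ Q * 4 ^ γ' * G.vt x b := by
    have h3 : (1 : ℝ) + n / b ≤ 4 := by
      have : (n : ℝ) / b ≤ 3 := by
        rw [div_le_iff₀ hb0]; exact_mod_cast hn3
      linarith
    have hp := (vt_pos (G := G) (x := x) hb).le
    exact (hvt x n b hb hn).trans (by gcongr)
  have hshell : ∀ k, (∑ z ∈ (U ∩ G.bf x (4 ^ (k + 1) * r)) \ G.bf x (4 ^ k * r), F z) * G.vt x n ≤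
      K * (Q * 4 ^ γ') * T * ((1 + 3 * C ^ 2 * t k) ^ γ * Real.exp (-c * t k ^ ε)) := by
    intro k
    have hE1 : G.En x (4 ^ (k + 1) * r) ≤ C ^ 2 * G.En x (4 ^ k * r) := by
      have h1 := h.En_pow_four_mul_le x 1 (4 ^ k * r)
      rwa [pow_one, pow_one, ← mul_assoc, ← pow_succ'] at h1
    have hEb : G.En x (4 ^ (k + 1) * r) / b ≤ 3 * C ^ 2 * t k := by
      rw [div_le_iff₀ hb0]
      have h3 : (n : ℝ) ≤ 3 * b := by exact_mod_cast hn3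
      calc _ ≤ C ^ 2 * (t k * n) := by
            rw [ht]; simp only; rw [div_mul_cancel₀ _ hn0.ne']; exact hE1
        _ ≤ C ^ 2 * (t k * (3 * b)) := by have := ht0 k; gcongr
        _ = _ := by ring
    have hpt : ∀ z ∈ (U ∩ G.bf x (4 ^ (k + 1) * r)) \ G.bf x (4 ^ k * r), F z * G.vt x n ≤
        G.mass z * G.hk U a x z * (K * (Q * 4 ^ γ') * (1 + 3 * C ^ 2 * t k) ^ γ) := by
      intro z hz
      have hz' : G.graph.dist x z < 4 ^ (k + 1) * r :=
        mem_bf.1 (Finset.mem_inter.1 (Finset.mem_sdiff.1 hz).1).2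
      have hy' : G.graph.dist x y < 4 ^ (k + 1) * r := by
        refine hd.trans_le (Nat.mul_le_mul_right r ?_)
        rw [pow_succ]; exact Nat.le_mul_of_pos_left 4 (by positivity)
      have h2 := h1 x y z _ b hb hy' hz'
      have hnn := heatKernel_nonneg (G := G) b z y
      have hE0 : 0 ≤ G.En x (4 ^ (k + 1) * r) / b := div_nonneg (En_nonneg x _) hb0.le
      have h4 : G.heatKernel b z y * G.vt x n ≤
          K * (Q * 4 ^ γ') * (1 + 3 * C ^ 2 * t k) ^ γ := by
        calc _ ≤ G.heatKernel b z y * (Q * 4 ^ γ' * G.vt x b) := mul_le_mul_of_nonneg_left hvn hnn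
          _ = (G.heatKernel b z y * G.vt x b) * (Q * 4 ^ γ') := by ring
          _ ≤ (K * (1 + G.En x (4 ^ (k + 1) * r) / b) ^ γ) * (Q * 4 ^ γ') :=
              mul_le_mul_of_nonneg_right h2 (by positivity)
          _ ≤ (K * (1 + 3 * C ^ 2 * t k) ^ γ) * (Q * 4 ^ γ') := by gcongr
          _ = _ := by ring
      calc F z * G.vt x n = G.mass z * G.hk U a x z * (G.heatKernel b z y * G.vt x n) := by
            rw [hF]; ring
        _ ≤ _ := mul_le_mul_of_nonneg_left h4 (mul_nonneg (mass_nonneg z) (hk_nonneg _ _ _ _))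
    have hs : ∑ z ∈ (U ∩ G.bf x (4 ^ (k + 1) * r)) \ G.bf x (4 ^ k * r), G.mass z * G.hk U a x z ≤
        T * Real.exp (-c * t k ^ ε) := by
      calc _ ≤ ∑ z ∈ U \ G.bf x (4 ^ k * r), G.mass z * G.hk U a x z :=
            Finset.sum_le_sum_of_subset_of_nonneg
              (Finset.sdiff_subset_sdiff Finset.inter_subset_left le_rfl)
              fun z _ _ => mul_nonneg (mass_nonneg z) (hk_nonneg _ _ _ _)
        _ ≤ _ := sum_mass_mul_hk_sdiff_le U x _ a
        _ ≤ _ := htail x _ a ha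
        _ ≤ _ := by
            refine mul_le_mul_of_nonneg_left (Real.exp_le_exp.2 ?_) (by linarith)
            have h5 : t k ≤ G.En x (4 ^ k * r) / a :=
              div_le_div_of_nonneg_left (En_nonneg x _) ha0 (by exact_mod_cast han)
            have := Real.rpow_le_rpow (ht0 k) h5 hε.le
            nlinarith
    rw [Finset.sum_mul]
    refine (Finset.sum_le_sum hpt).trans ?_
    rw [← Finset.sum_mul]
    have htk := ht0 k
    refine (mul_le_mul_of_nonneg_right hs (by positivity)).trans (le_of_eq (by ring))
  have hind : ∀ M : ℕ, (∑ z ∈ (U ∩ G.bf x (4 ^ M * r)) \ G.bf x r, F z) * G.vt x n ≤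
      K * (Q * 4 ^ γ') * T *
        ∑ k ∈ Finset.range M, (1 + 3 * C ^ 2 * t k) ^ γ * Real.exp (-c * t k ^ ε) := by
    intro M
    induction M with
    | zero =>
      rw [pow_zero, one_mul, Finset.range_zero, Finset.sum_empty, mul_zero,
        Finset.sdiff_eq_empty_iff_subset.2 Finset.inter_subset_right, Finset.sum_empty, zero_mul]
    | succ M ih =>
      rw [Finset.sum_range_succ, mul_add]
      refine le_trans ?_ (add_le_add ih (hshell M))
      rw [← add_mul]
      refine mul_le_mul_of_nonneg_right ?_ (vt_pos hn).le
      have hsub : (U ∩ G.bf x (4 ^ (M + 1) * r)) \ G.bf x r ⊆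
          (U ∩ G.bf x (4 ^ M * r)) \ G.bf x r ∪
            (U ∩ G.bf x (4 ^ (M + 1) * r)) \ G.bf x (4 ^ M * r) := by
        intro z hz
        simp only [Finset.mem_sdiff, Finset.mem_inter, Finset.mem_union] at hz ⊢
        tauto
      refine (Finset.sum_le_sum_of_subset_of_nonneg hsub fun z _ _ => hF0 z).trans ?_
      rw [← Finset.sum_union_inter]
      exact le_add_of_nonneg_right (Finset.sum_nonneg fun z _ => hF0 z)
  set M := U.sup fun z => G.graph.dist x z + 1 with hM
  have hUM : U ⊆ G.bf x (4 ^ M * r) := by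
    intro z hz
    rw [mem_bf]
    have h2 : G.graph.dist x z + 1 ≤ M := Finset.le_sup (f := fun z => G.graph.dist x z + 1) hz
    have h3 : M < 4 ^ M := Nat.lt_pow_self (by norm_num)
    have h4 : 4 ^ M ≤ 4 ^ M * r := Nat.le_mul_of_pos_right _ hr
    omega
  have h2 := hind M
  rw [Finset.inter_eq_left.2 hUM] at h2
  refine h2.trans ?_
  have h3 := hsum t (by rw [htz, one_le_div hn0]; exact hnr) (fun k => by
    rw [htz, ← mul_div_assoc]
    exact div_le_div_of_nonneg_right (h.le_En_pow_four_mul x k r) hn0.le) M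
  rw [htz] at h3
  rw [mul_assoc _ Φ]
  exact mul_le_mul_of_nonneg_left h3 (by positivity)

/-- Cut the time into two comparable parts a and b. The position z at the cut is at distance at
least about d/2 from x or from y, so the kernel is at most the sum of two far sums, one seen from
each end. -/
theorem ue_of_due (hD : G.DiagonalUpperEstimate) : G.UpperEstimate := by
  obtain ⟨K, c, ε, hK, hc, hε, hfar⟩ := h.exists_far_sum_le hD
  obtain ⟨K₁, γ₁, hK₁, h1⟩ := h.exists_heatKernel_le hD
  obtain ⟨Q, γ, hQ, -, hvx, -⟩ := h.exists_growth
  have hC := h.two_le_C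
  have hC0 := h.C_pos
  obtain ⟨Φ, hΦ, hpe⟩ := exists_pow_mul_exp_le (b := C ^ 3) hc hε (by positivity) γ
  -- The factor C³ is the price of replacing E(y,r) by E(x,d); half of c is spent on the volume
  -- ratio between y and x.
  set c' := c / 2 / (C ^ 3) ^ ε with hc'
  have hCε : 0 < (C ^ 3) ^ ε := Real.rpow_pos_of_pos (by positivity) ε
  have hc'0 : 0 < c' := by positivity
  set K₂ := K₁ * (2 + C ^ 4) ^ γ₁ * Real.exp (c / 2) with hK₂
  have hK₂0 : 0 < K₂ := by positivity
  set K₃ := K + Q * K * Φ with hK₃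
  rw [upperEstimate_iff]
  refine ⟨K₂ + K₃, c', ε, by positivity, hc'0, hε, fun x y n hn => ?_⟩
  have hn0 : (0 : ℝ) < n := by exact_mod_cast hn
  have hn1 : (1 : ℝ) ≤ n := by exact_mod_cast hn
  set d := G.graph.dist x y with hd
  set τ := G.En x d / n with hτ
  have hτ0 : 0 ≤ τ := div_nonneg (En_nonneg x d) hn0.le
  have hvn := (vt_pos (G := G) (x := x) hn).le
  have hscale : ∀ s, 0 ≤ s → τ ≤ C ^ 3 * s →
      Real.exp (-(c / 2) * s ^ ε) ≤ Real.exp (-c' * τ ^ ε) := by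
    intro s hs hτs
    refine Real.exp_le_exp.2 ?_
    have h2 : τ ^ ε ≤ (C ^ 3) ^ ε * s ^ ε := by
      rw [← Real.mul_rpow (by positivity) hs]
      exact Real.rpow_le_rpow hτ0 hτs hε.le
    have h3 : c' * τ ^ ε ≤ c' * ((C ^ 3) ^ ε * s ^ ε) := mul_le_mul_of_nonneg_left h2 hc'0.le
    have h4 : c' * ((C ^ 3) ^ ε * s ^ ε) = c / 2 * s ^ ε := by
      rw [hc']; field_simp
    linarith
  -- For bounded τ the exponential is bounded below, and the bound without Gaussian factor is
  -- enough.
  rcases lt_or_ge τ (C ^ 3) with hsmall | hbig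
  · have h2 := h1 x y x (d + 1) n hn (by omega) (by rw [SimpleGraph.dist_self]; omega)
    have h3 : G.En x (d + 1) / n ≤ 1 + C ^ 4 := by
      rcases Nat.eq_zero_or_pos d with hd0 | hd0
      · rw [hd0, zero_add, En_one]
        have : 1 / (n : ℝ) ≤ 1 := by rw [div_le_one hn0]; exact hn1
        have : 0 < C ^ 4 := by positivity
        linarith
      · have h4 : G.En x (d + 1) ≤ C * G.En x d :=
          (En_mono (by omega)).trans (h.En_two_mul_le x d)
        calc _ ≤ C * G.En x d / n := div_le_div_of_nonneg_right h4 hn0.le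
          _ = C * τ := by rw [hτ]; ring
          _ ≤ C * C ^ 3 := mul_le_mul_of_nonneg_left hsmall.le hC0.le
          _ ≤ _ := by nlinarith [sq_nonneg C]
    have h5 := hscale 1 zero_le_one (by linarith)
    rw [Real.one_rpow, mul_one] at h5
    have hE0 : 0 ≤ G.En x (d + 1) / n := div_nonneg (En_nonneg x _) hn0.le
    have h6 : 1 ≤ Real.exp (c / 2) * Real.exp (-c' * τ ^ ε) := by
      calc 1 = Real.exp (c / 2) * Real.exp (-(c / 2)) := by rw [← Real.exp_add]; simp
        _ ≤ _ := mul_le_mul_of_nonneg_left h5 (Real.exp_pos _).le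
    calc _ ≤ K₁ * (1 + G.En x (d + 1) / n) ^ γ₁ := h2
      _ ≤ K₁ * (2 + C ^ 4) ^ γ₁ * 1 := by
          rw [mul_one]
          refine mul_le_mul_of_nonneg_left (pow_le_pow_left₀ (by linarith) (by linarith) _) hK₁.le
      _ ≤ K₁ * (2 + C ^ 4) ^ γ₁ * (Real.exp (c / 2) * Real.exp (-c' * τ ^ ε)) :=
          mul_le_mul_of_nonneg_left h6 (by positivity)
      _ = K₂ * Real.exp (-c' * τ ^ ε) := by rw [hK₂]; ring
      _ ≤ _ := mul_le_mul_of_nonneg_right (by have : 0 < K₃ := by positivity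
                                              linarith) (Real.exp_pos _).le
  · have hC3 : 1 < C ^ 3 := one_lt_pow₀ (by linarith) (by norm_num)
    have hd2 : 2 ≤ d := by
      by_contra hlt
      have h2 : G.En x d ≤ 1 := by
        rw [← En_one (G := G) x]; exact En_mono (by omega)
      have : τ ≤ 1 := by rw [hτ, div_le_one hn0]; linarith
      linarith
    rcases Nat.lt_or_ge 1 n with hn2 | hn2
    swap
    · have : n = 1 := by omega
      subst this
      rw [heatKernel_eq_hk_bf (N := 2) 1 x y (by norm_num),
        hk_of_notMem_right (by rw [mem_bf]; omega), zero_mul]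
      positivity
    obtain ⟨a, b, hab, ha, hb, ha3, hb3⟩ :
        ∃ a b, n = a + b ∧ 0 < a ∧ 0 < b ∧ n ≤ 3 * a ∧ n ≤ 3 * b :=
      ⟨n / 2, n - n / 2, by omega, by omega, by omega, by omega, by omega⟩
    -- Here 2r ≤ d + 1 makes the open balls B(x,r) and B(y,r) disjoint: a common point would give d
    -- ≤ 2(r - 1) < d.
    obtain ⟨r, hr0, hr1, hr2⟩ : ∃ r, 0 < r ∧ d ≤ 2 * r ∧ 2 * r ≤ d + 1 :=
      ⟨(d + 1) / 2, by omega, by omega, by omega⟩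
    have hdx : G.graph.dist x y < 4 * r := by omega
    have hdy : G.graph.dist y x < 4 * r := by rw [SimpleGraph.dist_comm]; exact hdx
    have hEx : G.En x d ≤ C * G.En x r := (En_mono hr1).trans (h.En_two_mul_le x r)
    have hEy : G.En x (4 * r) ≤ C ^ 3 * G.En y r := by
      have h2 := h.En_pow_four_mul_le y 1 r
      rw [pow_one, pow_one] at h2
      calc _ ≤ C * G.En y (4 * r) := h.En_le_of_dist_lt hdx
        _ ≤ C * (C ^ 2 * G.En y r) := mul_le_mul_of_nonneg_left h2 hC0.le
        _ = _ := by ring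
    have hEdy : G.En x d ≤ C ^ 3 * G.En y r := (En_mono (by omega)).trans hEy
    have hbig' : C ^ 3 * n ≤ G.En x d := by rwa [hτ, le_div_iff₀ hn0] at hbig
    have hCC : C ≤ C ^ 3 := le_self_pow₀ (by linarith) (by norm_num)
    have hEx3 : G.En x d ≤ C ^ 3 * G.En x r :=
      hEx.trans (mul_le_mul_of_nonneg_right hCC (En_nonneg x r))
    have hnx : (n : ℝ) ≤ G.En x r :=
      le_of_mul_le_mul_left (hbig'.trans hEx3) (by positivity)
    have hny : (n : ℝ) ≤ G.En y r :=
      le_of_mul_le_mul_left (hbig'.trans hEdy) (by positivity)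
    set U := G.bf x (n + 1) with hU
    have f1 := hfar U x y n a b r ha hb (by omega) (by omega) hb3 hr0 hdx hnx
    have f2 := hfar U y x n b a r hb ha (by omega) (by omega) ha3 hr0 hdy hny
    set S1 := ∑ z ∈ U \ G.bf x r, G.mass z * (G.hk U a x z * G.heatKernel b z y) with hS1
    set S2 := ∑ z ∈ U \ G.bf y r, G.mass z * (G.hk U b y z * G.heatKernel a z x) with hS2
    have hsplit : G.heatKernel n x y ≤ S1 + S2 := by
      rw [heatKernel_eq_hk_of_subset (A := U) (by rw [hU]), hab, hk_add]
      have hsub : U ⊆ (U \ G.bf x r) ∪ (U \ G.bf y r) := by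
        intro z hz
        by_cases hzx : z ∈ G.bf x r
        · refine Finset.mem_union_right _ (Finset.mem_sdiff.2 ⟨hz, fun hzy => ?_⟩)
          rw [mem_bf] at hzx hzy
          rw [SimpleGraph.dist_comm] at hzy
          have := dist_triangle (G := G) x z y
          omega
        · exact Finset.mem_union_left _ (Finset.mem_sdiff.2 ⟨hz, hzx⟩)
      have hnn : ∀ z, 0 ≤ G.mass z * (G.hk U a x z * G.hk U b z y) := fun z =>
        mul_nonneg (mass_nonneg z) (mul_nonneg (hk_nonneg _ _ _ _) (hk_nonneg _ _ _ _))
      calc _ ≤ ∑ z ∈ (U \ G.bf x r) ∪ (U \ G.bf y r), G.mass z * (G.hk U a x z * G.hk U b z y) :=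
            Finset.sum_le_sum_of_subset_of_nonneg hsub fun z _ _ => hnn z
        _ ≤ ∑ z ∈ U \ G.bf x r, G.mass z * (G.hk U a x z * G.hk U b z y) +
            ∑ z ∈ U \ G.bf y r, G.mass z * (G.hk U a x z * G.hk U b z y) := by
            rw [← Finset.sum_union_inter]
            exact le_add_of_nonneg_right (Finset.sum_nonneg fun z _ => hnn z)
        _ ≤ _ := by
            refine add_le_add (Finset.sum_le_sum fun z _ => ?_) (Finset.sum_le_sum fun z _ => ?_)
            · exact mul_le_mul_of_nonneg_left (mul_le_mul_of_nonneg_left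
                (hk_le_heatKernel U b z y) (hk_nonneg _ _ _ _)) (mass_nonneg z)
            · refine mul_le_mul_of_nonneg_left ?_ (mass_nonneg z)
              rw [mul_comm, hk_comm U b z y, hk_comm U a x z]
              exact mul_le_mul_of_nonneg_left (hk_le_heatKernel U a z x) (hk_nonneg _ _ _ _)
    set s := G.En y r / n with hs
    have hs0 : 0 ≤ s := div_nonneg (En_nonneg y r) hn0.le
    have g1 : S1 * G.vt x n ≤ K * Real.exp (-c' * τ ^ ε) := by
      refine f1.trans (mul_le_mul_of_nonneg_left ?_ hK.le)
      have hsx0 : 0 ≤ G.En x r / n := div_nonneg (En_nonneg x r) hn0.le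
      refine le_trans (Real.exp_le_exp.2 ?_) (hscale (G.En x r / n) hsx0 ?_)
      · have := Real.rpow_nonneg hsx0 ε
        nlinarith
      · rw [hτ, ← mul_div_assoc]; exact div_le_div_of_nonneg_right hEx3 hn0.le
    have g2 : S2 * G.vt x n ≤ Q * K * Φ * Real.exp (-c' * τ ^ ε) := by
      have hS20 : 0 ≤ S2 := Finset.sum_nonneg fun z _ => mul_nonneg (mass_nonneg z)
        (mul_nonneg (hk_nonneg _ _ _ _) (heatKernel_nonneg _ _ _))
      have h2 := hvx x y (4 * r) n hn hdx
      have h3 : G.En x (4 * r) / n ≤ C ^ 3 * s := by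
        rw [hs, ← mul_div_assoc]; exact div_le_div_of_nonneg_right hEy hn0.le
      have hE0 : 0 ≤ G.En x (4 * r) / n := div_nonneg (En_nonneg x _) hn0.le
      have hvy := (vt_pos (G := G) (x := y) hn).le
      calc S2 * G.vt x n ≤ S2 * (Q * (1 + C ^ 3 * s) ^ γ * G.vt y n) := by
            refine mul_le_mul_of_nonneg_left (h2.trans ?_) hS20
            gcongr
        _ = Q * (1 + C ^ 3 * s) ^ γ * (S2 * G.vt y n) := by ring
        _ ≤ Q * (1 + C ^ 3 * s) ^ γ * (K * Real.exp (-c * s ^ ε)) :=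
            mul_le_mul_of_nonneg_left f2 (by positivity)
        _ = Q * K * ((1 + C ^ 3 * s) ^ γ * Real.exp (-c * s ^ ε)) := by ring
        _ ≤ Q * K * (Φ * Real.exp (-(c / 2) * s ^ ε)) :=
            mul_le_mul_of_nonneg_left (hpe s hs0) (by positivity)
        _ ≤ Q * K * (Φ * Real.exp (-c' * τ ^ ε)) := by
            have := hscale s hs0 (by
              rw [hτ, hs, ← mul_div_assoc]; exact div_le_div_of_nonneg_right hEdy hn0.le)
            gcongr
        _ = _ := by ring
    calc _ ≤ (S1 + S2) * G.vt x n := mul_le_mul_of_nonneg_right hsplit hvn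
      _ = S1 * G.vt x n + S2 * G.vt x n := add_mul _ _ _
      _ ≤ K₃ * Real.exp (-c' * τ ^ ε) := by rw [hK₃, add_mul]; exact add_le_add g1 g2
      _ ≤ _ := mul_le_mul_of_nonneg_right (by linarith) (Real.exp_pos _).le

end Hyp

/-- At y = x the radius is 0, E(x,0) = 0, and the exponential is 1. -/
theorem due_of_ue (hU : G.UpperEstimate) : G.DiagonalUpperEstimate := by
  obtain ⟨K, c, ε, hK, hc, hε, h⟩ := upperEstimate_iff.1 hU
  refine diagonalUpperEstimate_iff.2 ⟨K, hK, fun x n hn => ?_⟩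
  have h1 := h x x n hn
  rwa [SimpleGraph.dist_self, En_zero, zero_div, Real.zero_rpow hε.ne', mul_zero, Real.exp_zero,
    mul_one] at h1

end

noncomputable section

variable {Γ : Type*} {G : WeightedGraph Γ} [Countable Γ] [Infinite Γ] [MeasurableSpace Γ]
  [DiscreteMeasurableSpace Γ] [FiniteBalls G] {p D C : ℝ} {A B : Finset Γ} {x y z : Γ}

/-! ### Green kernels and elliptic mean value inequalities -/

theorem greenUpperBound_iff : G.GreenUpperBound ↔ ∃ K : ℝ, 0 < K ∧ ∀ (x : Γ) (N : ℕ) (y : Γ),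
    0 < G.graph.dist x y → G.gr (G.bf x N) y x * G.Vn x (G.graph.dist x y) ≤ K * G.En x N := by
  constructor
  · rintro ⟨K, hK, h⟩
    refine ⟨K, by linarith, fun x N y hd => ?_⟩
    rcases Nat.eq_zero_or_pos N with rfl | hN
    · rw [gr_of_notMem_left (by simp), zero_mul, En_zero, mul_zero]
    have h1 := h x N (Nat.cast_pos.2 hN) y hd
    rwa [ball_eq_coe_bf, Nat.ceil_natCast, green_coe, V_natCast, E_natCast, ← mul_div_assoc,
      le_div_iff₀ (Vn_pos hd)] at h1
  · rintro ⟨K, hK, h⟩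
    refine ⟨K + 1, by linarith, fun x R _ y hd => ?_⟩
    rw [ball_eq_coe_bf, green_coe, V_natCast, E_eq_En, ← mul_div_assoc, le_div_iff₀ (Vn_pos hd)]
    refine (h x _ y hd).trans ?_
    linarith [En_nonneg (G := G) x ⌈R⌉₊]

theorem greenMeanValue_iff : G.GreenMeanValue ↔ ∃ K : ℝ, 0 < K ∧ ∀ (x : Γ) (N : ℕ) (y : Γ),
    0 < G.graph.dist x y → G.gr (G.bf x N) y x * G.Vn x (G.graph.dist x y) ≤
      K * ∑ z ∈ G.bf x (G.graph.dist x y), G.gr (G.bf x N) y z * G.mass z := by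
  constructor
  · rintro ⟨K, hK, h⟩
    refine ⟨K, by linarith, fun x N y hd => ?_⟩
    rcases Nat.eq_zero_or_pos N with rfl | hN
    · rw [gr_of_notMem_left (by simp), zero_mul]
      exact mul_nonneg (by linarith) (Finset.sum_nonneg fun z _ =>
        mul_nonneg (gr_nonneg _ _ _) (mass_nonneg z))
    have h1 := h x N (Nat.cast_pos.2 hN) y hd
    rw [tsum_ball x _ fun z => G.green (G.ball x N) y z * G.mass z] at h1
    simp only [ball_eq_coe_bf, Nat.ceil_natCast, green_coe, V_natCast] at h1
    rwa [div_mul_eq_mul_div, le_div_iff₀ (Vn_pos hd)] at h1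
  · rintro ⟨K, hK, h⟩
    refine ⟨K + 1, by linarith, fun x R _ y hd => ?_⟩
    rw [tsum_ball x _ fun z => G.green (G.ball x R) y z * G.mass z]
    simp only [ball_eq_coe_bf, Nat.ceil_natCast, green_coe, V_natCast]
    rw [div_mul_eq_mul_div, le_div_iff₀ (Vn_pos hd)]
    refine (h x _ y hd).trans (mul_le_mul_of_nonneg_right (by linarith) ?_)
    exact Finset.sum_nonneg fun z _ => mul_nonneg (gr_nonneg _ _ _) (mass_nonneg z)

/-- The pole y lies on the boundary of the open ball B(x,d), so g(y,·) is harmonic in that ball. -/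
theorem greenMeanValue_of_meanValue (h : G.MeanValue) : G.GreenMeanValue := by
  obtain ⟨K, hK, h⟩ := h
  refine greenMeanValue_iff.2 ⟨K, hK, fun x N y hd => ?_⟩
  by_cases hy : y ∈ G.bf x N
  swap
  · rw [gr_of_notMem_left hy, zero_mul]
    exact mul_nonneg hK.le (Finset.sum_nonneg fun z _ =>
      mul_nonneg (gr_nonneg _ _ _) (mass_nonneg z))
  have hdN : G.graph.dist x y < N := mem_bf.1 hy
  have h1 := h x (G.graph.dist x y) (Nat.cast_pos.2 hd) (fun z => G.gr (G.bf x N) y z)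
    (fun z _ => gr_nonneg _ _ _) ?_
  · rwa [tsum_ball x _ fun z => G.gr (G.bf x N) y z * G.mass z, V_natCast, Nat.ceil_natCast,
      div_mul_eq_mul_div, le_div_iff₀ (Vn_pos hd)] at h1
  · intro z hz
    rw [ball_eq_coe_bf, Nat.ceil_natCast, Finset.mem_coe, mem_bf] at hz
    have hzN : z ∈ G.bf x N := by rw [mem_bf]; omega
    have hzy : z ≠ y := by rintro rfl; exact lt_irrefl _ hz
    have h2 := gr_eq_add (G := G) (y := y) hzN
    rw [L_apply_of_mem hzN, dl, if_neg fun h => hzy h.2, zero_div, zero_add] at h2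
    beta_reduce
    rw [gr_comm _ y z, h2, tsum_eq_sum (s := G.bf x N)]
    · exact Finset.sum_congr rfl fun w _ => by rw [gr_comm _ y w]
    · intro w hw
      rw [gr_of_notMem_right hw, mul_zero]

/-- Split the time sum at n. Beyond n, the kernel at time k + n is at most b times the survival
probability at time k. -/
theorem gr_le {a b : ℝ} (n : ℕ) (hy : y ∈ A) (ha : ∀ k < n, G.hk A k y x ≤ a)
    (hb : ∀ z ∈ A, G.hk A n z x ≤ b) : G.gr A y x ≤ n * a + b * G.ET A y := by
  have h1 : ∑ k ∈ Finset.range n, G.hk A k y x ≤ n * a := by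
    calc _ ≤ ∑ _k ∈ Finset.range n, a :=
          Finset.sum_le_sum fun k hk => ha k (Finset.mem_range.1 hk)
      _ = n * a := by simp
  have h2 : ∑' k, G.hk A (k + n) y x ≤ b * G.ET A y := by
    rw [ET, ← tsum_mul_left]
    refine Summable.tsum_le_tsum (fun k => ?_)
      ((summable_nat_add_iff n).2 (summable_hk A y x)) ((summable_surv A y).mul_left b)
    rw [hk_add, surv_eq_sum_hk hy, Finset.mul_sum]
    refine Finset.sum_le_sum fun z hz => ?_
    calc G.mass z * (G.hk A k y z * G.hk A n z x) ≤ G.mass z * (G.hk A k y z * b) :=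
          mul_le_mul_of_nonneg_left (mul_le_mul_of_nonneg_left (hb z hz) (hk_nonneg A k y z))
            (mass_nonneg z)
      _ = _ := by ring
  rw [gr, ← (summable_hk A y x).sum_add_tsum_nat_add n]
  exact add_le_add h1 h2

namespace Hyp

variable (h : G.Hyp p D C)
include h

/-- Over the whole of B(x,N), the integral of g(y,·) is the mean exit time from y, which is at most
C E(x,N). -/
theorem greenUpperBound_of_greenMeanValue (hG : G.GreenMeanValue) : G.GreenUpperBound := by
  obtain ⟨K, hK, hG⟩ := greenMeanValue_iff.1 hG
  refine greenUpperBound_iff.2 ⟨K * C, mul_pos hK h.C_pos, fun x N y hd => ?_⟩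
  by_cases hy : y ∈ G.bf x N
  swap
  · rw [gr_of_notMem_left hy, zero_mul]
    exact mul_nonneg (mul_pos hK h.C_pos).le (En_nonneg x N)
  have hdN : G.graph.dist x y < N := mem_bf.1 hy
  refine (hG x N y hd).trans ?_
  rw [mul_assoc]
  refine mul_le_mul_of_nonneg_left ?_ hK.le
  calc ∑ z ∈ G.bf x (G.graph.dist x y), G.gr (G.bf x N) y z * G.mass z
      ≤ ∑ z ∈ G.bf x N, G.gr (G.bf x N) y z * G.mass z :=
        Finset.sum_le_sum_of_subset_of_nonneg (bf_mono hdN.le) fun z _ _ =>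
          mul_nonneg (gr_nonneg _ _ _) (mass_nonneg z)
    _ = G.ET (G.bf x N) y := by
        rw [ET_eq_sum_gr hy]; exact Finset.sum_congr rfl fun z _ => mul_comm _ _
    _ ≤ C * G.En x N := h.ET_bf_le x y N

/-- Split the time at n ≈ E(x,N). Before n each kernel is at most const/V(x,d), since the
exponential absorbs the ratio of V(x,d) to V(x,e(x,k)); after n this ratio is bounded and survival
sums to the exit time. -/
theorem greenUpperBound_of_ue (hU : G.UpperEstimate) : G.GreenUpperBound := by
  obtain ⟨K, c, ε, hK, hc, hε, hU⟩ := upperEstimate_iff.1 hU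
  obtain ⟨Kg, γ, hKg, hV, -, -⟩ := h.exists_growth
  obtain ⟨Φ, hΦ, hexp⟩ := exists_pow_mul_exp_le hc hε zero_le_one γ
  have hKg0 : 0 < Kg := by linarith
  have hC0 := h.C_pos
  refine greenUpperBound_iff.2 ⟨2 * (Kg * K * Φ) + K * (Kg * 2 ^ γ) * C, by positivity,
    fun x N y hd => ?_⟩
  by_cases hy : y ∈ G.bf x N
  swap
  · rw [gr_of_notMem_left hy, zero_mul]
    exact mul_nonneg (by positivity) (En_nonneg x N)
  have hdN : G.graph.dist x y < N := mem_bf.1 hy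
  set d := G.graph.dist x y with hdd
  have hN : 0 < N := by omega
  have hE : 1 ≤ G.En x N := by
    have h1 : ((1 : ℕ) : ℝ) ≤ (N : ℝ) := Nat.cast_le.2 hN
    rw [Nat.cast_one] at h1
    exact h1.trans (le_En x N)
  have hVd := Vn_pos (G := G) (x := x) hd
  set n := ⌈G.En x N⌉₊ with hn
  have hnE : G.En x N ≤ n := Nat.le_ceil _
  have hn2 : (n : ℝ) ≤ 2 * G.En x N := by
    have := (Nat.ceil_lt_add_one (En_nonneg (G := G) x N)).le
    linarith
  have hn0 : 0 < n := by
    have : (0 : ℝ) < n := by linarith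
    exact_mod_cast this
  have hnr : (0 : ℝ) < n := Nat.cast_pos.2 hn0
  have ha : ∀ k < n, G.hk (G.bf x N) k y x ≤ Kg * K * Φ / G.Vn x d := by
    intro k _
    rw [le_div_iff₀ hVd]
    -- At time 0 the estimate (UE) says nothing, but the kernel vanishes because y ≠ x.
    rcases Nat.eq_zero_or_pos k with rfl | hk
    · have hxy : y ≠ x := by
        rintro rfl
        rw [SimpleGraph.dist_self] at hdd
        omega
      rw [hk, pow_zero, Module.End.one_apply, dl, if_neg fun h => hxy h.2, zero_div, zero_mul]
      positivity
    have hk0 : (0 : ℝ) < k := Nat.cast_pos.2 hk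
    have ht : 0 ≤ G.En x d / k := div_nonneg (En_nonneg x d) hk0.le
    have h1 := hU x y k hk
    have h2 := hexp _ ht
    rw [one_mul] at h2
    have h3 : Real.exp (-(c / 2) * (G.En x d / k) ^ ε) ≤ 1 := by
      rw [Real.exp_le_one_iff]
      have := Real.rpow_nonneg ht ε
      nlinarith
    calc G.hk (G.bf x N) k y x * G.Vn x d
        ≤ G.heatKernel k x y * (Kg * (1 + G.En x d / k) ^ γ * G.vt x k) := by
          refine mul_le_mul ?_ (hV x d k hk) hVd.le (heatKernel_nonneg _ _ _)
          rw [hk_comm]; exact hk_le_heatKernel _ _ _ _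
      _ = Kg * (1 + G.En x d / k) ^ γ * (G.heatKernel k x y * G.vt x k) := by ring
      _ ≤ Kg * (1 + G.En x d / k) ^ γ * (K * Real.exp (-c * (G.En x d / k) ^ ε)) :=
          mul_le_mul_of_nonneg_left h1 (by positivity)
      _ = Kg * K * ((1 + G.En x d / k) ^ γ * Real.exp (-c * (G.En x d / k) ^ ε)) := by ring
      _ ≤ Kg * K * (Φ * 1) := by
          refine mul_le_mul_of_nonneg_left (h2.trans ?_) (by positivity)
          exact mul_le_mul_of_nonneg_left h3 hΦ.le
      _ = _ := by ring
  have hb : ∀ z ∈ G.bf x N, G.hk (G.bf x N) n z x ≤ K * (Kg * 2 ^ γ) / G.Vn x d := by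
    intro z _
    rw [le_div_iff₀ hVd]
    have h1 := hU x z n hn0
    have h3 : Real.exp (-c * (G.En x (G.graph.dist x z) / n) ^ ε) ≤ 1 := by
      rw [Real.exp_le_one_iff]
      have := Real.rpow_nonneg (div_nonneg (En_nonneg (G := G) x (G.graph.dist x z)) hnr.le) ε
      nlinarith
    have h4 : G.Vn x d ≤ Kg * 2 ^ γ * G.vt x n := by
      refine (Vn_mono hdN.le).trans ((hV x N n hn0).trans ?_)
      refine mul_le_mul_of_nonneg_right (mul_le_mul_of_nonneg_left ?_ hKg0.le) (vt_pos hn0).le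
      refine pow_le_pow_left₀ (add_nonneg zero_le_one (div_nonneg (En_nonneg x N) hnr.le)) ?_ _
      have := (div_le_one hnr).2 hnE
      linarith
    calc G.hk (G.bf x N) n z x * G.Vn x d
        ≤ G.heatKernel n x z * (Kg * 2 ^ γ * G.vt x n) := by
          refine mul_le_mul ?_ h4 hVd.le (heatKernel_nonneg _ _ _)
          rw [hk_comm]; exact hk_le_heatKernel _ _ _ _
      _ = Kg * 2 ^ γ * (G.heatKernel n x z * G.vt x n) := by ring
      _ ≤ Kg * 2 ^ γ * (K * 1) := by
          refine mul_le_mul_of_nonneg_left (h1.trans ?_) (by positivity)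
          exact mul_le_mul_of_nonneg_left h3 hK.le
      _ = _ := by ring
  have h5 := gr_le n hy ha hb
  have h6 := h.ET_bf_le x y N
  calc G.gr (G.bf x N) y x * G.Vn x d
      ≤ (n * (Kg * K * Φ / G.Vn x d) + K * (Kg * 2 ^ γ) / G.Vn x d * G.ET (G.bf x N) y)
          * G.Vn x d := mul_le_mul_of_nonneg_right h5 hVd.le
    _ = n * (Kg * K * Φ) + K * (Kg * 2 ^ γ) * G.ET (G.bf x N) y := by field_simp
    _ ≤ (2 * G.En x N) * (Kg * K * Φ) + K * (Kg * 2 ^ γ) * (C * G.En x N) :=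
        add_le_add (mul_le_mul_of_nonneg_right hn2 (by positivity))
          (mul_le_mul_of_nonneg_left h6 (by positivity))
    _ = _ := by ring

end Hyp

end

noncomputable section

variable {Γ : Type*} {G : WeightedGraph Γ} [Countable Γ] [Infinite Γ] [MeasurableSpace Γ]
  [DiscreteMeasurableSpace Γ] [FiniteBalls G] {p D C : ℝ} {A B : Finset Γ} {x y z : Γ}

/-! ### Balayage -/

/-- A nonnegative superharmonic function on `B` has a swept out version: it is unchanged on `A`,
harmonic on `B \ A` and vanishes outside `B`. -/
theorem exists_balayage (hAB : A ⊆ B) {u : Γ → ℝ} (hu : ∀ z ∈ B, 0 ≤ u z)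
    (hL : ∀ z ∈ B, G.L B u z ≤ u z) : ∃ v : Γ → ℝ, (∀ z ∈ A, v z = u z) ∧
      (∀ z ∈ B, 0 ≤ v z ∧ v z ≤ u z) ∧ ∀ z ∈ B, z ∉ A → G.L B v z = v z := by
  -- The reward for stepping into A; its Green potential on B \ A solves the Dirichlet problem with
  -- values u on A and 0 outside B.
  set q : Γ → ℝ := fun z => ∑ y ∈ A, G.P z y * u y with hq
  set w := G.gop (B \ A) q with hw
  have hw1 : ∀ z ∈ B \ A, w z = q z + G.L (B \ A) w z := fun z hz => gop_eq_add q hz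
  have hq0 : ∀ z, 0 ≤ q z := fun z => Finset.sum_nonneg fun y hy =>
    mul_nonneg (G.P_nonneg z y) (hu y (hAB hy))
  have hw0 : ∀ z ∈ B \ A, 0 ≤ w z := fun z hz => gop_nonneg (fun y _ => hq0 y) hz
  have hwu : ∀ z ∈ B \ A, w z ≤ u z := by
    intro z hz
    have key := nonneg_of_L_le (G := G) (A := B \ A) (f := u - w) ?_ z hz
    · simpa using key
    intro z hz
    have hzB := (Finset.mem_sdiff.1 hz).1
    have h1 := hL z hzB
    have h2 := Finset.sum_sdiff (f := fun y => G.P z y * u y) hAB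
    have h3 := hw1 z hz
    rw [L_apply_of_mem hzB, ← h2] at h1
    rw [map_sub, Pi.sub_apply, Pi.sub_apply, L_apply_of_mem hz (f := u)]
    simp only [hq] at h3
    linarith
  refine ⟨fun z => if z ∈ A then u z else w z, fun z hz => if_pos hz, fun z hz => ?_,
    fun z hz hzA => ?_⟩
  · by_cases hzA : z ∈ A
    · simp only [if_pos hzA]; exact ⟨hu z hz, le_rfl⟩
    · have hz' : z ∈ B \ A := Finset.mem_sdiff.2 ⟨hz, hzA⟩
      simp only [if_neg hzA]; exact ⟨hw0 z hz', hwu z hz'⟩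
  · have hz' : z ∈ B \ A := Finset.mem_sdiff.2 ⟨hz, hzA⟩
    beta_reduce
    rw [if_neg hzA, hw1 z hz', L_apply_of_mem hz, L_apply_of_mem hz', ← Finset.sum_sdiff hAB,
      add_comm]
    refine congrArg₂ (· + ·) (Finset.sum_congr rfl fun y hy => ?_)
      (Finset.sum_congr rfl fun y hy => ?_)
    · rw [if_pos hy]
    · rw [if_neg (Finset.mem_sdiff.1 hy).2]

namespace Hyp

variable (h : G.Hyp p D C)
include h

/-- Sweep u onto B(x,ρ) with ρ = N/2, obtaining v ≤ u with v(x) = u(x). Its charge f = v - Lv lives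
at distance ρ - 1, so u(x) = ∑ g(x,z)f(z)μ(z) is at most K E(x,N)/V(x,ρ-1) times the total charge.
There E(x,N) is at most C times the exit time from z, and symmetry of the Green operator turns the
integral of f against the exit time into the integral of v. -/
theorem mul_Vn_le_of_superharmonic {K : ℝ} (hK : 0 < K)
    (hG : ∀ (x : Γ) (N : ℕ) (y : Γ), 0 < G.graph.dist x y →
      G.gr (G.bf x N) y x * G.Vn x (G.graph.dist x y) ≤ K * G.En x N)
    (x : Γ) {N : ℕ} (hN : 4 ≤ N) {u : Γ → ℝ} (hu : ∀ z ∈ G.bf x N, 0 ≤ u z)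
    (hL : ∀ z ∈ G.bf x N, G.L (G.bf x N) u z ≤ u z)
    (hLe : ∀ z ∈ G.bf x (N - 1), G.L (G.bf x N) u z = u z) :
    u x * G.Vn x N ≤ D ^ 3 * (K * C) * ∑ z ∈ G.bf x N, u z * G.mass z := by
  have hC0 := h.C_pos
  set ρ := N / 2 with hρ
  set B := G.bf x N with hB
  have hAB : G.bf x ρ ⊆ B := bf_mono (by omega)
  obtain ⟨v, hvA, hvB, hvL⟩ := exists_balayage hAB hu hL
  set f := v - G.L B v with hf
  have hf0 : ∀ z ∈ B, 0 ≤ f z := by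
    intro z hz
    simp only [hf, Pi.sub_apply, sub_nonneg]
    by_cases hzA : z ∈ G.bf x ρ
    · rw [hvA z hzA]
      exact (L_mono (fun y hy => (hvB y hy).2) z).trans (hL z hz)
    · exact (hvL z hz hzA).le
  -- Deeper inside, v equals u at z and at its neighbours, and u is harmonic; outside B(x,ρ), v is
  -- harmonic by construction.
  have hfs : ∀ z ∈ B, f z ≠ 0 → G.graph.dist x z + 1 = ρ := by
    intro z hz hfz
    by_contra hne
    refine hfz ?_
    simp only [hf, Pi.sub_apply, sub_eq_zero]
    by_cases hzA : z ∈ G.bf x ρ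
    · have hzA' := mem_bf.1 hzA
      rw [hvA z hzA, ← hLe z (by rw [mem_bf]; omega), L_apply_of_mem hz, L_apply_of_mem hz]
      refine Finset.sum_congr rfl fun y _ => ?_
      by_cases hadj : G.graph.Adj z y
      · have := dist_le_of_adj (G := G) (x := x) hadj
        rw [hvA y (by rw [mem_bf]; omega)]
      · rw [P_eq_zero hadj, zero_mul, zero_mul]
    · exact (hvL z hz hzA).symm
  have hxB : x ∈ B := mem_bf_self (by omega)
  have hxA : x ∈ G.bf x ρ := mem_bf_self (by omega)
  have hux : u x = ∑ z ∈ B, G.mass z * (G.gr B x z * f z) := by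
    rw [← hvA x hxA, ← gop_eq_sum_gr f hxB, hf, gop_sub_L v hxB]
  have hE0 := En_nonneg (G := G) x N
  have h1 : u x * G.Vn x (ρ - 1) ≤ K * ∑ z ∈ B, G.mass z * (G.En x N * f z) := by
    rw [hux, Finset.sum_mul, Finset.mul_sum]
    refine Finset.sum_le_sum fun z hz => ?_
    by_cases hfz : f z = 0
    · rw [hfz]; simp
    have hd := hfs z hz hfz
    have h2 := hG x N z (by omega)
    rw [show G.graph.dist x z = ρ - 1 by omega, gr_comm] at h2
    have h3 := mul_le_mul_of_nonneg_left h2 (mul_nonneg (mass_nonneg (G := G) z) (hf0 z hz))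
    calc _ = G.mass z * f z * (G.gr B x z * G.Vn x (ρ - 1)) := by ring
      _ ≤ _ := h3
      _ = _ := by ring
  have h2 : ∑ z ∈ B, G.mass z * (G.En x N * f z) ≤ C * G.ip B f (G.gop B (ind B)) := by
    rw [ip, Finset.mul_sum]
    refine Finset.sum_le_sum fun z hz => ?_
    by_cases hfz : f z = 0
    · rw [hfz]; simp
    have hd := hfs z hz hfz
    have h4 : G.En x N ≤ C * G.ET B z := by
      calc G.En x N ≤ G.En x (2 * (N - ρ)) := En_mono (by omega)
        _ ≤ C * G.En z (N - ρ) := h.tc x z _ (by omega)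
        _ ≤ C * G.ET B z := mul_le_mul_of_nonneg_left
            (ET_mono (bf_subset_bf (by omega)) z) hC0.le
    rw [ET_eq_gop] at h4
    have h3 := mul_le_mul_of_nonneg_left h4 (mul_nonneg (mass_nonneg (G := G) z) (hf0 z hz))
    calc _ = G.mass z * f z * G.En x N := by ring
      _ ≤ _ := h3
      _ = _ := by ring
  have h3 : G.ip B f (G.gop B (ind B)) ≤ ∑ z ∈ B, u z * G.mass z := by
    rw [← ip_gop, ip]
    refine Finset.sum_le_sum fun z hz => ?_
    rw [hf, gop_sub_L v hz, ind_of_mem hz, mul_one, mul_comm]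
    exact mul_le_mul_of_nonneg_right (hvB z hz).2 (mass_nonneg z)
  -- For N ≥ 4 one has ρ ≥ 2 and N ≤ 8(ρ - 1).
  have h4 : G.Vn x N ≤ D ^ 3 * G.Vn x (ρ - 1) :=
    (Vn_mono (by omega)).trans (h.Vn_pow_two_mul_le x 3 (ρ - 1))
  have hD0 := h.D_pos
  calc u x * G.Vn x N ≤ u x * (D ^ 3 * G.Vn x (ρ - 1)) :=
        mul_le_mul_of_nonneg_left h4 (hu x hxB)
    _ = D ^ 3 * (u x * G.Vn x (ρ - 1)) := by ring
    _ ≤ D ^ 3 * (K * (C * ∑ z ∈ B, u z * G.mass z)) := by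
        refine mul_le_mul_of_nonneg_left (h1.trans ?_) (by positivity)
        exact mul_le_mul_of_nonneg_left (h2.trans (mul_le_mul_of_nonneg_left h3 hC0.le)) hK.le
    _ = _ := by ring

theorem meanValue_of_greenUpperBound (hG : G.GreenUpperBound) : G.MeanValue := by
  obtain ⟨K, hK, hG⟩ := greenUpperBound_iff.1 hG
  have hC0 := h.C_pos
  have hD0 := h.D_pos
  refine ⟨D ^ 2 + D ^ 3 * (K * C), by positivity, fun x R hR u hu hharm => ?_⟩
  rw [tsum_ball x R fun z => u z * G.mass z, V_eq_Vn]
  simp only [ball_eq_coe_bf] at hu hharm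
  set N := ⌈R⌉₊ with hN
  have hN0 : 0 < N := Nat.ceil_pos.2 hR
  have hu0 : ∀ z ∈ G.bf x N, 0 ≤ u z := fun z hz => hu z (Or.inl hz)
  have hsum0 : 0 ≤ ∑ z ∈ G.bf x N, u z * G.mass z := Finset.sum_nonneg fun z hz =>
    mul_nonneg (hu0 z hz) (mass_nonneg z)
  rw [div_mul_eq_mul_div, le_div_iff₀ (Vn_pos hN0)]
  have hxB : x ∈ G.bf x N := mem_bf_self hN0
  rcases Nat.lt_or_ge N 4 with h4 | h4
  · have h1 : G.Vn x N ≤ D ^ 2 * G.mass x := by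
      rw [← Vn_one]
      exact (Vn_mono (by omega)).trans (h.Vn_pow_two_mul_le x 2 1)
    calc u x * G.Vn x N ≤ u x * (D ^ 2 * G.mass x) := mul_le_mul_of_nonneg_left h1 (hu0 x hxB)
      _ = D ^ 2 * (u x * G.mass x) := by ring
      _ ≤ D ^ 2 * ∑ z ∈ G.bf x N, u z * G.mass z := by
          refine mul_le_mul_of_nonneg_left ?_ (by positivity)
          exact Finset.single_le_sum (f := fun z => u z * G.mass z)
            (fun z hz => mul_nonneg (hu0 z hz) (mass_nonneg z)) hxB
      _ ≤ _ := mul_le_mul_of_nonneg_right (le_add_of_nonneg_right (by positivity)) hsum0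
  · have hsupp : ∀ M : ℕ, ∀ z ∈ G.bf x M, ∀ y ∉ G.bf x (M + 1), G.P z y * u y = 0 := by
      intro M z hz y hy
      rw [P_eq_zero fun hadj => hy ?_, zero_mul]
      have := dist_le_of_adj (G := G) (x := x) hadj
      rw [mem_bf] at hz ⊢
      omega
    refine (h.mul_Vn_le_of_superharmonic hK hG x h4 hu0 (fun z hz => ?_) fun z hz => ?_).trans
      (mul_le_mul_of_nonneg_right (le_add_of_nonneg_left (by positivity)) hsum0)
    -- On the outer layer the killed operator drops the nonnegative values outside the ball, so u is
    -- only superharmonic there; equality holds on B(x,N-1).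
    · rw [← hharm z hz, L_apply_of_mem hz, tsum_eq_sum fun y hy => hsupp N z hz y hy]
      refine Finset.sum_le_sum_of_subset_of_nonneg (bf_mono N.le_succ) fun y _ _ => ?_
      by_cases hadj : G.graph.Adj z y
      · exact mul_nonneg (G.P_nonneg z y) (hu y (Or.inr ⟨z, hz, hadj⟩))
      · rw [P_eq_zero hadj, zero_mul]
    · have hz' : z ∈ G.bf x N := bf_mono (by omega) hz
      have h1 := hsupp (N - 1) z hz
      rw [Nat.sub_add_cancel hN0] at h1
      rw [← hharm z hz', L_apply_of_mem hz', tsum_eq_sum h1]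

end Hyp

/-! ### The Faber-Krahn inequality from Green kernel bounds -/

/-- The difference of the two Green kernels has no pole and is harmonic in the small ball. By the
minimum principle it is bounded by the large kernel at points outside the small ball, where the
Green bound applies. -/
theorem gr_four_mul_le {K : ℝ} (hK : 0 < K)
    (hG : ∀ (x : Γ) (N : ℕ) (y : Γ), 0 < G.graph.dist x y →
      G.gr (G.bf x N) y x * G.Vn x (G.graph.dist x y) ≤ K * G.En x N)
    (x : Γ) {r : ℕ} (hr : 0 < r) (w : Γ) :
    G.gr (G.bf x (4 * r)) w x ≤ G.gr (G.bf x r) w x + K * G.En x (4 * r) / G.Vn x r := by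
  set M := K * G.En x (4 * r) / G.Vn x r with hM
  have hV := Vn_pos (G := G) (x := x) hr
  have hfar : ∀ w, w ∉ G.bf x r → G.gr (G.bf x (4 * r)) w x ≤ M := by
    intro w hw
    rw [mem_bf, not_lt] at hw
    rw [hM, le_div_iff₀ hV]
    exact (mul_le_mul_of_nonneg_left (Vn_mono hw) (gr_nonneg _ _ _)).trans
      (hG x (4 * r) w (by omega))
  by_cases hw : w ∈ G.bf x r
  swap
  · rw [gr_of_notMem_left hw, zero_add]; exact hfar w hw
  have hAB : G.bf x r ⊆ G.bf x (4 * r) := bf_mono (by omega)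
  have key := nonneg_of_L_le (G := G) (A := G.bf x r)
    (f := fun z => M - (G.gr (G.bf x (4 * r)) z x - G.gr (G.bf x r) z x)) ?_ w hw
  · linarith
  intro z hz
  have hz' := hAB hz
  have h1 := gr_eq_add (G := G) (y := x) hz
  have h2 := gr_eq_add (G := G) (y := x) hz'
  have h3 : dl (G.bf x (4 * r)) x z = dl (G.bf x r) x z := by
    simp only [dl, hz, hz', true_and]
  rw [h3, L_apply_of_mem hz', ← Finset.sum_sdiff hAB] at h2
  rw [L_apply_of_mem hz] at h1 ⊢
  have h4 : ∑ y ∈ G.bf x (4 * r) \ G.bf x r, G.P z y * G.gr (G.bf x (4 * r)) y x ≤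
      ∑ y ∈ G.bf x (4 * r) \ G.bf x r, G.P z y * M :=
    Finset.sum_le_sum fun y hy =>
      mul_le_mul_of_nonneg_left (hfar y (Finset.mem_sdiff.1 hy).2) (G.P_nonneg z y)
  have h5 := Finset.sum_sdiff (f := G.P z) hAB
  have h6 := P_sum_le_one (G := G) (G.bf x (4 * r)) z
  have hM0 : 0 ≤ M := div_nonneg (mul_nonneg hK.le (En_nonneg x _)) hV.le
  rw [← Finset.sum_mul] at h4
  simp only [mul_sub, Finset.sum_sub_distrib, ← Finset.sum_mul]
  nlinarith

namespace Hyp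

variable (h : G.Hyp p D C)
include h

theorem gr_pow_four_mul_le {K : ℝ} (hK : 0 < K)
    (hG : ∀ (x : Γ) (N : ℕ) (y : Γ), 0 < G.graph.dist x y →
      G.gr (G.bf x N) y x * G.Vn x (G.graph.dist x y) ≤ K * G.En x N)
    (x : Γ) {s : ℕ} (hs : 0 < s) (q : ℕ) (w : Γ) :
    G.gr (G.bf x (4 ^ q * s)) w x ≤ G.gr (G.bf x s) w x +
      q * (K * (D ^ 2) ^ q * G.En x (4 ^ q * s) / G.Vn x (4 ^ q * s)) := by
  have hD1 : 1 ≤ D ^ 2 := one_le_pow₀ h.one_le_D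
  have key : ∀ j ≤ q, G.gr (G.bf x (4 ^ j * s)) w x ≤ G.gr (G.bf x s) w x +
      j * (K * (D ^ 2) ^ q * G.En x (4 ^ q * s) / G.Vn x (4 ^ q * s)) := by
    intro j
    induction j with
    | zero => simp
    | succ j ih =>
      intro hj
      have hsj : 0 < 4 ^ j * s := by positivity
      have hV := Vn_pos (G := G) (x := x) hsj
      have hVq := Vn_pos (G := G) (x := x) (show 0 < 4 ^ q * s by positivity)
      have h1 := gr_four_mul_le hK hG x hsj w
      have h2 : G.Vn x (4 ^ q * s) ≤ (D ^ 2) ^ q * G.Vn x (4 ^ j * s) := by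
        calc G.Vn x (4 ^ q * s) = G.Vn x (4 ^ (q - j) * (4 ^ j * s)) := by
              rw [← mul_assoc, ← pow_add, Nat.sub_add_cancel (by omega)]
          _ ≤ (D ^ 2) ^ (q - j) * G.Vn x (4 ^ j * s) := h.Vn_pow_four_mul_le x _ _
          _ ≤ _ := mul_le_mul_of_nonneg_right (pow_le_pow_right₀ hD1 (by omega)) hV.le
      have h3 : G.En x (4 * (4 ^ j * s)) ≤ G.En x (4 ^ q * s) := by
        refine En_mono ?_
        rw [← mul_assoc, ← pow_succ']
        exact Nat.mul_le_mul_right s (Nat.pow_le_pow_right (by norm_num) hj)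
      have h4 : K * G.En x (4 * (4 ^ j * s)) / G.Vn x (4 ^ j * s) ≤
          K * (D ^ 2) ^ q * G.En x (4 ^ q * s) / G.Vn x (4 ^ q * s) := by
        rw [div_le_div_iff₀ hV hVq]
        calc K * G.En x (4 * (4 ^ j * s)) * G.Vn x (4 ^ q * s)
            ≤ K * G.En x (4 ^ q * s) * ((D ^ 2) ^ q * G.Vn x (4 ^ j * s)) :=
              mul_le_mul (mul_le_mul_of_nonneg_left h3 hK.le) h2 hVq.le
                (mul_nonneg hK.le (En_nonneg x _))
          _ = _ := by ring
      rw [pow_succ', mul_assoc]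
      push_cast
      linarith [ih (by omega)]
  exact key q le_rfl

/-- Integrate the Green kernel over A ∩ B(y,4^q s). Its part from B(y,s) contributes at most E(y,s);
the rest is uniformly of order E/V, and A has volume at most εV. -/
theorem ET_inter_le {K : ℝ} (hK : 0 < K)
    (hG : ∀ (x : Γ) (N : ℕ) (y : Γ), 0 < G.graph.dist x y →
      G.gr (G.bf x N) y x * G.Vn x (G.graph.dist x y) ≤ K * G.En x N)
    {s : ℕ} (hs : 0 < s) (q : ℕ) {ε : ℝ} (hy : y ∈ A)
    (hA : G.vol A ≤ ε * G.Vn y (4 ^ q * s)) :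
    G.ET (A ∩ G.bf y (4 ^ q * s)) y ≤
      G.En y s + ε * (q * (K * (D ^ 2) ^ q)) * G.En y (4 ^ q * s) := by
  set N := 4 ^ q * s with hN
  set T := (q : ℝ) * (K * (D ^ 2) ^ q * G.En y N / G.Vn y N) with hT
  have hV := Vn_pos (G := G) (x := y) (show 0 < N by positivity)
  have hT0 : 0 ≤ T := by have := En_nonneg (G := G) y N; have := h.D_pos; positivity
  have hyN : y ∈ A ∩ G.bf y N := Finset.mem_inter.2 ⟨hy, mem_bf_self (by positivity)⟩
  have hsN : G.bf y s ⊆ G.bf y N := bf_mono (Nat.le_mul_of_pos_left s (by positivity))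
  have h1 : ∑ w ∈ A ∩ G.bf y N, G.mass w * G.gr (G.bf y s) w y ≤ G.En y s := by
    rw [En, ET_eq_sum_gr (mem_bf_self hs)]
    calc _ ≤ ∑ w ∈ G.bf y N, G.mass w * G.gr (G.bf y s) w y :=
          Finset.sum_le_sum_of_subset_of_nonneg Finset.inter_subset_right fun w _ _ =>
            mul_nonneg (mass_nonneg w) (gr_nonneg _ _ _)
      _ = ∑ w ∈ G.bf y s, G.mass w * G.gr (G.bf y s) w y :=
          (Finset.sum_subset hsN fun w _ hw => by rw [gr_of_notMem_left hw, mul_zero]).symm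
      _ = _ := Finset.sum_congr rfl fun w _ => by rw [gr_comm]
  calc G.ET (A ∩ G.bf y N) y = ∑ w ∈ A ∩ G.bf y N, G.mass w * G.gr (A ∩ G.bf y N) y w :=
        ET_eq_sum_gr hyN
    _ ≤ ∑ w ∈ A ∩ G.bf y N, (G.mass w * G.gr (G.bf y s) w y + G.mass w * T) := by
        refine Finset.sum_le_sum fun w _ => ?_
        rw [← mul_add, gr_comm]
        exact mul_le_mul_of_nonneg_left ((gr_mono Finset.inter_subset_right w y).trans
          (h.gr_pow_four_mul_le hK hG y hs q w)) (mass_nonneg w)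
    _ ≤ G.En y s + G.vol A * T := by
        rw [Finset.sum_add_distrib, ← Finset.sum_mul]
        exact add_le_add h1 (mul_le_mul_of_nonneg_right
          (vol_mono Finset.inter_subset_left) hT0)
    _ ≤ G.En y s + ε * G.Vn y N * T :=
        add_le_add le_rfl (mul_le_mul_of_nonneg_right hA hT0)
    _ = _ := by rw [hT]; field_simp

/-- For each y in A choose a ball B(y,N) rarely left before time n, with E(y,N) still of order n.
The mean exit time from A ∩ B(y,N) is at most n/4, so survival in A up to time n has probability at
most 1/4 + 1/4. -/
theorem faberKrahn_of_greenUpperBound (hG : G.GreenUpperBound) : G.FaberKrahn := by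
  obtain ⟨K, hK, hG⟩ := greenUpperBound_iff.1 hG
  obtain ⟨Λ, hΛ, hexit⟩ := h.exists_exit_le (η := 1 / 4) (by norm_num)
  obtain ⟨Q, γ, hQ, -, -, hvt⟩ := h.exists_growth
  have hC := h.two_le_C
  have hC0 := h.C_pos
  have hD0 := h.D_pos
  have hQ0 : 0 < Q := by linarith
  have hΛ0 : (0 : ℝ) < Λ := Nat.cast_pos.2 hΛ
  have hΛ1 : (1 : ℝ) ≤ Λ := by exact_mod_cast hΛ
  -- Enough scales of growth so that E(y,4^q s) ≤ CΛn forces E(y,s) ≤ n/8.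
  obtain ⟨q, hq⟩ := pow_unbounded_of_one_lt (8 * (C * Λ)) h.one_lt_ratio
  set a := (q : ℝ) * (K * (D ^ 2) ^ q) with ha
  have ha0 : 0 ≤ a := by positivity
  set b := Q * (1 + (C ^ 2) ^ q) ^ γ with hb
  have hb0 : 0 < b := by positivity
  -- The first entry makes the contribution of A outside B(y,s) at most n/8; the second rules out
  -- the case where even s = 1 gives too large an exit time.
  set ε := min (1 / (8 * (C * Λ) * (a + 1))) (1 / (2 * b)) with hε
  have hε0 : 0 < ε := lt_min (by positivity) (by positivity)
  refine ⟨ε, 1 / 4, hε0, by norm_num, fun n A hn hA f _ => ?_⟩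
  obtain ⟨i, hi1, hi2⟩ := exists_pow_two n hn
  refine ip_L_L_le_of_half hn hi2 f (ip_L_pow_le _ (fun y hy => ?_) f)
  refine (surv_antitone A y (show n ≤ 2 ^ i * 2 by omega)).trans ?_
  have hn0 : (0 : ℝ) < n := Nat.cast_pos.2 hn
  have hn1 : (1 : ℝ) ≤ n := by exact_mod_cast hn
  have hex : ∃ s, 0 < s ∧ (Λ * n : ℝ) ≤ G.En y (4 ^ q * s) := by
    refine ⟨Λ * n, by positivity, ?_⟩
    rw [← Nat.cast_mul]
    exact (le_En y (Λ * n)).trans (En_mono (Nat.le_mul_of_pos_left _ (by positivity)))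
  set s := Nat.find hex with hs
  obtain ⟨hs0, hsE⟩ := Nat.find_spec hex
  rw [← hs] at hs0 hsE
  set N := 4 ^ q * s with hN
  have hup : G.En y N ≤ C * (Λ * n) := by
    rcases Nat.lt_or_ge 1 s with hs1 | hs1
    · have h1 := Nat.find_min hex (m := s - 1) (by omega)
      have h2 : G.En y (4 ^ q * (s - 1)) < Λ * n := by
        by_contra h3
        exact h1 ⟨by omega, not_lt.1 h3⟩
      calc G.En y N ≤ G.En y (2 * (4 ^ q * (s - 1))) := by
            refine En_mono ?_
            rw [hN, mul_left_comm]
            exact Nat.mul_le_mul_left _ (by omega)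
        _ ≤ C * G.En y (4 ^ q * (s - 1)) := h.En_two_mul_le y _
        _ ≤ _ := mul_le_mul_of_nonneg_left h2.le hC0.le
    -- Minimality of s says nothing here. If E(y,4^q) were too large, n would be bounded, the volume
    -- at scale n comparable to μ(y), and A could not even contain y.
    · have hs1 : s = 1 := by omega
      by_contra h3
      rw [not_le] at h3
      have h4 := h.En_pow_four_mul_le y q s
      rw [show G.En y s = 1 by rw [hs1, En_one], mul_one] at h4
      have h5 : (n : ℝ) ≤ (C ^ 2) ^ q := by
        have : (n : ℝ) ≤ C * (Λ * n) := (le_mul_of_one_le_left hn0.le hΛ1).trans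
          (le_mul_of_one_le_left (by positivity) (by linarith))
        linarith
      have h6 := hvt y n 1 one_pos hn
      rw [vt_one, Nat.cast_one, div_one] at h6
      have h7 : G.vt y n ≤ b * G.mass y := by
        refine h6.trans (mul_le_mul_of_nonneg_right ?_ (mass_nonneg y))
        exact mul_le_mul_of_nonneg_left (pow_le_pow_left₀ (by positivity) (by linarith) _) hQ0.le
      have h8 : G.mass y ≤ ε * (b * G.mass y) :=
        (mass_le_vol hy).trans ((hA y hy).trans (mul_le_mul_of_nonneg_left h7 hε0.le))
      have h9 : ε * b ≤ 1 / 2 := by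
        calc ε * b ≤ 1 / (2 * b) * b := mul_le_mul_of_nonneg_right (min_le_right _ _) hb0.le
          _ = 1 / 2 := by field_simp
      have h10 := G.mass_pos y
      nlinarith
  have hAN : G.vol A ≤ ε * G.Vn y N := by
    refine (hA y hy).trans (mul_le_mul_of_nonneg_left (Vn_mono (en_le ?_)) hε0.le)
    nlinarith
  have hE := h.ET_inter_le hK hG hs0 q hy hAN
  have hE0 := En_nonneg (G := G) y s
  have hEN := En_nonneg (G := G) y N
  have h1 : G.En y s ≤ n / 8 := by
    have h2 := h.le_En_pow_four_mul y q s
    have h3 : 8 * (C * Λ) * G.En y s ≤ C * (Λ * n) :=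
      (mul_le_mul_of_nonneg_right hq.le hE0).trans (h2.trans hup)
    have h4 : (C * Λ) * (8 * G.En y s) ≤ (C * Λ) * n := by linarith
    have := le_of_mul_le_mul_left h4 (by positivity)
    linarith
  have h2 : ε * a * G.En y N ≤ n / 8 := by
    have h3 : ε * a ≤ 1 / (8 * (C * Λ)) := by
      calc ε * a ≤ 1 / (8 * (C * Λ) * (a + 1)) * (a + 1) :=
            mul_le_mul (min_le_left _ _) (by linarith) ha0 (by positivity)
        _ = _ := by field_simp
    calc ε * a * G.En y N ≤ 1 / (8 * (C * Λ)) * (C * (Λ * n)) :=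
          mul_le_mul h3 hup hEN (by positivity)
      _ = n / 8 := by field_simp
  have h3 : G.surv (A ∩ G.bf y N) n y ≤ 1 / 4 := by
    have h4 := mul_surv_le_ET (G := G) (A := A ∩ G.bf y N) n y
    have h5 : (n : ℝ) * G.surv (A ∩ G.bf y N) n y ≤ n * (1 / 4) := by linarith
    exact le_of_mul_le_mul_left h5 hn0
  have h4 := surv_le_surv_inter_add (G := G) A (G.bf y N) n y
  have h5 := hexit y N n hn hsE
  linarith

end Hyp

end

noncomputable section

variable {Γ : Type*} {G : WeightedGraph Γ} [Countable Γ] [Infinite Γ] [MeasurableSpace Γ]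
  [DiscreteMeasurableSpace Γ] [FiniteBalls G] {p D C : ℝ} {A B : Finset Γ} {x y z : Γ}

/-! ### The parabolic mean value inequality -/

theorem tsum_killedP_mul (hz : z ∈ A) (u : Γ → ℝ) :
    ∑' y, G.killedP A z y * u y = G.L A u z := by
  rw [L_apply_of_mem hz, tsum_eq_sum (s := A)]
  · refine Finset.sum_congr rfl fun y hy => ?_
    rw [killedP, if_pos ⟨hz, hy⟩]
  · intro y hy
    rw [killedP, if_neg fun h => hy h.2, zero_mul]

/-- A Dirichlet solution is the orbit of its initial value, so the families u reduce to iterates of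
a single f ≥ 0. -/
theorem parabolicMeanValue_iff {c₁ c₂ : ℝ} : G.ParabolicMeanValue c₁ c₂ ↔
    ∃ K : ℝ, 0 < K ∧ ∀ (x : Γ) (N : ℕ), 0 < N → ∀ f : Γ → ℝ, (∀ z ∈ G.bf x N, 0 ≤ f z) →
      (G.L (G.bf x N) ^ ⌊c₂ * G.En x N⌋₊) f x * (G.Vn x N * G.En x N) ≤
        K * ∑ i ∈ Finset.Icc ⌊c₁ * G.En x N⌋₊ ⌊c₂ * G.En x N⌋₊,
          ∑ y ∈ G.bf x N, (G.L (G.bf x N) ^ i) f y * G.mass y := by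
  constructor
  · rintro ⟨K, hK, h⟩
    refine ⟨K, by linarith, fun x N hN f hf => ?_⟩
    have h1 := h x N (Nat.cast_pos.2 hN) (fun i => (G.L (G.bf x N) ^ i) f) ?_
    · have hball := fun i => tsum_ball (G := G) x N fun y => (G.L (G.bf x N) ^ i) f y * G.mass y
      simp only [hball, V_natCast, E_natCast, Nat.ceil_natCast] at h1
      rwa [div_mul_eq_mul_div, le_div_iff₀ (mul_pos (Vn_pos hN) (En_pos hN))] at h1
    · rw [ball_eq_coe_bf, Nat.ceil_natCast]
      refine ⟨fun i _ z hz => L_pow_nonneg hf i hz, fun i _ z hz => ?_⟩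
      beta_reduce
      rw [tsum_killedP_mul hz, L_pow_succ]
  · rintro ⟨K, hK, h⟩
    refine ⟨K + 1, by linarith, fun x R hR u hu => ?_⟩
    have hball := fun i => tsum_ball (G := G) x R fun y => u i y * G.mass y
    simp only [hball, V_eq_Vn, E_eq_En]
    rw [ball_eq_coe_bf, E_eq_En] at hu
    set N := ⌈R⌉₊ with hN
    have hN0 : 0 < N := Nat.ceil_pos.2 hR
    obtain ⟨hu0, hu1⟩ := hu
    set n := ⌊c₂ * G.En x N⌋₊ with hn
    have key : ∀ i ≤ n, ∀ z ∈ G.bf x N, u i z = (G.L (G.bf x N) ^ i) (u 0) z := by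
      intro i
      induction i with
      | zero => intro _ z _; simp
      | succ i ih =>
        intro hi z hz
        rw [hu1 i (by omega) z hz, tsum_killedP_mul hz, L_pow_succ, L_apply_of_mem hz,
          L_apply_of_mem hz]
        exact Finset.sum_congr rfl fun y hy => by rw [ih (by omega) y hy]
    have h1 := h x N hN0 (u 0) (hu0 0 (Nat.zero_le _))
    rw [div_mul_eq_mul_div, le_div_iff₀ (mul_pos (Vn_pos hN0) (En_pos hN0)),
      key n le_rfl x (mem_bf_self hN0)]
    refine h1.trans ?_
    have h2 : ∑ i ∈ Finset.Icc ⌊c₁ * G.En x N⌋₊ n,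
          ∑ y ∈ G.bf x N, (G.L (G.bf x N) ^ i) (u 0) y * G.mass y =
        ∑ i ∈ Finset.Icc ⌊c₁ * G.En x N⌋₊ n, ∑ y ∈ G.bf x N, u i y * G.mass y :=
      Finset.sum_congr rfl fun i hi => Finset.sum_congr rfl fun y hy => by
        rw [key i (Finset.mem_Icc.1 hi).2 y hy]
    rw [h2]
    refine mul_le_mul_of_nonneg_right (by linarith) ?_
    exact Finset.sum_nonneg fun i hi => Finset.sum_nonneg fun y hy =>
      mul_nonneg (hu0 i (Finset.mem_Icc.1 hi).2 y hy) (mass_nonneg y)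

theorem L_pow_mul_le_sum {N i k : ℕ} {v K : ℝ} {f : Γ → ℝ} (hx : x ∈ A)
    (hf : ∀ z ∈ A, 0 ≤ f z) (hv : 0 ≤ v) (hK : ∀ y, G.heatKernel k x y * v ≤ K) (hN : i + k = N) :
    (G.L A ^ N) f x * v ≤ K * ∑ y ∈ A, (G.L A ^ i) f y * G.mass y := by
  rw [← hN, add_comm, L_pow_add, L_pow_eq_sum_hk k _ hx, Finset.sum_mul, Finset.mul_sum]
  refine Finset.sum_le_sum fun y hy => ?_
  have h1 : G.hk A k x y * v ≤ K :=
    (mul_le_mul_of_nonneg_right (hk_le_heatKernel A k x y) hv).trans (hK y)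
  have h2 := mul_le_mul_of_nonneg_left h1
    (mul_nonneg (L_pow_nonneg (G := G) hf i hy) (mass_nonneg (G := G) y))
  calc _ = (G.L A ^ i) f y * G.mass y * (G.hk A k x y * v) := by ring
    _ ≤ _ := h2
    _ = _ := by ring

namespace Hyp

variable (h : G.Hyp p D C)
include h

/-- For times i in the first half of the window, the remaining time n - i is comparable to E, so the
kernel from i to n is at most const/V(x,N). Averaging over these i gives the factor 1/E. -/
theorem parabolicMeanValue_of_ue {c₁ c₂ : ℝ} (hc₁ : 0 ≤ c₁) (hc : c₁ < c₂)
    (hU : G.UpperEstimate) : G.ParabolicMeanValue c₁ c₂ := by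
  obtain ⟨K, c, ε, hK, hc0, hε, hU⟩ := upperEstimate_iff.1 hU
  obtain ⟨Q, γ, hQ, hV, -, -⟩ := h.exists_growth
  have hQ0 : 0 < Q := by linarith
  set δ := c₂ - c₁ with hδ
  have hδ0 : 0 < δ := sub_pos.2 hc
  set b := Q * (1 + 4 / δ) ^ γ with hb
  have hb0 : 0 < b := by positivity
  have hU1 : ∀ (x y : Γ) (k : ℕ), 0 < k → G.heatKernel k x y * G.vt x k ≤ K := by
    intro x y k hk
    refine (hU x y k hk).trans (mul_le_of_le_one_right hK.le ?_)
    rw [Real.exp_le_one_iff]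
    have := Real.rpow_nonneg
      (div_nonneg (En_nonneg (G := G) x (G.graph.dist x y)) (Nat.cast_nonneg k)) ε
    nlinarith
  refine parabolicMeanValue_iff.2 ⟨4 / δ * ((K + 1) * b), by positivity, fun x N hN f hf => ?_⟩
  set E := G.En x N with hE
  have hE0 : 0 < E := En_pos hN
  set m := ⌊c₁ * E⌋₊ with hm
  set n := ⌊c₂ * E⌋₊ with hn
  set S : ℕ → ℝ := fun i => ∑ y ∈ G.bf x N, (G.L (G.bf x N) ^ i) f y * G.mass y with hS
  have hS0 : ∀ i, 0 ≤ S i := fun i => Finset.sum_nonneg fun y hy =>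
    mul_nonneg (L_pow_nonneg hf i hy) (mass_nonneg y)
  have hmn : m ≤ n := Nat.floor_mono (mul_le_mul_of_nonneg_right hc.le hE0.le)
  have hxB : x ∈ G.bf x N := mem_bf_self hN
  have hV0 := Vn_pos (G := G) (x := x) hN
  have hLn := L_pow_nonneg (G := G) hf n hxB
  -- A short window may leave no time to evolve. Then E is bounded, V(x,N) is comparable to μ(x),
  -- and the single term at y = x and time n suffices.
  rcases lt_or_ge (δ * E) 4 with hsmall | hbig
  · have hE4 : E ≤ 4 / δ := by rw [le_div_iff₀ hδ0]; linarith
    have h1 : G.Vn x N ≤ b * G.mass x := by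
      have h2 := hV x N 1 one_pos
      rw [vt_one, Nat.cast_one, div_one] at h2
      refine h2.trans (mul_le_mul_of_nonneg_right ?_ (mass_nonneg x))
      exact mul_le_mul_of_nonneg_left (pow_le_pow_left₀ (by positivity) (by linarith) _) hQ0.le
    have h2 : (G.L (G.bf x N) ^ n) f x * G.mass x ≤ ∑ i ∈ Finset.Icc m n, S i := by
      refine le_trans ?_ (Finset.single_le_sum (f := S) (fun i _ => hS0 i)
        (Finset.mem_Icc.2 ⟨hmn, le_rfl⟩))
      exact Finset.single_le_sum (f := fun y => (G.L (G.bf x N) ^ n) f y * G.mass y)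
        (fun y hy => mul_nonneg (L_pow_nonneg hf n hy) (mass_nonneg y)) hxB
    calc (G.L (G.bf x N) ^ n) f x * (G.Vn x N * E)
        ≤ (G.L (G.bf x N) ^ n) f x * (b * G.mass x * (4 / δ)) :=
          mul_le_mul_of_nonneg_left (mul_le_mul h1 hE4 hE0.le
            (mul_nonneg hb0.le (mass_nonneg x))) hLn
      _ = 4 / δ * b * ((G.L (G.bf x N) ^ n) f x * G.mass x) := by ring
      _ ≤ 4 / δ * b * ∑ i ∈ Finset.Icc m n, S i :=
          mul_le_mul_of_nonneg_left h2 (by positivity)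
      _ ≤ _ := by
          refine mul_le_mul_of_nonneg_right ?_ (Finset.sum_nonneg fun i _ => hS0 i)
          refine mul_le_mul_of_nonneg_left ?_ (by positivity)
          exact le_mul_of_one_le_left hb0.le (by linarith)
  · have hm1 : (m : ℝ) ≤ c₁ * E := Nat.floor_le (by positivity)
    have hn1 : c₂ * E < n + 1 := Nat.lt_floor_add_one _
    set s := (n - m) / 2 with hs
    have hs1 : n - m ≤ 2 * s + 1 := by omega
    have hs2 : (n : ℝ) - m ≤ 2 * s + 1 := by
      rw [← Nat.cast_sub hmn]; exact_mod_cast hs1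
    have hsE : δ * E / 4 ≤ s + 1 := by rw [hδ] at hbig ⊢; linarith
    have h1 : ∀ i ∈ Finset.Icc m (m + s), (G.L (G.bf x N) ^ n) f x * G.Vn x N ≤ K * b * S i := by
      intro i hi
      obtain ⟨hi1, hi2⟩ := Finset.mem_Icc.1 hi
      have hin : i ≤ n := by omega
      have hk : δ * E / 4 ≤ ((n - i : ℕ) : ℝ) := by
        have h3 : n - m ≤ 2 * (n - i) := by omega
        have h4 : (n : ℝ) - m ≤ 2 * ((n - i : ℕ) : ℝ) := by
          rw [← Nat.cast_sub hmn]; exact_mod_cast h3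
        rw [hδ] at hbig ⊢; linarith
      have hk0' : (0 : ℝ) < ((n - i : ℕ) : ℝ) := by linarith
      have hk0 : 0 < n - i := by exact_mod_cast hk0'
      refine L_pow_mul_le_sum hxB hf hV0.le (fun y => ?_) (Nat.add_sub_cancel' hin)
      have h2 : G.Vn x N ≤ b * G.vt x (n - i) := by
        refine (hV x N _ hk0).trans (mul_le_mul_of_nonneg_right ?_ (vt_pos hk0).le)
        refine mul_le_mul_of_nonneg_left (pow_le_pow_left₀ (by positivity) ?_ _) hQ0.le
        have : E / ((n - i : ℕ) : ℝ) ≤ 4 / δ := by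
          rw [div_le_div_iff₀ hk0' hδ0]; linarith
        linarith
      calc G.heatKernel (n - i) x y * G.Vn x N
          ≤ G.heatKernel (n - i) x y * (b * G.vt x (n - i)) :=
            mul_le_mul_of_nonneg_left h2 (heatKernel_nonneg _ _ _)
        _ = b * (G.heatKernel (n - i) x y * G.vt x (n - i)) := by ring
        _ ≤ b * K := mul_le_mul_of_nonneg_left (hU1 x y _ hk0) hb0.le
        _ = K * b := mul_comm _ _
    have h2 : (s + 1) * ((G.L (G.bf x N) ^ n) f x * G.Vn x N) ≤
        K * b * ∑ i ∈ Finset.Icc m n, S i := by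
      calc (s + 1) * ((G.L (G.bf x N) ^ n) f x * G.Vn x N)
          = ∑ _i ∈ Finset.Icc m (m + s), (G.L (G.bf x N) ^ n) f x * G.Vn x N := by
            rw [Finset.sum_const, Nat.card_Icc, nsmul_eq_mul,
              show m + s + 1 - m = s + 1 by omega]
            push_cast; rfl
        _ ≤ ∑ i ∈ Finset.Icc m (m + s), K * b * S i := Finset.sum_le_sum h1
        _ ≤ ∑ i ∈ Finset.Icc m n, K * b * S i :=
            Finset.sum_le_sum_of_subset_of_nonneg (Finset.Icc_subset_Icc_right (by omega))
              fun i _ _ => mul_nonneg (by positivity) (hS0 i)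
        _ = _ := (Finset.mul_sum _ _ _).symm
    have hLV : 0 ≤ (G.L (G.bf x N) ^ n) f x * G.Vn x N := mul_nonneg hLn hV0.le
    calc (G.L (G.bf x N) ^ n) f x * (G.Vn x N * E)
        = 4 / δ * (δ * E / 4 * ((G.L (G.bf x N) ^ n) f x * G.Vn x N)) := by field_simp
      _ ≤ 4 / δ * (K * b * ∑ i ∈ Finset.Icc m n, S i) :=
          mul_le_mul_of_nonneg_left ((mul_le_mul_of_nonneg_right hsE hLV).trans h2)
            (by positivity)
      _ ≤ 4 / δ * ((K + 1) * b * ∑ i ∈ Finset.Icc m n, S i) := by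
          refine mul_le_mul_of_nonneg_left (mul_le_mul_of_nonneg_right ?_
            (Finset.sum_nonneg fun i _ => hS0 i)) (by positivity)
          exact mul_le_mul_of_nonneg_right (by linarith) hb0.le
      _ = _ := by ring

end Hyp

end

noncomputable section

variable {Γ : Type*} {G : WeightedGraph Γ} [Countable Γ] [Infinite Γ] [MeasurableSpace Γ]
  [DiscreteMeasurableSpace Γ] [FiniteBalls G] {p D C : ℝ} {A B : Finset Γ} {x y z : Γ}

/-! ### Localisation of the energy -/

/-- On functions supported in B, replace the kernel of A by that of A ∩ B'. The error has row sums
at most the probability of leaving B' from B, so Schur's test makes it a bounded form of norm η. -/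
theorem sum_sum_hk_le {B' : Finset Γ} {k : ℕ} {c η : ℝ} (hc : 0 ≤ c) (hη : 0 ≤ η)
    (hloc : ∀ f : Γ → ℝ, G.ip (A ∩ B') ((G.L (A ∩ B') ^ k) f) f ≤ c * G.ip (A ∩ B') f f)
    (hexit : ∀ y ∈ A ∩ B, 1 - G.surv B' k y ≤ η) (f : Γ → ℝ) :
    ∑ y ∈ A, ∑ z ∈ A, G.mass y * G.mass z * G.hk A k y z *
        ((ind B y * f y) * (ind B z * f z)) ≤
      (c + η) * G.ip A (fun y => ind B y * f y) (fun y => ind B y * f y) := by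
  set g : Γ → ℝ := fun y => ind B y * f y with hg
  have hsub : A ∩ B' ⊆ A := Finset.inter_subset_left
  have hind : ∀ y, ind B y * g y = g y := by
    intro y
    by_cases hy : y ∈ B
    · rw [ind_of_mem hy, one_mul]
    · simp [hg, ind_of_notMem hy]
  have hi0 : ∀ y, 0 ≤ ind B y ∧ ind B y ≤ 1 := fun y => by
    unfold ind; split_ifs <;> norm_num
  have hΔ : ∀ y z, 0 ≤ G.hk A k y z - G.hk (A ∩ B') k y z := fun y z =>
    sub_nonneg.2 (hk_mono_set hsub k y z)
  have h1 : ∑ y ∈ A, ∑ z ∈ A, G.mass y * G.mass z * G.hk (A ∩ B') k y z * (g y * g z) ≤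
      c * G.ip A g g := by
    have h2 := hloc g
    rw [ip_L_pow_eq_sum] at h2
    have h3 : G.ip (A ∩ B') g g ≤ G.ip A g g :=
      Finset.sum_le_sum_of_subset_of_nonneg hsub fun y _ _ =>
        mul_nonneg (mass_nonneg y) (mul_self_nonneg _)
    refine le_trans (le_of_eq ?_) (h2.trans (mul_le_mul_of_nonneg_left h3 hc))
    symm
    rw [← Finset.sum_subset hsub]
    · refine Finset.sum_congr rfl fun y _ => Finset.sum_subset hsub fun z _ hz => ?_
      rw [hk_of_notMem_right hz]; ring
    · intro y _ hy
      exact Finset.sum_eq_zero fun z _ => by rw [hk_of_notMem_left hy]; ring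
  have h2 := schur (G := G) (A := A)
    (fun y z => ind B y * ind B z * (G.hk A k y z - G.hk (A ∩ B') k y z))
    (fun y _ z _ => mul_nonneg (mul_nonneg (hi0 y).1 (hi0 z).1) (hΔ y z))
    (fun y _ z _ => by rw [hk_comm A, hk_comm (A ∩ B')]; ring) (c := η) (fun y hy => ?_) g
  · rw [add_mul]
    refine le_trans (le_of_eq ?_) (add_le_add h1 h2)
    rw [← Finset.sum_add_distrib]
    refine Finset.sum_congr rfl fun y _ => ?_
    rw [← Finset.sum_add_distrib]
    refine Finset.sum_congr rfl fun z _ => ?_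
    have h3 := hind y
    have h4 := hind z
    change G.mass y * G.mass z * G.hk A k y z * (g y * g z) = _
    calc _ = G.mass y * G.mass z * G.hk (A ∩ B') k y z * (g y * g z) + G.mass y * G.mass z *
          (G.hk A k y z - G.hk (A ∩ B') k y z) * ((ind B y * g y) * (ind B z * g z)) := by
          rw [h3, h4]; ring
      _ = _ := by ring
  · by_cases hyB : y ∈ B
    swap
    · refine le_trans (le_of_eq (Finset.sum_eq_zero fun z _ => ?_)) hη
      rw [ind_of_notMem hyB]; ring
    calc ∑ z ∈ A, G.mass z * (ind B y * ind B z * (G.hk A k y z - G.hk (A ∩ B') k y z))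
        ≤ ∑ z ∈ A, (G.mass z * G.hk A k y z - G.mass z * G.hk (A ∩ B') k y z) := by
          refine Finset.sum_le_sum fun z _ => ?_
          rw [← mul_sub]
          refine mul_le_mul_of_nonneg_left ?_ (mass_nonneg z)
          exact mul_le_of_le_one_left (hΔ y z) (mul_le_one₀ (hi0 y).2 (hi0 z).1 (hi0 z).2)
      _ = G.surv A k y - G.surv (A ∩ B') k y := by
          rw [Finset.sum_sub_distrib, ← surv_eq_sum_hk hy]
          congr 1
          by_cases hyA : y ∈ A ∩ B'
          · rw [surv_eq_sum_hk hyA]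
            exact (Finset.sum_subset hsub fun z _ hz => by
              rw [hk_of_notMem_right hz, mul_zero]).symm
          · rw [surv_of_notMem hyA]
            exact Finset.sum_eq_zero fun z _ => by rw [hk_of_notMem_left hyA, mul_zero]
      _ ≤ 1 - G.surv B' k y := by
          have := surv_le_surv_inter_add (G := G) A B' k y; linarith
      _ ≤ η := hexit y (Finset.mem_inter.2 ⟨hy, hyB⟩)

/-- An energy bound for the killed walk from energy bounds on the pieces of a cover. -/
theorem ip_L_pow_le_of_cover {X : Finset Γ} {Bx Dx : Γ → Finset Γ} {ω : Γ → ℝ} {k : ℕ}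
    {c η η' a b : ℝ} (hc : 0 ≤ c) (hη : 0 ≤ η) (ha : 0 < a) (hω : ∀ x, 0 ≤ ω x)
    (hloc : ∀ x ∈ X, (A ∩ Bx x).Nonempty → ∀ f : Γ → ℝ,
      G.ip (A ∩ Dx x) ((G.L (A ∩ Dx x) ^ k) f) f ≤ c * G.ip (A ∩ Dx x) f f)
    (hexit : ∀ x ∈ X, ∀ y ∈ A ∩ Bx x, 1 - G.surv (Dx x) k y ≤ η)
    (hb : ∀ y ∈ A, ∑ x ∈ X, ω x * ind (Bx x) y ≤ b)
    (hfar : ∀ y ∈ A, ∑ z ∈ A, G.mass z *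
      (if ∑ x ∈ X, ω x * (ind (Bx x) y * ind (Bx x) z) < a then G.hk A k y z else 0) ≤ η')
    {f : Γ → ℝ} (hf : ∀ y ∈ A, 0 ≤ f y) :
    G.ip A ((G.L A ^ k) f) f ≤ (b * (c + η) / a + η') * G.ip A f f := by
  -- The weight with which the cover sees the pair (y,z). Pairs with W ≥ a are charged to the
  -- localised forms, with overlap b; the others form a kernel with small row sums.
  set W : Γ → Γ → ℝ := fun y z => ∑ x ∈ X, ω x * (ind (Bx x) y * ind (Bx x) z) with hW
  have hWc : ∀ y z, W y z = W z y := fun y z =>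
    Finset.sum_congr rfl fun x _ => by rw [mul_comm (ind (Bx x) y)]
  have hi0 : ∀ (S : Finset Γ) (y : Γ), 0 ≤ ind S y := fun S y => by
    unfold ind; split_ifs <;> norm_num
  have hW0 : ∀ y z, 0 ≤ W y z := fun y z => Finset.sum_nonneg fun x _ =>
    mul_nonneg (hω x) (mul_nonneg (hi0 _ y) (hi0 _ z))
  have hfar' := schur (G := G) (A := A) (fun y z => if W y z < a then G.hk A k y z else 0)
    (fun y _ z _ => by
      split_ifs
      · exact hk_nonneg A k y z
      · exact le_rfl) (fun y _ z _ => by rw [hWc y z, hk_comm A k y z]) hfar f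
  have hnear : ∑ y ∈ A, ∑ z ∈ A, W y z * (G.mass y * G.mass z * G.hk A k y z * (f y * f z)) ≤
      b * (c + η) * G.ip A f f := by
    have h1 : ∀ x ∈ X, ω x * ∑ y ∈ A, ∑ z ∈ A, G.mass y * G.mass z * G.hk A k y z *
        ((ind (Bx x) y * f y) * (ind (Bx x) z * f z)) ≤
        ω x * ((c + η) * ∑ y ∈ A, G.mass y * (ind (Bx x) y * (f y * f y))) := by
      intro x hx
      refine mul_le_mul_of_nonneg_left ?_ (hω x)
      by_cases hne : (A ∩ Bx x).Nonempty
      · refine (sum_sum_hk_le hc hη (hloc x hx hne) (hexit x hx) f).trans (le_of_eq ?_)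
        congr 1
        refine Finset.sum_congr rfl fun y _ => ?_
        beta_reduce
        by_cases hy : y ∈ Bx x
        · rw [ind_of_mem hy]; ring
        · rw [ind_of_notMem hy]; ring
      · refine le_trans (le_of_eq (Finset.sum_eq_zero fun y hy => Finset.sum_eq_zero fun z _ => ?_))
          (mul_nonneg (add_nonneg hc hη) (Finset.sum_nonneg fun y _ => mul_nonneg (mass_nonneg y)
            (mul_nonneg (hi0 _ y) (mul_self_nonneg _))))
        rw [ind_of_notMem fun hyB => hne ⟨y, Finset.mem_inter.2 ⟨hy, hyB⟩⟩]; ring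
    calc ∑ y ∈ A, ∑ z ∈ A, W y z * (G.mass y * G.mass z * G.hk A k y z * (f y * f z))
        = ∑ x ∈ X, ω x * ∑ y ∈ A, ∑ z ∈ A, G.mass y * G.mass z * G.hk A k y z *
            ((ind (Bx x) y * f y) * (ind (Bx x) z * f z)) := by
          simp only [hW, Finset.sum_mul, Finset.mul_sum]
          symm
          rw [Finset.sum_comm]
          refine Finset.sum_congr rfl fun y _ => ?_
          rw [Finset.sum_comm]
          exact Finset.sum_congr rfl fun z _ => Finset.sum_congr rfl fun x _ => by ring
      _ ≤ ∑ x ∈ X, ω x * ((c + η) * ∑ y ∈ A, G.mass y * (ind (Bx x) y * (f y * f y))) :=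
          Finset.sum_le_sum h1
      _ = (c + η) * ∑ y ∈ A, (∑ x ∈ X, ω x * ind (Bx x) y) * (G.mass y * (f y * f y)) := by
          simp only [Finset.sum_mul, Finset.mul_sum]
          rw [Finset.sum_comm]
          exact Finset.sum_congr rfl fun y _ => Finset.sum_congr rfl fun x _ => by ring
      _ ≤ (c + η) * ∑ y ∈ A, b * (G.mass y * (f y * f y)) :=
          mul_le_mul_of_nonneg_left (Finset.sum_le_sum fun y hy => mul_le_mul_of_nonneg_right
            (hb y hy) (mul_nonneg (mass_nonneg y) (mul_self_nonneg _))) (add_nonneg hc hη)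
      _ = _ := by rw [← Finset.mul_sum, ip]; ring
  have hsplit : G.ip A ((G.L A ^ k) f) f ≤
      (∑ y ∈ A, ∑ z ∈ A, W y z * (G.mass y * G.mass z * G.hk A k y z * (f y * f z))) / a +
      ∑ y ∈ A, ∑ z ∈ A, G.mass y * G.mass z * (if W y z < a then G.hk A k y z else 0) *
        (f y * f z) := by
    rw [ip_L_pow_eq_sum, Finset.sum_div, ← Finset.sum_add_distrib]
    refine Finset.sum_le_sum fun y hy => ?_
    rw [Finset.sum_div, ← Finset.sum_add_distrib]
    refine Finset.sum_le_sum fun z hz => ?_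
    have h0 : 0 ≤ G.mass y * G.mass z * G.hk A k y z * (f y * f z) :=
      mul_nonneg (mul_nonneg (mul_nonneg (mass_nonneg y) (mass_nonneg z)) (hk_nonneg A k y z))
        (mul_nonneg (hf y hy) (hf z hz))
    split_ifs with hlt
    · exact le_add_of_nonneg_left (div_nonneg (mul_nonneg (hW0 y z) h0) ha.le)
    · rw [mul_zero, zero_mul, add_zero, le_div_iff₀ ha, mul_comm]
      exact mul_le_mul_of_nonneg_right (not_lt.1 hlt) h0
  calc _ ≤ _ := hsplit
    _ ≤ b * (c + η) * G.ip A f f / a + η' * G.ip A f f :=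
        add_le_add (div_le_div_of_nonneg_right hnear ha.le) hfar'
    _ = _ := by ring

/-! ### Energy bounds in balls from the parabolic mean value inequality -/

namespace Hyp

variable (h : G.Hyp p D C)
include h

/-- Apply the inequality in B(y,2r) to the evolution of the indicator of A. Its mass never exceeds
μ(A), the window has at most (c₂ + 1)E times, and the value at y dominates survival in A. -/
theorem exists_surv_mul_le {c₁ c₂ : ℝ} (hc₂ : 0 < c₂) (hM : G.ParabolicMeanValue c₁ c₂) :
    ∃ K : ℝ, 0 < K ∧ ∀ (x : Γ) (r n : ℕ) (A : Finset Γ), 0 < r → A ⊆ G.bf x r →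
      c₂ * C * G.En x r ≤ n → ∀ y ∈ A, G.surv A n y * G.Vn x r ≤ K * G.vol A := by
  obtain ⟨K, hK, hM⟩ := parabolicMeanValue_iff.1 hM
  refine ⟨K * (c₂ + 1), by positivity, fun x r n A hr hA hn y hy => ?_⟩
  have hyx : G.graph.dist x y < r := mem_bf.1 (hA hy)
  have hyx' : G.graph.dist y x < r := by rwa [SimpleGraph.dist_comm]
  set B := G.bf y (2 * r) with hB
  have hxB : G.bf x r ⊆ B := bf_subset_bf (by omega)
  have hAB : A ⊆ B := hA.trans hxB
  have h2r : 0 < 2 * r := by omega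
  set E := G.En y (2 * r) with hE
  have hE1 : 1 ≤ E := by
    have h1 : ((1 : ℕ) : ℝ) ≤ ((2 * r : ℕ) : ℝ) := Nat.cast_le.2 h2r
    rw [Nat.cast_one] at h1
    exact h1.trans (le_En y (2 * r))
  have hE0 : 0 < E := by linarith
  set m := ⌊c₂ * E⌋₊ with hm
  have hmn : m ≤ n := by
    refine Nat.floor_le_of_le (le_trans ?_ hn)
    rw [mul_assoc]
    exact mul_le_mul_of_nonneg_left (h.tc y x r hyx') hc₂.le
  have hm1 : (m : ℝ) + 1 ≤ (c₂ + 1) * E := by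
    have := Nat.floor_le (mul_pos hc₂ hE0).le
    nlinarith
  have hind : ∀ z, 0 ≤ ind A z := fun z => by unfold ind; split_ifs <;> norm_num
  have h1 := hM y (2 * r) h2r (ind A) fun z _ => hind z
  have h2 : ∀ i, ∑ z ∈ B, (G.L B ^ i) (ind A) z * G.mass z ≤ G.vol A := by
    intro i
    calc ∑ z ∈ B, (G.L B ^ i) (ind A) z * G.mass z = G.ip B ((G.L B ^ i) (ind A)) (ind B) :=
          Finset.sum_congr rfl fun z hz => by rw [ind_of_mem hz]; ring
      _ = G.ip B (ind A) (G.surv B i) := ip_L_pow i _ _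
      _ ≤ ∑ z ∈ B, G.mass z * ind A z := Finset.sum_le_sum fun z _ =>
          mul_le_mul_of_nonneg_left (mul_le_of_le_one_right (hind z) (surv_le_one B i z))
            (mass_nonneg z)
      _ = ∑ z ∈ A, G.mass z * ind A z := (Finset.sum_subset hAB fun z _ hz => by
          rw [ind_of_notMem hz, mul_zero]).symm
      _ = G.vol A := Finset.sum_congr rfl fun z hz => by rw [ind_of_mem hz, mul_one]
  have hvol := vol_nonneg (G := G) A
  have h3 : ∑ i ∈ Finset.Icc ⌊c₁ * E⌋₊ m, ∑ z ∈ B, (G.L B ^ i) (ind A) z * G.mass z ≤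
      (c₂ + 1) * E * G.vol A := by
    calc _ ≤ ∑ _i ∈ Finset.Icc ⌊c₁ * E⌋₊ m, G.vol A := Finset.sum_le_sum fun i _ => h2 i
      _ = ((Finset.Icc ⌊c₁ * E⌋₊ m).card : ℝ) * G.vol A := by
          rw [Finset.sum_const, nsmul_eq_mul]
      _ ≤ (m + 1) * G.vol A := by
          refine mul_le_mul_of_nonneg_right ?_ hvol
          rw [Nat.card_Icc]
          exact_mod_cast Nat.sub_le _ _
      _ ≤ _ := mul_le_mul_of_nonneg_right hm1 hvol
  have h4 : G.surv A n y ≤ (G.L B ^ m) (ind A) y :=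
    (surv_antitone A y hmn).trans (L_pow_mono_set hAB (fun _ _ => le_rfl) (fun z _ => hind z) m y hy)
  have hV : G.Vn x r ≤ G.Vn y (2 * r) := vol_mono hxB
  have h5 : G.surv A n y * G.Vn x r * E ≤ K * (c₂ + 1) * G.vol A * E := by
    calc G.surv A n y * G.Vn x r * E
        ≤ (G.L B ^ m) (ind A) y * G.Vn y (2 * r) * E := by
          refine mul_le_mul_of_nonneg_right ?_ hE0.le
          exact mul_le_mul h4 hV (Vn_pos hr).le ((surv_nonneg A n y).trans h4)
      _ = (G.L B ^ m) (ind A) y * (G.Vn y (2 * r) * E) := by ring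
      _ ≤ K * ((c₂ + 1) * E * G.vol A) := h1.trans (mul_le_mul_of_nonneg_left h3 hK.le)
      _ = _ := by ring
  exact le_of_mul_le_mul_right h5 hE0

/-- Survival is controlled only at times of order E, possibly much longer than k. The bound is
obtained at time 2ʲk with constant c^(2ʲ) and brought back to k by Jensen. -/
theorem exists_ip_L_pow_le {c₁ c₂ : ℝ} (hc₂ : 0 < c₂) (hM : G.ParabolicMeanValue c₁ c₂)
    {c Λ : ℝ} (hc : 0 < c) : ∃ ε : ℝ, 0 < ε ∧
      ∀ (x : Γ) (r k : ℕ) (A : Finset Γ), 0 < r → A ⊆ G.bf x r → G.En x r ≤ Λ * k →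
        G.vol A ≤ ε * G.Vn x r → ∀ f : Γ → ℝ, G.ip A ((G.L A ^ k) f) f ≤ c * G.ip A f f := by
  obtain ⟨K, hK, hs⟩ := h.exists_surv_mul_le hc₂ hM
  obtain ⟨j, hj⟩ := pow_unbounded_of_one_lt (c₂ * C * Λ) (one_lt_two (α := ℝ))
  refine ⟨c ^ (2 ^ j) / K, by positivity, fun x r k A hr hA hE hvol f => ?_⟩
  refine ip_L_pow_jensen k j hc.le (ip_L_pow_le _ (fun y hy => ?_) f)
  have hV := Vn_pos (G := G) (x := x) hr
  refine le_of_mul_le_mul_right ((hs x r _ A hr hA ?_ y hy).trans ?_) hV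
  · push_cast
    calc c₂ * C * G.En x r ≤ c₂ * C * (Λ * k) :=
          mul_le_mul_of_nonneg_left hE (mul_pos hc₂ h.C_pos).le
      _ = c₂ * C * Λ * k := by ring
      _ ≤ _ := mul_le_mul_of_nonneg_right hj.le (Nat.cast_nonneg k)
  · calc K * G.vol A ≤ K * (c ^ (2 ^ j) / K * G.Vn x r) := mul_le_mul_of_nonneg_left hvol hK.le
      _ = _ := by field_simp

end Hyp

end

noncomputable section

variable {Γ : Type*} {G : WeightedGraph Γ} [Countable Γ] [Infinite Γ] [MeasurableSpace Γ]
  [DiscreteMeasurableSpace Γ] [FiniteBalls G] {p D C : ℝ} {A B : Finset Γ} {x y z : Γ}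

/-! ### The Faber–Krahn inequality from the parabolic mean value inequality -/

namespace Hyp

variable (h : G.Hyp p D C)
include h

theorem En_en_le_of_dist_lt {T : ℕ} (hT : 0 < T) (hd : G.graph.dist x y < G.en x T) :
    G.En y (G.en x T) ≤ C ^ 2 * T := by
  rw [SimpleGraph.dist_comm] at hd
  calc G.En y (G.en x T) ≤ C * G.En x (G.en x T) := h.En_le_of_dist_lt hd
    _ ≤ C * (C * T) := mul_le_mul_of_nonneg_left (h.En_en_le x hT) h.C_pos.le
    _ = _ := by ring

/-- Otherwise growth over q scales would make E(y,e(x,T)) exceed C²T, against time comparison. -/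
theorem en_lt_of_dist_lt {q T : ℕ} (hq : C ^ 2 < (1 + 1 / C) ^ q) (hT : 0 < T)
    (hd : G.graph.dist x y < G.en x T) : G.en x T < 4 ^ q * G.en y T := by
  by_contra hle
  have hT0 : (0 : ℝ) < T := Nat.cast_pos.2 hT
  have h1 := (En_mono (x := y) (not_lt.1 hle)).trans (h.En_en_le_of_dist_lt hT hd)
  have h2 : (1 + 1 / C) ^ q * (T : ℝ) ≤ C ^ 2 * T :=
    (mul_le_mul_of_nonneg_left (le_En_en y T) (by have := h.C_pos; positivity)).trans
      ((h.le_En_pow_four_mul y q _).trans h1)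
  have := le_of_mul_le_mul_right h2 hT0
  linarith

/-- Because S is much smaller than T, the balls B(x,e(x,T)) centred near y contain all of
B(y,e(y,S)). -/
theorem two_mul_en_le {S T : ℕ} (hS : 0 < S) (hST : C ^ 2 * S < T)
    (hd : G.graph.dist x y < G.en y S) :
    G.En x (2 * G.en y S) < T ∧ 2 * G.en y S ≤ G.en x T := by
  have h1 : G.En x (2 * G.en y S) < T := by
    calc G.En x (2 * G.en y S) ≤ C * G.En y (G.en y S) := h.tc x y _ hd
      _ ≤ C * (C * S) := mul_le_mul_of_nonneg_left (h.En_en_le y hS) h.C_pos.le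
      _ = C ^ 2 * S := by ring
      _ < T := hST
  refine ⟨h1, ?_⟩
  have h2 : 2 * G.en y S - 1 < G.en x T :=
    lt_en_iff.2 ((En_mono (Nat.sub_le _ _)).trans_lt h1)
  omega

/-- The set A need not lie in one ball, so it is covered by the balls B(x,e(x,T)) with weights
μ(x)/V(x,e(x,T)), a discrete substitute for a partition of unity. Overlaps are bounded by b; pairs
(y,z) with z in B(y,e(y,S)) get weight at least a; farther pairs are reached by time k with
probability at most η. -/
theorem faberKrahn_of_parabolicMeanValue {c₁ c₂ : ℝ} (hc₂ : 0 < c₂)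
    (hM : G.ParabolicMeanValue c₁ c₂) : G.FaberKrahn := by
  obtain ⟨Q, γ, hQ, -, hvx, hvt⟩ := h.exists_growth
  obtain ⟨q, hq⟩ := pow_unbounded_of_one_lt (C ^ 2) h.one_lt_ratio
  have hC := h.two_le_C
  have hC0 := h.C_pos
  have hD0 := h.D_pos
  have hQ0 : 0 < Q := by linarith
  set Q₁ := Q * (1 + (C ^ 2) ^ q * C) ^ γ with hQ₁
  have hQ₁0 : 0 < Q₁ := by positivity
  set b := Q₁ * (D ^ 2) ^ q with hb
  have hb0 : 0 < b := by positivity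
  set Q₂ := Q * 2 ^ γ * (Q * (1 + (C ^ 2 + 2)) ^ γ) with hQ₂
  have hQ₂0 : 0 < Q₂ := by positivity
  set a := 1 / Q₂ with ha
  have ha0 : 0 < a := by positivity
  -- Makes b(η + η)/a + η at most 1/4 + 1/4, the drop required by `ip_L_L_le_of_half`.
  set η := min (a / (8 * b)) (1 / 4) with hη
  have hη0 : 0 < η := lt_min (by positivity) (by norm_num)
  obtain ⟨Λ₀, hΛ₀, hexit⟩ := h.exists_exit_le hη0
  have hΛ₀1 : (1 : ℝ) ≤ Λ₀ := by exact_mod_cast hΛ₀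
  -- Large enough for C²S < T with S = Λ₀k and T = Λk, yet with T/S bounded so that volumes at the
  -- two scales are comparable.
  set Λ := ⌈C ^ 2 * Λ₀⌉₊ + 1 with hΛ
  have hΛ1 : C ^ 2 * Λ₀ < Λ := by
    rw [hΛ]; push_cast
    linarith [Nat.le_ceil (C ^ 2 * (Λ₀ : ℝ))]
  have hΛ2 : (Λ : ℝ) ≤ (C ^ 2 + 2) * Λ₀ := by
    rw [hΛ]; push_cast
    have := Nat.ceil_lt_add_one (show 0 ≤ C ^ 2 * (Λ₀ : ℝ) by positivity)
    linarith
  obtain ⟨ε', hε', hloc⟩ := h.exists_ip_L_pow_le hc₂ hM (c := η) (Λ := C ^ 2 * Λ) hη0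
  set Q₃ := Q * (1 + C ^ 2) ^ γ with hQ₃
  have hQ₃0 : 0 < Q₃ := by positivity
  refine ⟨ε' / Q₃, 1 / 4, by positivity, by norm_num, fun n A hn hA f hf => ?_⟩
  obtain ⟨i, hi1, hi2⟩ := exists_pow_two n hn
  refine ip_L_L_le_of_half hn hi2 f ?_
  set k := 2 ^ i * 2 with hk
  have hk0 : 0 < k := by positivity
  have hkr : (0 : ℝ) < k := Nat.cast_pos.2 hk0
  set T := Λ * k with hT
  set S := Λ₀ * k with hS
  have hT0 : 0 < T := by positivity
  have hS0 : 0 < S := by positivity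
  have hTr : (0 : ℝ) < T := Nat.cast_pos.2 hT0
  have hSr : (0 : ℝ) < S := Nat.cast_pos.2 hS0
  have hTc : (T : ℝ) = Λ * k := by rw [hT]; push_cast; rfl
  have hSc : (S : ℝ) = Λ₀ * k := by rw [hS]; push_cast; rfl
  have hST : C ^ 2 * S < T := by
    rw [hTc, hSc, ← mul_assoc]; exact mul_lt_mul_of_pos_right hΛ1 hkr
  have hTS : (T : ℝ) / S ≤ C ^ 2 + 2 := by
    rw [div_le_iff₀ hSr, hTc, hSc, ← mul_assoc]; exact mul_le_mul_of_nonneg_right hΛ2 hkr.le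
  have hnT : n ≤ T := by
    have h1 : n ≤ k := by omega
    exact h1.trans (Nat.le_mul_of_pos_left k (by omega))
  -- A finite set of centres: the first balls contain every centre whose ball meets A, as the
  -- overlap bound requires, and the second those giving the lower bound a for near pairs.
  set X := A.biUnion fun y => G.bf y (4 ^ q * G.en y T) ∪ G.bf y (G.en y S) with hX
  have hX1 : ∀ y ∈ A, G.bf y (4 ^ q * G.en y T) ⊆ X := fun y hy =>
    Finset.subset_union_left.trans (Finset.subset_biUnion_of_mem
      (fun y => G.bf y (4 ^ q * G.en y T) ∪ G.bf y (G.en y S)) hy)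
  have hX2 : ∀ y ∈ A, G.bf y (G.en y S) ⊆ X := fun y hy =>
    Finset.subset_union_right.trans (Finset.subset_biUnion_of_mem
      (fun y => G.bf y (4 ^ q * G.en y T) ∪ G.bf y (G.en y S)) hy)
  have hi0 : ∀ (U : Finset Γ) (y : Γ), 0 ≤ ind U y := fun U y => by
    unfold ind; split_ifs <;> norm_num
  have hω : ∀ x, 0 ≤ G.mass x / G.vt x T := fun x => div_nonneg (mass_nonneg x) (vt_pos hT0).le
  have key := ip_L_pow_le_of_cover (G := G) (A := A) (X := X) (Bx := fun x => G.bf x (G.en x T))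
    (Dx := fun x => G.bf x (2 * G.en x T)) (ω := fun x => G.mass x / G.vt x T) (k := k)
    (c := η) (η := η) (η' := η) (a := a) (b := b) hη0.le hη0.le ha0 hω ?_ ?_ ?_ ?_ hf
  · refine key.trans (mul_le_mul_of_nonneg_right ?_ (ip_self_nonneg A f))
    have h1 : η ≤ a / (8 * b) := min_le_left _ _
    have h2 : η ≤ 1 / 4 := min_le_right _ _
    have h3 : b * (η + η) / a ≤ 1 / 4 := by
      rw [div_le_iff₀ ha0]
      rw [le_div_iff₀ (by positivity)] at h1
      linarith
    linarith
  · rintro x - ⟨y, hy⟩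
    obtain ⟨hyA, hyB⟩ := Finset.mem_inter.1 hy
    rw [mem_bf] at hyB
    have hen := en_pos (G := G) (x := x) hT0
    refine hloc x (2 * G.en x T) k _ (by omega) Finset.inter_subset_right ?_ ?_
    · calc G.En x (2 * G.en x T) ≤ C * G.En x (G.en x T) := h.En_two_mul_le x _
        _ ≤ C * (C * T) := mul_le_mul_of_nonneg_left (h.En_en_le x hT0) hC0.le
        _ = _ := by rw [hTc]; ring
    · have h1 : G.vt y T ≤ Q₃ * G.vt x T := by
        refine (hvx y x (G.en x T) T hT0 (by rwa [SimpleGraph.dist_comm])).trans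
          (mul_le_mul_of_nonneg_right (mul_le_mul_of_nonneg_left (pow_le_pow_left₀
            (add_nonneg zero_le_one (div_nonneg (En_nonneg _ _) hTr.le)) ?_ _) hQ0.le)
            (vt_pos hT0).le)
        have := (div_le_iff₀ hTr).2 (h.En_en_le_of_dist_lt hT0 hyB)
        linarith
      calc G.vol (A ∩ G.bf x (2 * G.en x T)) ≤ G.vol A := vol_mono Finset.inter_subset_left
        _ ≤ ε' / Q₃ * G.vt y n := hA y hyA
        _ ≤ ε' / Q₃ * (Q₃ * G.vt x T) :=
            mul_le_mul_of_nonneg_left ((vt_mono hnT).trans h1) (by positivity)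
        _ = ε' * G.vt x T := by field_simp
        _ ≤ _ := mul_le_mul_of_nonneg_left (Vn_mono (by omega)) hε'.le
  · rintro x - y hy
    have hyB := mem_bf.1 (Finset.mem_inter.1 hy).2
    have h1 : (Λ₀ * k : ℝ) ≤ G.En y (G.en x T) := by
      have h2 : (T : ℝ) ≤ C * G.En y (G.en x T) :=
        (le_En_en x T).trans (h.En_le_of_dist_lt hyB)
      have h3 : C * (S : ℝ) ≤ C * G.En y (G.en x T) := by
        have : C * (S : ℝ) ≤ C ^ 2 * S :=
          mul_le_mul_of_nonneg_right (le_self_pow₀ (by linarith) (by norm_num)) hSr.le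
        linarith
      rw [← hSc]
      exact le_of_mul_le_mul_left h3 hC0
    have h2 := hexit y (G.en x T) k hk0 h1
    have h3 := surv_mono_set (G := G) (bf_subset_bf (G := G)
      (show G.graph.dist x y + G.en x T ≤ 2 * G.en x T by omega)) k y
    linarith
  · intro y hy
    set N := 4 ^ q * G.en y T with hN
    have hvy := vt_pos (G := G) (x := y) hT0
    have h1 : ∑ x ∈ X, G.mass x / G.vt x T * ind (G.bf x (G.en x T)) y =
        ∑ x ∈ G.bf y N, G.mass x / G.vt x T * ind (G.bf x (G.en x T)) y := by
      refine (Finset.sum_subset (hX1 y hy) fun x _ hx => ?_).symm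
      rw [ind_of_notMem, mul_zero]
      intro hxy
      rw [mem_bf] at hx hxy
      have := h.en_lt_of_dist_lt hq hT0 hxy
      rw [SimpleGraph.dist_comm] at hxy
      omega
    have h2 : ∀ x ∈ G.bf y N, G.mass x / G.vt x T * ind (G.bf x (G.en x T)) y ≤
        G.mass x * (Q₁ / G.vt y T) := by
      intro x hx
      have h3 : G.vt y T ≤ Q₁ * G.vt x T := by
        refine (hvx y x N T hT0 (mem_bf.1 hx)).trans
          (mul_le_mul_of_nonneg_right (mul_le_mul_of_nonneg_left (pow_le_pow_left₀
            (add_nonneg zero_le_one (div_nonneg (En_nonneg _ _) hTr.le)) ?_ _) hQ0.le)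
            (vt_pos hT0).le)
        have h4 : G.En y N ≤ (C ^ 2) ^ q * C * T := by
          calc G.En y N ≤ (C ^ 2) ^ q * G.En y (G.en y T) := h.En_pow_four_mul_le y q _
            _ ≤ (C ^ 2) ^ q * (C * T) :=
                mul_le_mul_of_nonneg_left (h.En_en_le y hT0) (by positivity)
            _ = _ := by ring
        have := (div_le_iff₀ hTr).2 h4
        linarith
      have hind1 : ind (G.bf x (G.en x T)) y ≤ 1 := by unfold ind; split_ifs <;> norm_num
      refine (mul_le_of_le_one_right (hω x) hind1).trans ?_
      rw [div_eq_mul_one_div]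
      refine mul_le_mul_of_nonneg_left ?_ (mass_nonneg x)
      rw [div_le_div_iff₀ (vt_pos hT0) hvy]
      linarith
    rw [h1]
    refine (Finset.sum_le_sum h2).trans ?_
    rw [← Finset.sum_mul]
    calc (∑ x ∈ G.bf y N, G.mass x) * (Q₁ / G.vt y T)
        ≤ (D ^ 2) ^ q * G.vt y T * (Q₁ / G.vt y T) :=
          mul_le_mul_of_nonneg_right (h.Vn_pow_four_mul_le y q _) (by positivity)
      _ = b := by rw [hb]; field_simp
  · intro y hy
    set s := G.en y S with hs
    have hvS := vt_pos (G := G) (x := y) hS0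
    have hnear : ∀ z ∈ G.bf y s, a ≤ ∑ x ∈ X, G.mass x / G.vt x T *
        (ind (G.bf x (G.en x T)) y * ind (G.bf x (G.en x T)) z) := by
      intro z hz
      have h1 : ∀ x ∈ G.bf y s, G.mass x * (a / G.vt y S) ≤ G.mass x / G.vt x T *
          (ind (G.bf x (G.en x T)) y * ind (G.bf x (G.en x T)) z) := by
        intro x hx
        have hd : G.graph.dist x y < s := by
          rw [mem_bf, SimpleGraph.dist_comm] at hx; exact hx
        obtain ⟨h2, h3⟩ := h.two_mul_en_le hS0 hST hd
        rw [← hs] at h2 h3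
        have hz' := mem_bf.1 hz
        have htri := dist_triangle (G := G) x y z
        rw [ind_of_mem (by rw [mem_bf]; omega), ind_of_mem (by rw [mem_bf]; omega), mul_one,
          mul_one, div_eq_mul_one_div (G.mass x)]
        refine mul_le_mul_of_nonneg_left ?_ (mass_nonneg x)
        have h4 : G.vt x T ≤ Q * 2 ^ γ * G.vt y T := by
          refine (hvx x y s T hT0 hd).trans
            (mul_le_mul_of_nonneg_right (mul_le_mul_of_nonneg_left (pow_le_pow_left₀
              (add_nonneg zero_le_one (div_nonneg (En_nonneg _ _) hTr.le)) ?_ _) hQ0.le)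
              (vt_pos hT0).le)
          have h5 : G.En x s ≤ 1 * T := by
            rw [one_mul]
            exact (En_mono (by omega)).trans h2.le
          have := (div_le_iff₀ hTr).2 h5
          linarith
        have h5 : G.vt y T ≤ Q * (1 + (C ^ 2 + 2)) ^ γ * G.vt y S := by
          refine (hvt y T S hS0 hT0).trans
            (mul_le_mul_of_nonneg_right (mul_le_mul_of_nonneg_left (pow_le_pow_left₀
              (by positivity) (by linarith) _) hQ0.le) hvS.le)
        have h6 : G.vt x T ≤ Q₂ * G.vt y S := by
          calc G.vt x T ≤ Q * 2 ^ γ * G.vt y T := h4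
            _ ≤ Q * 2 ^ γ * (Q * (1 + (C ^ 2 + 2)) ^ γ * G.vt y S) :=
                mul_le_mul_of_nonneg_left h5 (by positivity)
            _ = _ := by rw [hQ₂]; ring
        rw [div_le_div_iff₀ hvS (vt_pos hT0), one_mul, ha, one_div_mul_eq_div,
          div_le_iff₀ hQ₂0, mul_comm]
        exact h6
      calc a = (∑ x ∈ G.bf y s, G.mass x) * (a / G.vt y S) :=
            (mul_div_cancel₀ a hvS.ne').symm
        _ = ∑ x ∈ G.bf y s, G.mass x * (a / G.vt y S) := Finset.sum_mul _ _ _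
        _ ≤ _ := Finset.sum_le_sum h1
        _ ≤ _ := Finset.sum_le_sum_of_subset_of_nonneg (hX2 y hy) fun x _ _ =>
            mul_nonneg (hω x) (mul_nonneg (hi0 _ y) (hi0 _ z))
    refine le_trans ?_ ((sum_mass_mul_hk_sdiff_le A y s k).trans
      (hexit y s k hk0 (by rw [← hSc]; exact le_En_en y S)))
    rw [← Finset.sum_subset (Finset.sdiff_subset (s := A) (t := G.bf y s))]
    · refine Finset.sum_le_sum fun z _ => mul_le_mul_of_nonneg_left ?_ (mass_nonneg z)
      split_ifs
      · exact le_rfl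
      · exact hk_nonneg A k y z
    · intro z hzA hz
      have hz' : z ∈ G.bf y s := by
        by_contra hcon
        exact hz (Finset.mem_sdiff.2 ⟨hzA, hcon⟩)
      rw [if_neg (not_lt.2 (hnear z hz')), mul_zero]

end Hyp

/-! ### The hypotheses for balls of integer radius -/

theorem exists_hyp (hp : G.ControlledWeights) (hV : G.VolumeDoubling) (hT : G.TimeComparison) :
    ∃ p D C : ℝ, G.Hyp p D C := by
  obtain ⟨p, hp0, hp⟩ := hp
  obtain ⟨D, hD0, hV⟩ := hV
  obtain ⟨C, hC1, hT⟩ := hT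
  refine ⟨p, max D 1, max C 2, hp0, hp, le_max_right _ _, fun x N => ?_, le_max_right _ _,
    fun x y N hd => ?_⟩
  · rcases Nat.eq_zero_or_pos N with rfl | hN
    · simp [Vn, bf, vol]
    have h1 := hV x N (Nat.cast_pos.2 hN)
    rw [← Nat.cast_ofNat, ← Nat.cast_mul, V_natCast, V_natCast] at h1
    exact h1.trans (mul_le_mul_of_nonneg_right (le_max_left _ _) (Vn_pos hN).le)
  · have hN : 0 < N := by omega
    have h1 := hT x N (Nat.cast_pos.2 hN) y (by simpa [ball] using hd)
    rw [← Nat.cast_ofNat, ← Nat.cast_mul, E_natCast, E_natCast, div_le_iff₀ (En_pos hN)] at h1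
    exact h1.trans (mul_le_mul_of_nonneg_right (le_max_left _ _) (En_nonneg y N))

end

end WeightedGraph

/-! ### The equivalence -/

theorem mainTheorem1 {Γ : Type*} [Countable Γ] [Infinite Γ]
    [MeasurableSpace Γ] [DiscreteMeasurableSpace Γ] (G : WeightedGraph Γ)
    (hp₀ : G.ControlledWeights) (hVD : G.VolumeDoubling) (hTC : G.TimeComparison)
    (c₁ c₂ : ℝ) (hc₁ : 0 ≤ c₁) (hc₁₂ : c₁ < c₂) :
    List.TFAE [G.DiagonalUpperEstimate, G.UpperEstimate, G.ParabolicMeanValue c₁ c₂,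
      G.MeanValue, G.GreenMeanValue, G.GreenUpperBound] := by
  have := WeightedGraph.finiteBalls_of_controlledWeights hp₀
  obtain ⟨p, D, C, h⟩ := WeightedGraph.exists_hyp hp₀ hVD hTC
  tfae_have 1 → 2 := h.ue_of_due
  tfae_have 2 → 1 := WeightedGraph.due_of_ue
  tfae_have 2 → 3 := h.parabolicMeanValue_of_ue hc₁ hc₁₂
  tfae_have 3 → 1 := fun h3 =>
    h.due_of_faberKrahn (h.faberKrahn_of_parabolicMeanValue (hc₁.trans_lt hc₁₂) h3)
  tfae_have 2 → 6 := h.greenUpperBound_of_ue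
  tfae_have 6 → 4 := h.meanValue_of_greenUpperBound
  tfae_have 4 → 5 := WeightedGraph.greenMeanValue_of_meanValue
  tfae_have 5 → 6 := h.greenUpperBound_of_greenMeanValue
  tfae_have 6 → 1 := fun h6 => h.due_of_faberKrahn (h.faberKrahn_of_greenUpperBound h6)
  tfae_finish
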